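/- **Setting.** Let $D\ge 1$ be a square-free integer, $\mathcal O_D=\mathbb Z[w_D]=\mathbb Z+\mathbb Z w_D$ the ring of integers of $\mathbb Q(\sqrt{-D})$, where $w_D=\frac{1+i\sqrt D}{2}$ if $D\equiv 3 \bmod 4$ and $w_D=i\sqrt D$ otherwise, $\Lambda_D=\mathcal O_D\subset\mathbb C$ the corresponding lattice and $|\Lambda_D|$ the area of $\mathbb R^2/\Lambda_D$. Let $\Gamma=\mathbf{SL}(2,\mathcal O_D)$, let $\Gamma_\infty\subset\Gamma$ be the subgroup of upper triangular matrices and $\Gamma'_\infty\subset\Gamma_\infty$ the subgroup of those with both diagonal entries $1$; let $\widetilde\Gamma_\infty,\widetilde\Gamma'_\infty$ be the images of $\Gamma_\infty,\Gamma'_\infty$ in $\mathbf{PSL}(2,\mathbb C)$. The group $\mathbf{SL}(2,\mathbb C)$ acts on $\mathbb H^3=\{P=z+\lambda j : z\in\mathbb C,\lambda>0\}$, $\mathrm{Im}\,P:=\lambda$, by $$\begin{pmatrix}a&b\\c&d\end{pmatrix}(z+\lambda j)=\frac{(az+b)\overline{(cz+d)}+a\bar c\lambda^2}{|cz+d|^2+|c|^2\lambda^2}+\frac{\lambda}{|cz+d|^2+|c|^2\lambda^2}\,j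 .$$ Let $F_D\subset\mathbb H^3$ be a measurable fundamental domain for the action of $\Gamma$ (almost every orbit meets $F_D$, and $F_D\cap\gamma F_D$ is a null set for every $\gamma\in\Gamma\setminus\{\pm I\}$). For $\sigma\in\mathbf{SL}(2,\mathbb C)$ and $P=z+\lambda j$ let $R(d\sigma,P)=\frac{\lambda}{\mathrm{Im}\,\sigma P}\,d\sigma_P\in\mathbf{SO}(3)$. Let $T_1(\mathbb H^3)$ be the set of pairs $(P,v)$ with $P=z+\lambda j\in\mathbb H^3$ and $v\in\mathbb R^3$ of Euclidean norm $\lambda$, and $T_1(M_D)$ its quotient by the action $\gamma(P,v)=(\gamma P,d\gamma_P v)$ of $\Gamma$. A function $f:T_1(M_D)\to\mathbb C$ is in $C_0^\infty(T_1(M_D))$ if it has compact support and its lift to $T_1(\mathbb H^3)$, also written $f$, is smooth. Let $Y^l_m$ ($l\ge 0$, $-l\le m\le l$) be the standard orthonormal spherical harmonics on $S^2\subset\mathbb R^3$, and for $R\in\mathbf{SO}(3)$ let $D^l_{km}(R)$ be the Wigner matrix coefficients, given by $Y^l_m(R^{-1}p)=\sum_{k=-l}^{l}D^l_{km}(R)\,Y^l_k(p)$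 for $p\in S^2$. Put $e_1=(1,0,0)$ and, for $f\in C_0^\infty(T_1(M_D))$, $$\hat f^{\,l}_m(P)=\int_{S^2}f(P,\lambda p)\,\overline{Y^l_m(p)}\,dp\quad(P=z+\lambda j),\qquad \nu(\lambda)(f)=\frac1{|\Lambda_D|}\int_{\mathbb R^2/\Lambda_D}f(x+iy+\lambda j,\lambda e_1)\,dx\,dy,$$ $$\mathfrak M(f,s)=\int_0^\infty\nu(\lambda)(f)\,\lambda^{s-2}\,d\lambda,\qquad H^l_{km}(P,s)=\frac1{[\Gamma_\infty:\Gamma'_\infty]}\sum_{\sigma\in\Gamma'_\infty\backslash\Gamma}\overline{D^l_{km}\big(R(d\sigma,P)^{-1}\big)}\,(\mathrm{Im}\,\sigma P)^{1+s}.$$ **Proposition.** Let $f\in C_0^\infty(T_1(M_D))$ and $\mathrm{Re}(s)>1$. Then the integral defining $\mathfrak M(f,s)$, the series $H^l_{km}(P,s)$ ($P\in\mathbb H^3$) and the integrals over $F_D$ below are absolutely convergent, the outer series over $l$ is summable, and $$\mathfrak M(f,s)=\frac{[\widetilde\Gamma_\infty:\widetilde\Gamma'_\infty]}{|\Lambda_D|}\sum_{l=0}^\infty\sum_{m=-l}^l\sum_{k=-l}^l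 Y^l_m(e_1)\int_{F_D}\hat f^{\,l}_k(P)\,H^l_{km}(P,s)\,\frac{dx\,dy\,d\lambda}{\lambda^3}.$$ -/

import Mathlib

open MeasureTheory Set
open scoped ContDiff ComplexConjugate MatrixGroups

noncomputable section

namespace Bianchi

/-! ### The upper half-space and the action of `SL(2,ℂ)`

Euclidean space `ℝ³` is modelled as `ℂ × ℝ`: the point `(x, y, t)` is `(x + i y, t)`, so that
`e₁ = (1, 0)`, `e₂ = (i, 0)`, `e₃ = (0, 1)`. A point `z + λ j` of hyperbolic space is `(z, λ)`.
The Euclidean norm is always written out explicitly; the product norm of `ℂ × ℝ` is used only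
for its topology. -/

/-- Upper half-space `ℍ³`. -/
def H3 : Set (ℂ × ℝ) := {P | 0 < P.2}

/-- The denominator `Ω = |c z + d|² + |c|² λ²`. -/
def Om (σ : SL(2, ℂ)) (P : ℂ × ℝ) : ℝ :=
  Complex.normSq (σ 1 0 * P.1 + σ 1 1) + Complex.normSq (σ 1 0) * P.2 ^ 2

/-- The action of `SL(2,ℂ)` on `ℍ³` (meaningful for `P ∈ ℍ³`). -/
def act (σ : SL(2, ℂ)) (P : ℂ × ℝ) : ℂ × ℝ :=
  (((σ 0 0 * P.1 + σ 0 1) * conj (σ 1 0 * P.1 + σ 1 1) + σ 0 0 * conj (σ 1 0) * (P.2 : ℂ) ^ 2)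
      / (Om σ P : ℂ),
    P.2 / Om σ P)

/-- The differential `dσ_P` of the action at `P`. -/
def dAct (σ : SL(2, ℂ)) (P : ℂ × ℝ) : ℂ × ℝ →L[ℝ] ℂ × ℝ := fderiv ℝ (act σ) P

/-- The rotation `R(dσ, P) v = (λ / Im σP) · dσ_P v`. -/
def rot (σ : SL(2, ℂ)) (P : ℂ × ℝ) : ℂ × ℝ →L[ℝ] ℂ × ℝ :=
  (P.2 / (act σ P).2) • dAct σ P

/-- The hyperbolic volume `dx dy dλ / λ³` on `ℍ³`. -/
def hypVol : Measure (ℂ × ℝ) :=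
  (volume.restrict H3).withDensity fun P => ENNReal.ofReal (1 / P.2 ^ 3)

/-! ### The Bianchi groups -/

/-- `w_D`: equal to `(1 + i √D) / 2` if `D ≡ 3 mod 4`, and to `i √D` otherwise. -/
def w (D : ℕ) : ℂ :=
  if D % 4 = 3 then (1 + Complex.I * (Real.sqrt D : ℂ)) / 2 else Complex.I * (Real.sqrt D : ℂ)

/-- The ring of integers `𝒪_D = ℤ[w_D]` of `ℚ(√-D)` (`D` square-free), as a subring of `ℂ`. -/
def ringO (D : ℕ) : Subring ℂ := Subring.closure {w D}

/-- `Γ = SL(2, 𝒪_D)`, as a subgroup of `SL(2,ℂ)`. -/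
def Gam (D : ℕ) : Subgroup SL(2, ℂ) :=
  (Matrix.SpecialLinearGroup.map (n := Fin 2) (ringO D).subtype).range

/-- The stabilizer of the point `∞` in `SL(2,ℂ)`: upper triangular matrices. -/
def upperTri : Subgroup SL(2, ℂ) where
  carrier := {σ | σ 1 0 = 0}
  one_mem' := by simp
  mul_mem' := by
    intro a b ha hb
    simp only [Set.mem_ofPred_eq] at *
    simp [Matrix.mul_apply, Fin.sum_univ_two, ha, hb]
  inv_mem' := by
    intro a ha
    simp only [Set.mem_ofPred_eq] at *
    simp [Matrix.SpecialLinearGroup.SL2_inv_expl, ha]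

/-- The upper triangular matrices with ones on the diagonal. -/
def upperUni : Subgroup SL(2, ℂ) where
  carrier := {σ | σ 1 0 = 0 ∧ σ 0 0 = 1 ∧ σ 1 1 = 1}
  one_mem' := by simp
  mul_mem' := by
    rintro a b ⟨h1, h2, h3⟩ ⟨k1, k2, k3⟩
    refine ⟨?_, ?_, ?_⟩ <;>
      simp [Matrix.mul_apply, Fin.sum_univ_two, h1, h2, h3, k1, k2, k3]
  inv_mem' := by
    rintro a ⟨h1, h2, h3⟩
    refine ⟨?_, ?_, ?_⟩ <;>
      simp [Matrix.SpecialLinearGroup.SL2_inv_expl, h1, h2, h3]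

/-- `Γ_∞`, the stabilizer of `∞` in `Γ`. -/
def GamInf (D : ℕ) : Subgroup SL(2, ℂ) := Gam D ⊓ upperTri

/-- `Γ'_∞`, the maximal unipotent subgroup of `Γ` at `∞`. -/
def GamInf' (D : ℕ) : Subgroup SL(2, ℂ) := Gam D ⊓ upperUni

/-- The projection `SL(2,ℂ) → PSL(2,ℂ)`. -/
def toPSL : SL(2, ℂ) →* Matrix.ProjectiveSpecialLinearGroup (Fin 2) ℂ :=
  QuotientGroup.mk' (Subgroup.center SL(2, ℂ))

/-- The index of the image of `Γ'_∞` in the image of `Γ_∞`, both images taken in `PSL(2,ℂ)`. -/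
def cuspIndexPSL (D : ℕ) : ℕ :=
  ((GamInf' D).map toPSL).relIndex ((GamInf D).map toPSL)

/-- The right cosets `Γ'_∞ \ Γ`. -/
abbrev Cosets (D : ℕ) : Type :=
  Quotient (QuotientGroup.rightRel ((GamInf' D).subgroupOf (Gam D)))

/-- A fundamental domain of `Γ` in `ℍ³`: a measurable set which meets almost every orbit, and
whose translates by the nontrivial Möbius transformations of `Γ` meet it in null sets. -/
structure IsFundDomain (D : ℕ) (F : Set (ℂ × ℝ)) : Prop where
  subset : F ⊆ H3
  measurable : MeasurableSet F
  covers : ∀ᵐ P ∂hypVol, ∃ γ ∈ Gam D, act γ P ∈ F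
  disjoint : ∀ γ ∈ Gam D, γ ≠ 1 → γ ≠ -1 → hypVol (F ∩ act γ '' F) = 0

/-- The closed parallelogram `C_D` spanned by `1` and `w_D`, a fundamental domain of the lattice
`Λ_D = ℤ + ℤ w_D` in `ℂ`. -/
def cell (D : ℕ) : Set ℂ :=
  {z | ∃ a ∈ Icc (0 : ℝ) 1, ∃ b ∈ Icc (0 : ℝ) 1, z = a + b * w D}

/-- `|Λ_D|`, the area of the flat torus `ℝ² / Λ_D`. -/
def area (D : ℕ) : ℝ := volume.real (cell D)

/-! ### Spherical harmonics and Wigner matrices -/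

/-- The Legendre polynomial `P_l = (1 / (2^l l!)) (d/dt)^l (t² - 1)^l`. -/
def legendre (l : ℕ) : Polynomial ℝ :=
  Polynomial.C (1 / (2 ^ l * (l.factorial : ℝ))) *
    Polynomial.derivative^[l] ((Polynomial.X ^ 2 - 1) ^ l)

/-- The spherical harmonic `Y^l_m` (`|m| ≤ l`), orthonormal on the unit sphere of `ℂ × ℝ`:
at the point with spherical coordinates `(ϑ, φ)`, that is `(sin ϑ · exp (i φ), cos ϑ)`, it is
`N · exp (i m φ) · (sin ϑ)^|m| · P_l^{(|m|)} (cos ϑ)`, with the phase `(-1)^m` for `m ≥ 0`. -/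
def sphHarm (l : ℕ) (m : ℤ) (p : ℂ × ℝ) : ℂ :=
  (if 0 ≤ m then (-1 : ℂ) ^ m.natAbs else 1) *
    (Real.sqrt ((2 * l + 1) / (4 * Real.pi) *
      (((l - m.natAbs).factorial : ℝ) / ((l + m.natAbs).factorial : ℝ))) : ℂ) *
    (if 0 ≤ m then p.1 else conj p.1) ^ m.natAbs *
    (((Polynomial.derivative^[m.natAbs] (legendre l)).eval p.2 : ℝ) : ℂ)

/-- The point of the unit sphere with spherical coordinates `(ϑ, φ)`. -/
def spherePt (θ φ : ℝ) : ℂ × ℝ :=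
  ((Real.sin θ : ℂ) * Complex.exp (Complex.I * φ), Real.cos θ)

/-- `∫_{S²} g(ϑ, φ) sin ϑ dϑ dφ`. -/
def sphereInt (g : ℂ × ℝ → ℂ) : ℂ :=
  ∫ φ in (0 : ℝ)..(2 * Real.pi), ∫ θ in (0 : ℝ)..Real.pi,
    g (spherePt θ φ) * (Real.sin θ : ℂ)

/-- The Wigner matrix: `D^l_{km}(R)` is the coefficient of `Y^l_k` in the expansion of
`p ↦ Y^l_m (R⁻¹ p)` in spherical harmonics. -/
def wigner (l : ℕ) (k m : ℤ) (R : ℂ × ℝ →L[ℝ] ℂ × ℝ) : ℂ :=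
  sphereInt fun p => sphHarm l m (R.inverse p) * conj (sphHarm l k p)

/-! ### The series `H^l_{km}` -/

/-- The term of the series belonging to `σ`; it depends only on the coset `Γ'_∞ σ`. -/
def HTerm (l : ℕ) (k m : ℤ) (P : ℂ × ℝ) (s : ℂ) (σ : SL(2, ℂ)) : ℂ :=
  conj (wigner l k m (rot σ P).inverse) * ((act σ P).2 : ℂ) ^ (1 + s)

/-- `H^l_{km}(P, s)`: the sum of the terms over `Γ'_∞ \ Γ`, divided by `[Γ_∞ : Γ'_∞]`. -/
def HSeries (D l : ℕ) (k m : ℤ) (P : ℂ × ℝ) (s : ℂ) : ℂ :=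
  1 / ((GamInf' D).relIndex (GamInf D) : ℂ) *
    ∑' σ : Cosets D, HTerm l k m P s (σ.out : Gam D)

/-! ### The unit tangent bundle of the Bianchi orbifold -/

/-- `T₁(ℍ³)`: pairs `(P, v)`, where the tangent vector `v` at `P = (z, λ)` has hyperbolic norm
one, that is, Euclidean norm `λ`. -/
def T1H3 : Set ((ℂ × ℝ) × (ℂ × ℝ)) :=
  {x | x.1 ∈ H3 ∧ Complex.normSq x.2.1 + x.2.2 ^ 2 = x.1.2 ^ 2}

/-- `T₁(M_D)`: the quotient of `T₁(ℍ³)` by the action `γ (P, v) = (γ P, dγ_P v)` of `Γ`, with the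
quotient topology. -/
abbrev T1M (D : ℕ) : Type :=
  Quot fun x y : T1H3 => ∃ γ ∈ Gam D, (y : (ℂ × ℝ) × (ℂ × ℝ)) = (act γ x.1.1, dAct γ x.1.1 x.1.2)

open Classical in
/-- The `Γ`-invariant function on `T₁(ℍ³)` given by a function on `T₁(M_D)` (and `0` elsewhere). -/
def lift {D : ℕ} (f : T1M D → ℂ) (x : (ℂ × ℝ) × (ℂ × ℝ)) : ℂ :=
  if h : x ∈ T1H3 then f (Quot.mk _ ⟨x, h⟩) else 0

/-- `f ∈ C^∞_0(T₁(M_D))`: `f` has compact support, and its lift is smooth on the submanifold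
`T₁(ℍ³)` of `ℝ³ × ℝ³`. -/
structure IsTestFunction {D : ℕ} (f : T1M D → ℂ) : Prop where
  smooth : ContDiffOn ℝ ∞ (lift f) T1H3
  compact : HasCompactSupport f

/-- The coefficient `\hat f^l_m(P) = ∫_{S²} f(P, λ p) conj (Y^l_m(p)) dp`, `P = (z, λ)`. -/
def coeff {D : ℕ} (f : T1M D → ℂ) (l : ℕ) (m : ℤ) (P : ℂ × ℝ) : ℂ :=
  sphereInt fun p => lift f (P, P.2 • p) * conj (sphHarm l m p)

/-- `ν(λ)(f) = |Λ_D|⁻¹ ∫_{ℝ²/Λ_D} f(x + i y + λ j, e₁) dx dy`; here `e₁` stands for the unit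
tangent vector `λ e₁`. -/
def nu {D : ℕ} (f : T1M D → ℂ) (r : ℝ) : ℂ :=
  1 / (area D : ℂ) * ∫ z in cell D, lift f ((z, r), r • ((1, 0) : ℂ × ℝ))

/-- The integrand `ν(λ)(f) λ^(s - 2)` of the Mellin transform. -/
def mellinIntegrand {D : ℕ} (f : T1M D → ℂ) (s : ℂ) (r : ℝ) : ℂ := nu f r * (r : ℂ) ^ (s - 2)

/-- The Mellin transform `𝔐(f, s) = ∫_0^∞ ν(λ)(f) λ^(s - 2) dλ`. -/
def mellinTransform {D : ℕ} (f : T1M D → ℂ) (s : ℂ) : ℂ :=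
  ∫ r in Ioi (0 : ℝ), mellinIntegrand f s r

end Bianchi

end

open Bianchi

/-! The formula is a Rankin-Selberg unfolding on the unit tangent bundle. By Fubini, `𝔐(f, s)` is
`1/|Λ_D|` times the hyperbolic integral of `λ^(1+s) f(P, λ e₁)` over the strip above a cell of
`Λ_D`, a fundamental domain of `Γ'_∞` (`mellinTransform_eq`). On each fibre sphere `f` is split into
its components of degree `l`; the component at `q` is `proj f l P q`, the integral of `f` against
the zonal kernel `(2l+1)/(4π) P_l(q·p)`. Times `λ^(1+s)`, each component is `Γ'_∞`-invariant, so
`hasSum_unfold` turns its strip integral into a sum over `Γ'_∞ \ Γ` of integrals over `F` of its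
values at `σP`. Since `f` is `Γ`-invariant and `dσ_P` is a scaled rotation `R`, the component at
`σP` in the direction `e₁` is the component at `P` in the direction `R⁻¹ e₁`. In spherical harmonics
this is a double sum with Wigner coefficients (`sum_coeff_mul_HTerm`), and the sum over `σ` produces
`H^l_{km}`.

The harmonic analysis needs three facts about the zonal kernel: it is the sum of the `Y^l_m(q) conj
(Y^l_m(p))` (`addition_theorem`), it reproduces itself under convolution
(`integral_zonal_mul_zonal`), and the integrals of a smooth function against the kernels of all
degrees sum to its value at the pole (`hasSum_integral_mul_zonal`). All three are derived from
Legendre's differential equation and the recurrence for `P_l'`, without representation theory.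

Convergence rests on two estimates. The support of `f` lies over the orbit of a compact set, where
the height is bounded because nonzero elements of `𝒪_D` have norm at least one. Hence `λ^(1+Re s)`,
cut off to that orbit, is integrable over the strip: against `dλ/λ³` the exponent is `Re s - 2 > -1`
(`integrableOn_cut`). Unfolding this majorant also justifies exchanging the sum over `σ` with the
integral over `F`. For the sum over `l`, the components decay like `l^(-3/2)` uniformly in `P`
(`IsTestFunction.exists_proj_bound`).

As `-I` acts trivially, unfolding produces a factor 2; it cancels against `[Γ_∞ : Γ'_∞]`, which is
twice the index in `PSL(2,ℂ)` (`relIndex_eq`). -/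

noncomputable section

namespace Bianchi

/-! ### The Euclidean form on `ℂ × ℝ` -/

/-- The squared Euclidean norm on `ℂ × ℝ = ℝ³`. -/
def en (v : ℂ × ℝ) : ℝ := Complex.normSq v.1 + v.2 ^ 2

/-- The Euclidean inner product on `ℂ × ℝ = ℝ³`. -/
def ed (v w : ℂ × ℝ) : ℝ := v.1.re * w.1.re + v.1.im * w.1.im + v.2 * w.2

lemma en_smul (t : ℝ) (v : ℂ × ℝ) : en (t • v) = t ^ 2 * en v := by
  simp only [en, Prod.smul_fst, Prod.smul_snd, Complex.real_smul, map_mul, Complex.normSq_ofReal,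
    smul_eq_mul]
  ring

lemma en_eq_zero {v : ℂ × ℝ} : en v = 0 ↔ v = 0 := by
  constructor
  · intro h
    have h1 := Complex.normSq_nonneg v.1
    have h2 := sq_nonneg v.2
    unfold en at h
    have h3 : Complex.normSq v.1 = 0 := by linarith
    have h4 : v.2 ^ 2 = 0 := by linarith
    exact Prod.ext (Complex.normSq_eq_zero.1 h3) (by simpa using h4)
  · rintro rfl
    simp [en]

lemma ed_eq (v w : ℂ × ℝ) : ed v w = (en (v + w) - en v - en w) / 2 := by
  simp only [ed, en, Complex.normSq_apply, Prod.fst_add, Prod.snd_add, Complex.add_re,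
    Complex.add_im]
  ring

lemma continuous_en : Continuous en := by
  unfold en
  exact (Complex.continuous_normSq.comp continuous_fst).add (continuous_snd.pow 2)

/-- A linear map of `ℝ³` that preserves the Euclidean norm. -/
def IsOrth (R : ℂ × ℝ →L[ℝ] ℂ × ℝ) : Prop := ∀ v, en (R v) = en v

lemma IsOrth.ed {R : ℂ × ℝ →L[ℝ] ℂ × ℝ} (hR : IsOrth R) (v w : ℂ × ℝ) :
    ed (R v) (R w) = ed v w := by
  rw [ed_eq, ed_eq, ← map_add, hR, hR, hR]

lemma IsOrth.injective {R : ℂ × ℝ →L[ℝ] ℂ × ℝ} (hR : IsOrth R) : Function.Injective R := by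
  refine (injective_iff_map_eq_zero R).2 fun v hv => ?_
  rw [← en_eq_zero, ← hR v, hv, en_eq_zero]

/-- The linear equivalence given by a linear map preserving the Euclidean norm. -/
def IsOrth.equiv {R : ℂ × ℝ →L[ℝ] ℂ × ℝ} (hR : IsOrth R) : (ℂ × ℝ) ≃L[ℝ] ℂ × ℝ :=
  (LinearEquiv.ofInjectiveEndo (R : ℂ × ℝ →ₗ[ℝ] ℂ × ℝ) hR.injective).toContinuousLinearEquiv

lemma IsOrth.coe_equiv {R : ℂ × ℝ →L[ℝ] ℂ × ℝ} (hR : IsOrth R) :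
    (hR.equiv : ℂ × ℝ →L[ℝ] ℂ × ℝ) = R := by
  ext v <;> rfl

lemma IsOrth.inverse_eq {R : ℂ × ℝ →L[ℝ] ℂ × ℝ} (hR : IsOrth R) :
    R.inverse = (hR.equiv.symm : ℂ × ℝ →L[ℝ] ℂ × ℝ) := by
  conv_lhs => rw [← hR.coe_equiv]
  exact ContinuousLinearMap.inverse_equiv _

lemma IsOrth.apply_inverse {R : ℂ × ℝ →L[ℝ] ℂ × ℝ} (hR : IsOrth R) (v : ℂ × ℝ) :
    R (R.inverse v) = v := by
  rw [hR.inverse_eq]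
  exact hR.equiv.apply_symm_apply v

lemma IsOrth.inverse {R : ℂ × ℝ →L[ℝ] ℂ × ℝ} (hR : IsOrth R) : IsOrth R.inverse := fun v => by
  rw [← hR (R.inverse v), hR.apply_inverse]

lemma IsOrth.inverse_inverse {R : ℂ × ℝ →L[ℝ] ℂ × ℝ} (hR : IsOrth R) :
    R.inverse.inverse = R := by
  rw [hR.inverse_eq, ContinuousLinearMap.inverse_equiv]
  exact hR.coe_equiv

lemma isCompact_en_le (r : ℝ) : IsCompact {v : ℂ × ℝ | en v ≤ r} := by
  refine Metric.isCompact_of_isClosed_isBounded (isClosed_le continuous_en continuous_const) ?_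
  refine (Metric.isBounded_closedBall (x := (0 : ℂ × ℝ)) (r := Real.sqrt r)).subset fun v hv => ?_
  have hv : en v ≤ r := hv
  have h1 := Complex.normSq_nonneg v.1
  have h2 := sq_nonneg v.2
  unfold en at hv
  rw [mem_closedBall_zero_iff, Prod.norm_def]
  refine max_le (Real.le_sqrt_of_sq_le ?_) (Real.le_sqrt_of_sq_le ?_)
  · rw [← Complex.normSq_eq_norm_sq]; linarith
  · rw [Real.norm_eq_abs, sq_abs]; linarith

instance : (volume : Measure (ℂ × ℝ)).IsAddHaarMeasure :=
  inferInstanceAs (((volume : Measure ℂ).prod (volume : Measure ℝ)).IsAddHaarMeasure)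

lemma IsOrth.abs_det {R : ℂ × ℝ →L[ℝ] ℂ × ℝ} (hR : IsOrth R) : |R.det| = 1 := by
  set B : Set (ℂ × ℝ) := {v | en v ≤ 1} with hB
  have himg : R '' B = B := by
    ext v
    constructor
    · rintro ⟨x, hx, rfl⟩
      simpa [hB, hR x] using hx
    · intro hv
      exact ⟨R.inverse v, by simpa [hB, hR.inverse v] using hv, hR.apply_inverse v⟩
  have h := Measure.addHaar_image_continuousLinearMap (volume : Measure (ℂ × ℝ)) R B
  rw [himg] at h
  have hfin : volume B ≠ ⊤ := (isCompact_en_le 1).measure_ne_top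
  have hpos : volume B ≠ 0 := by
    have ho : IsOpen {v : ℂ × ℝ | en v < 1} := isOpen_lt continuous_en continuous_const
    have h0 : volume {v : ℂ × ℝ | en v < 1} ≠ 0 :=
      (ho.measure_pos volume ⟨0, by simp [en]⟩).ne'
    exact fun h => h0 (measure_mono_null (fun v (hv : en v < 1) => hv.le) h)
  have h1 : ENNReal.ofReal |R.det| = 1 := by
    refine (ENNReal.mul_left_inj hpos hfin).1 ?_
    rw [one_mul, ← h]
  exact ENNReal.ofReal_eq_one.1 h1

/-! ### The action through Hermitian matrices -/

lemma det_eq (σ : SL(2, ℂ)) : σ 0 0 * σ 1 1 - σ 0 1 * σ 1 0 = 1 := by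
  have := σ.det_coe
  rwa [Matrix.det_fin_two] at this

lemma Om_pos (σ : SL(2, ℂ)) {P : ℂ × ℝ} (hP : P ∈ H3) : 0 < Om σ P := by
  have hP : 0 < P.2 := hP
  unfold Om
  by_cases hc : σ 1 0 = 0
  · have hd : σ 1 1 ≠ 0 := by
      intro hd
      have := det_eq σ
      simp [hc, hd] at this
    simpa [hc] using hd
  · have h1 := Complex.normSq_pos.2 hc
    have h2 := Complex.normSq_nonneg (σ 1 0 * P.1 + σ 1 1)
    positivity

lemma act_mem (σ : SL(2, ℂ)) {P : ℂ × ℝ} (hP : P ∈ H3) : act σ P ∈ H3 :=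
  div_pos (show 0 < P.2 from hP) (Om_pos σ hP)

/-- The positive Hermitian matrix of determinant `1` that belongs to a point of `ℍ³`. -/
def hMat (P : ℂ × ℝ) : Matrix (Fin 2) (Fin 2) ℂ :=
  !![(P.1 * conj P.1 + (P.2 : ℂ) ^ 2) / P.2, P.1 / P.2; conj P.1 / P.2, 1 / P.2]

lemma Om_cast (σ : SL(2, ℂ)) (P : ℂ × ℝ) : (Om σ P : ℂ) =
    (σ 1 0 * P.1 + σ 1 1) * (conj (σ 1 0) * conj P.1 + conj (σ 1 1)) +
      σ 1 0 * conj (σ 1 0) * (P.2 : ℂ) ^ 2 := by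
  unfold Om
  push_cast
  rw [← Complex.mul_conj, ← Complex.mul_conj, map_add, map_mul]

/-- In this model the action is the congruence `H ↦ σ H σ*`, so that composition of transformations
becomes matrix multiplication. -/
lemma hMat_act (σ : SL(2, ℂ)) {P : ℂ × ℝ} (hP : P ∈ H3) :
    hMat (act σ P) = (σ : Matrix (Fin 2) (Fin 2) ℂ) * hMat P * (σ : Matrix (Fin 2) (Fin 2) ℂ).conjTranspose := by
  have hl : (P.2 : ℂ) ≠ 0 := Complex.ofReal_ne_zero.2 (ne_of_gt hP)
  have hO : (Om σ P : ℂ) ≠ 0 := Complex.ofReal_ne_zero.2 (Om_pos σ hP).ne'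
  have hOc := Om_cast σ P
  have hdet := det_eq σ
  have hdetc := congrArg conj hdet
  simp only [map_sub, map_mul, map_one] at hdetc
  have hr : conj (P.2 : ℂ) = P.2 := Complex.conj_ofReal _
  have hOr : conj (Om σ P : ℂ) = Om σ P := Complex.conj_ofReal _
  ext i j
  fin_cases i <;> fin_cases j <;>
    simp [hMat, act, Matrix.mul_apply, Fin.sum_univ_two, Matrix.conjTranspose_apply] <;>
    field_simp
  · rw [hOc]
    -- The two sides differ by a multiple of `|det σ|² - 1`, which is split into multiples of `det σ
    -- - 1` and of its conjugate.
    linear_combination (-(P.2 : ℂ) ^ 2 * (conj (σ 0 0) * conj (σ 1 1) - conj (σ 0 1) * conj (σ 1 0)))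
      * hdet - (P.2 : ℂ) ^ 2 * hdetc
  · ring
  · ring
  · rw [hOc]
    ring

lemma hMat_injOn : InjOn hMat H3 := by
  intro P hP Q hQ h
  have hP' : (P.2 : ℂ) ≠ 0 := Complex.ofReal_ne_zero.2 (ne_of_gt hP)
  have hQ' : (Q.2 : ℂ) ≠ 0 := Complex.ofReal_ne_zero.2 (ne_of_gt hQ)
  have h1 : (1 : ℂ) / P.2 = 1 / Q.2 := by simpa [hMat] using congrFun (congrFun h 1) 1
  have h2 : P.1 / P.2 = Q.1 / Q.2 := by simpa [hMat] using congrFun (congrFun h 0) 1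
  have h3 : (P.2 : ℂ) = Q.2 := by
    field_simp at h1
    exact h1.symm
  rw [h3] at h2
  exact Prod.ext ((div_left_inj' hQ').1 h2) (Complex.ofReal_injective h3)

lemma act_mul (σ τ : SL(2, ℂ)) {P : ℂ × ℝ} (hP : P ∈ H3) :
    act (σ * τ) P = act σ (act τ P) := by
  apply hMat_injOn (act_mem _ hP) (act_mem _ (act_mem _ hP))
  rw [hMat_act _ hP, hMat_act _ (act_mem _ hP), hMat_act _ hP]
  simp only [Matrix.SpecialLinearGroup.coe_mul, Matrix.conjTranspose_mul, Matrix.mul_assoc]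

lemma act_one {P : ℂ × ℝ} : act 1 P = P := by
  simp [act, Om]

lemma act_neg (σ : SL(2, ℂ)) (P : ℂ × ℝ) : act (-σ) P = act σ P := by
  have h : Om (-σ) P = Om σ P := by
    simp only [Om, Matrix.SpecialLinearGroup.coe_neg, Matrix.neg_apply, Complex.normSq_neg]
    rw [← Complex.normSq_neg]
    congr 2
    ring
  simp only [act, h]
  simp only [Matrix.SpecialLinearGroup.coe_neg, Matrix.neg_apply, map_add, map_mul, map_neg]
  congr 2
  ring

lemma act_inv_act (σ : SL(2, ℂ)) {P : ℂ × ℝ} (hP : P ∈ H3) : act σ⁻¹ (act σ P) = P := by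
  rw [← act_mul _ _ hP, inv_mul_cancel, act_one]

lemma act_act_inv (σ : SL(2, ℂ)) {P : ℂ × ℝ} (hP : P ∈ H3) : act σ (act σ⁻¹ P) = P := by
  rw [← act_mul _ _ hP, mul_inv_cancel, act_one]

/-- The trace is `2 cosh` of the hyperbolic distance; its invariance under congruence gives
`en_act_sub_act`. -/
lemma trace_hMat_mul_adjugate {P Q : ℂ × ℝ} (hP : P ∈ H3) (hQ : Q ∈ H3) :
    (hMat P * (hMat Q).adjugate).trace = ((en (P - Q) / (P.2 * Q.2) + 2 : ℝ) : ℂ) := by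
  have hP' : (P.2 : ℂ) ≠ 0 := Complex.ofReal_ne_zero.2 (ne_of_gt hP)
  have hQ' : (Q.2 : ℂ) ≠ 0 := Complex.ofReal_ne_zero.2 (ne_of_gt hQ)
  simp only [en, Matrix.trace_fin_two, hMat, Matrix.adjugate_fin_two, Matrix.mul_apply, Fin.sum_univ_two]
  push_cast
  rw [← Complex.mul_conj]
  simp
  field_simp
  ring

lemma en_act_sub_act (σ : SL(2, ℂ)) {P Q : ℂ × ℝ} (hP : P ∈ H3) (hQ : Q ∈ H3) :
    en (act σ P - act σ Q) = en (P - Q) / (Om σ P * Om σ Q) := by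
  have h : (hMat (act σ P) * (hMat (act σ Q)).adjugate).trace
      = (hMat P * (hMat Q).adjugate).trace := by
    set S : Matrix (Fin 2) (Fin 2) ℂ := (σ : Matrix (Fin 2) (Fin 2) ℂ) with hS
    have hd : S.det = 1 := σ.det_coe
    have hd' : S.conjTranspose.det = 1 := by rw [Matrix.det_conjTranspose, hd, star_one]
    rw [hMat_act _ hP, hMat_act _ hQ, ← hS, Matrix.adjugate_mul_distrib, Matrix.adjugate_mul_distrib]
    have e1 : S * hMat P * S.conjTranspose * (S.conjTranspose.adjugate * ((hMat Q).adjugate * S.adjugate))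
        = S * (hMat P * (S.conjTranspose * S.conjTranspose.adjugate) * ((hMat Q).adjugate * S.adjugate)) := by
      simp only [Matrix.mul_assoc]
    rw [e1, Matrix.mul_adjugate, hd', one_smul, Matrix.mul_one, Matrix.trace_mul_comm,
      ← Matrix.mul_assoc, Matrix.mul_assoc, Matrix.adjugate_mul, hd, one_smul, Matrix.mul_one]
  rw [trace_hMat_mul_adjugate hP hQ, trace_hMat_mul_adjugate (act_mem _ hP) (act_mem _ hQ)] at h
  have h := Complex.ofReal_injective h
  have hP' : P.2 ≠ 0 := ne_of_gt hP
  have hQ' : Q.2 ≠ 0 := ne_of_gt hQ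
  have h1 := (Om_pos σ hP).ne'
  have h2 := (Om_pos σ hQ).ne'
  simp only [act] at h ⊢
  field_simp at h ⊢
  linarith

/-! ### Smoothness and conformality -/

lemma isOpen_H3 : IsOpen H3 := isOpen_lt continuous_const continuous_snd

lemma contDiff_conj : ContDiff ℝ ∞ (fun z : ℂ => conj z) := Complex.conjCLE.contDiff

lemma contDiff_normSq : ContDiff ℝ ∞ Complex.normSq := by
  have : (Complex.normSq : ℂ → ℝ) = fun z => Complex.reCLM z * Complex.reCLM z +
      Complex.imCLM z * Complex.imCLM z := by
    ext z
    simp [Complex.normSq_apply]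
  rw [this]
  fun_prop

lemma contDiff_Om (σ : SL(2, ℂ)) : ContDiff ℝ ∞ (Om σ) := by
  unfold Om
  exact (contDiff_normSq.comp (by fun_prop)).add (by fun_prop)

lemma contDiffOn_act (σ : SL(2, ℂ)) : ContDiffOn ℝ ∞ (act σ) H3 := by
  have hO : ∀ P ∈ H3, Om σ P ≠ 0 := fun P hP => (Om_pos σ hP).ne'
  have h2 : ContDiff ℝ ∞ (fun P : ℂ × ℝ => (P.2 : ℂ)) := Complex.ofRealCLM.contDiff.comp contDiff_snd
  unfold act
  simp only [div_eq_mul_inv]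
  refine ContDiffOn.prodMk (ContDiffOn.mul ?_ (ContDiffOn.inv ?_ ?_)) (ContDiffOn.mul ?_ (ContDiffOn.inv ?_ hO))
  · refine ContDiff.contDiffOn (ContDiff.add (ContDiff.mul (by fun_prop) ?_) (by fun_prop))
    exact contDiff_conj.comp (by fun_prop)
  · exact (Complex.ofRealCLM.contDiff.comp (contDiff_Om σ)).contDiffOn
  · exact fun P hP => Complex.ofReal_ne_zero.2 (hO P hP)
  · exact contDiff_snd.contDiffOn
  · exact (contDiff_Om σ).contDiffOn

lemma hasFDerivAt_act (σ : SL(2, ℂ)) {P : ℂ × ℝ} (hP : P ∈ H3) :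
    HasFDerivAt (act σ) (dAct σ P) P :=
  (((contDiffOn_act σ).differentiableOn (by simp)).differentiableAt
    (isOpen_H3.mem_nhds hP)).hasFDerivAt

lemma continuousOn_dAct (σ : SL(2, ℂ)) : ContinuousOn (dAct σ) H3 :=
  (contDiffOn_act σ).continuousOn_fderiv_of_isOpen isOpen_H3 (by simp)

/-- Conformality comes from the exact distance formula `en_act_sub_act`: apply it to `P + t v` and
`P`, divide by `t²` and let `t → 0`. The derivative is never computed. -/
lemma en_dAct (σ : SL(2, ℂ)) {P : ℂ × ℝ} (hP : P ∈ H3) (v : ℂ × ℝ) :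
    en (dAct σ P v) = en v / (Om σ P) ^ 2 := by
  have hline : HasDerivAt (fun t : ℝ => P + t • v) v 0 := by
    simpa using ((hasDerivAt_id (0 : ℝ)).smul_const v).const_add P
  have hd : HasDerivAt (fun t : ℝ => act σ (P + t • v)) (dAct σ P v) 0 := by
    have h0 : HasFDerivAt (act σ) (dAct σ P) (P + (0 : ℝ) • v) := by
      simpa using hasFDerivAt_act σ hP
    exact h0.comp_hasDerivAt (0 : ℝ) hline
  have h1 := (continuous_en.tendsto _).comp (hasDerivAt_iff_tendsto_slope_zero.1 hd)
  have hc : Filter.Tendsto (fun t : ℝ => P + t • v) (nhdsWithin 0 {0}ᶜ) (nhds P) := by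
    have : Filter.Tendsto (fun t : ℝ => P + t • v) (nhds 0) (nhds (P + (0 : ℝ) • v)) :=
      hline.continuousAt
    rw [zero_smul, add_zero] at this
    exact this.mono_left nhdsWithin_le_nhds
  have h2 : Filter.Tendsto (fun t : ℝ => en v / (Om σ (P + t • v) * Om σ P)) (nhdsWithin 0 {0}ᶜ)
      (nhds (en v / (Om σ P * Om σ P))) :=
    tendsto_const_nhds.div
      ((((contDiff_Om σ).continuous.tendsto _).comp hc).mul tendsto_const_nhds)
      (mul_pos (Om_pos σ hP) (Om_pos σ hP)).ne'
  rw [sq]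
  refine tendsto_nhds_unique h1 (h2.congr' ?_)
  filter_upwards [hc (isOpen_H3.mem_nhds hP), self_mem_nhdsWithin] with t ht ht0
  have ht0 : t ≠ 0 := ht0
  simp only [Function.comp_apply, zero_add, zero_smul, add_zero]
  rw [en_smul, en_act_sub_act σ ht hP, add_sub_cancel_left, en_smul]
  field_simp

lemma rot_eq (σ : SL(2, ℂ)) {P : ℂ × ℝ} (hP : P ∈ H3) : rot σ P = Om σ P • dAct σ P := by
  have h1 := (Om_pos σ hP).ne'
  have h2 : P.2 ≠ 0 := ne_of_gt hP
  have : P.2 / (act σ P).2 = Om σ P := by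
    simp only [act]
    field_simp
  rw [rot, this]

lemma isOrth_rot (σ : SL(2, ℂ)) {P : ℂ × ℝ} (hP : P ∈ H3) : IsOrth (rot σ P) := fun v => by
  have h1 := (Om_pos σ hP).ne'
  rw [rot_eq σ hP, smul_apply, en_smul, en_dAct σ hP]
  field_simp

lemma dAct_apply (σ : SL(2, ℂ)) {P : ℂ × ℝ} (hP : P ∈ H3) (v : ℂ × ℝ) :
    dAct σ P v = ((act σ P).2 / P.2) • rot σ P v := by
  have h1 : (act σ P).2 ≠ 0 := ne_of_gt (act_mem σ hP)
  have h2 : P.2 ≠ 0 := ne_of_gt hP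
  rw [rot, smul_apply, smul_smul, div_mul_div_cancel₀ h2, div_self h1, one_smul]

lemma continuousOn_rot (σ : SL(2, ℂ)) : ContinuousOn (rot σ) H3 := by
  refine ContinuousOn.congr ?_ (fun P hP => rot_eq σ hP)
  exact (contDiff_Om σ).continuous.continuousOn.smul (continuousOn_dAct σ)

lemma abs_det_dAct (σ : SL(2, ℂ)) {P : ℂ × ℝ} (hP : P ∈ H3) :
    |(dAct σ P).det| = ((act σ P).2 / P.2) ^ 3 := by
  have h : dAct σ P = ((act σ P).2 / P.2) • rot σ P := by
    refine ContinuousLinearMap.ext fun v => ?_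
    exact dAct_apply σ hP v
  have h0 : 0 < (act σ P).2 / P.2 := div_pos (act_mem σ hP) hP
  rw [h, ContinuousLinearMap.det, ContinuousLinearMap.toLinearMap_smul, LinearMap.det_smul, abs_mul]
  have h1 : |LinearMap.det (rot σ P : ℂ × ℝ →ₗ[ℝ] ℂ × ℝ)| = 1 := (isOrth_rot σ hP).abs_det
  rw [h1, mul_one, abs_of_pos (pow_pos h0 _)]
  congr 1
  simp

/-! ### Invariance of the hyperbolic volume -/

lemma measurable_Om (σ : SL(2, ℂ)) : Measurable (Om σ) := (contDiff_Om σ).continuous.measurable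

lemma measurable_act (σ : SL(2, ℂ)) : Measurable (act σ) := by
  have h : Measurable (fun z : ℂ => conj z) := Complex.continuous_conj.measurable
  have hO := measurable_Om σ
  unfold act
  refine Measurable.prodMk (Measurable.div ?_ (Complex.measurable_ofReal.comp hO))
    (measurable_snd.div hO)
  refine Measurable.add (Measurable.mul (by fun_prop) (h.comp (by fun_prop))) ?_
  exact (measurable_const.mul ((Complex.measurable_ofReal.comp measurable_snd).pow_const 2))

lemma measurableSet_H3 : MeasurableSet H3 := isOpen_H3.measurableSet

lemma hypVol_apply (A : Set (ℂ × ℝ)) (hA : MeasurableSet A) :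
    hypVol A = ∫⁻ P in A ∩ H3, ENNReal.ofReal (1 / P.2 ^ 3) := by
  rw [hypVol, withDensity_apply _ hA, Measure.restrict_restrict hA]

lemma hypVol_compl_H3 : hypVol H3ᶜ = 0 := by
  rw [hypVol_apply _ measurableSet_H3.compl, compl_inter_self, setLIntegral_empty]

lemma ae_mem_H3 : ∀ᵐ P ∂hypVol, P ∈ H3 := by
  rw [ae_iff]
  exact hypVol_compl_H3

/-- The Jacobian `(Im σP / Im P)³` cancels the change of the density `1/λ³`. -/
lemma measurePreserving_act (σ : SL(2, ℂ)) : MeasurePreserving (act σ) hypVol hypVol := by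
  refine ⟨measurable_act σ, Measure.ext fun A hA => ?_⟩
  rw [Measure.map_apply (measurable_act σ) hA, hypVol_apply _ hA,
    hypVol_apply _ (measurable_act σ hA)]
  have himg : act σ '' (act σ ⁻¹' A ∩ H3) = A ∩ H3 := by
    ext Q
    constructor
    · rintro ⟨P, ⟨h1, h2⟩, rfl⟩
      exact ⟨h1, act_mem σ h2⟩
    · rintro ⟨h1, h2⟩
      refine ⟨act σ⁻¹ Q, ⟨?_, act_mem _ h2⟩, act_act_inv σ h2⟩
      rwa [mem_preimage, act_act_inv σ h2]
  rw [← himg, lintegral_image_eq_lintegral_abs_det_fderiv_mul volume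
    ((measurable_act σ hA).inter measurableSet_H3)
    (fun P hP => (hasFDerivAt_act σ hP.2).hasFDerivWithinAt)
    (fun P hP Q hQ h => by rw [← act_inv_act σ hP.2, h, act_inv_act σ hQ.2])]
  refine setLIntegral_congr_fun ((measurable_act σ hA).inter measurableSet_H3) fun P hP => ?_
  have h0 : 0 < P.2 := hP.2
  have h1 : 0 < (act σ P).2 := act_mem σ hP.2
  rw [abs_det_dAct σ hP.2, ← ENNReal.ofReal_mul (by positivity)]
  congr 1
  field_simp

/-! ### The ring of integers -/

section RingO

variable {D : ℕ}

lemma w_im_pos (hD : Squarefree D) : 0 < (w D).im := by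
  have hD0 : (0 : ℝ) < D := Nat.cast_pos.2 (Nat.pos_of_ne_zero hD.ne_zero)
  have := Real.sqrt_pos.2 hD0
  unfold w
  split_ifs
  · have h : ((1 + Complex.I * (Real.sqrt D : ℂ)) / 2).im = Real.sqrt D / 2 := by
      rw [show (2 : ℂ) = ((2 : ℝ) : ℂ) by norm_num, Complex.div_ofReal_im]
      simp
    rw [h]
    positivity
  · simpa using this

/-- The generator is a root of `x² - t x + n` with integral `t` and `n`; for `D ≡ 3 mod 4` the norm
`(1 + D)/4` is an integer. -/
lemma w_trace_norm (D : ℕ) : ∃ t n : ℤ, w D + conj (w D) = t ∧ w D * conj (w D) = n := by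
  have hs : (Real.sqrt D : ℂ) * Real.sqrt D = D := by
    rw [← Complex.ofReal_mul, Real.mul_self_sqrt (Nat.cast_nonneg D), Complex.ofReal_natCast]
  have c2 : conj (2 : ℂ) = 2 := map_ofNat _ 2
  unfold w
  split_ifs with h
  · refine ⟨1, (1 + D) / 4, ?_, ?_⟩
    · simp [c2]
      ring
    · have h4 : (((1 + D : ℤ) / 4 : ℤ) : ℂ) = (1 + D) / 4 := by
        obtain ⟨k, hk⟩ : (4 : ℤ) ∣ 1 + D := by omega
        rw [hk, Int.mul_ediv_cancel_left _ (by norm_num)]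
        have : (1 + D : ℂ) = 4 * k := by exact_mod_cast hk
        rw [this]
        ring
      rw [h4]
      simp [c2]
      linear_combination (1 / 4 : ℂ) * hs - (1 / 4 : ℂ) * (Real.sqrt D : ℂ) * Real.sqrt D * Complex.I_sq
  · refine ⟨0, D, by simp, ?_⟩
    simp
    linear_combination hs - (Real.sqrt D : ℂ) * Real.sqrt D * Complex.I_sq

lemma mem_ringO {x : ℂ} : x ∈ ringO D ↔ ∃ a b : ℤ, x = a + b * w D := by
  constructor
  · intro hx
    obtain ⟨t, n, ht, hn⟩ := w_trace_norm D
    refine Subring.closure_induction (p := fun x _ => ∃ a b : ℤ, x = a + b * w D)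
      ?_ ?_ ?_ ?_ ?_ ?_ hx
    · rintro x rfl
      exact ⟨0, 1, by simp⟩
    · exact ⟨0, 0, by simp⟩
    · exact ⟨1, 0, by simp⟩
    · rintro _ _ _ _ ⟨a, b, rfl⟩ ⟨c, d, rfl⟩
      exact ⟨a + c, b + d, by push_cast; ring⟩
    · rintro _ _ ⟨a, b, rfl⟩
      exact ⟨-a, -b, by push_cast; ring⟩
    · rintro _ _ _ _ ⟨a, b, rfl⟩ ⟨c, d, rfl⟩
      -- Coordinates of the product after the substitution `w² = t w - n`.
      refine ⟨a * c - b * d * n, a * d + b * c + b * d * t, ?_⟩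
      push_cast
      rw [← ht, ← hn]
      ring
  · rintro ⟨a, b, rfl⟩
    exact add_mem (intCast_mem _ a) (mul_mem (intCast_mem _ b) (Subring.subset_closure rfl))

/-- The squared absolute value is a binary quadratic form with integral coefficients, hence an
integer, and it is positive. -/
lemma one_le_normSq {x : ℂ} (hx : x ∈ ringO D) (h0 : x ≠ 0) : 1 ≤ Complex.normSq x := by
  obtain ⟨a, b, rfl⟩ := mem_ringO.1 hx
  obtain ⟨t, n, ht, hn⟩ := w_trace_norm D
  have h : Complex.normSq (a + b * w D) = ((a ^ 2 + a * b * t + b ^ 2 * n : ℤ) : ℝ) := by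
    apply Complex.ofReal_injective
    rw [← Complex.mul_conj]
    push_cast
    rw [← ht, ← hn]
    simp
    ring
  have hpos := Complex.normSq_pos.2 h0
  rw [h] at hpos ⊢
  exact_mod_cast hpos

instance countable_ringO : Countable (ringO D) := by
  refine Function.Surjective.countable (f := fun p : ℤ × ℤ =>
    (⟨p.1 + p.2 * w D, mem_ringO.2 ⟨p.1, p.2, rfl⟩⟩ : ringO D)) ?_
  rintro ⟨x, hx⟩
  obtain ⟨a, b, rfl⟩ := mem_ringO.1 hx
  exact ⟨(a, b), rfl⟩

/-- The second coordinate with respect to the real basis `1`, `w_D` of `ℂ`. -/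
def cy (D : ℕ) : ℂ →ₗ[ℝ] ℝ := (w D).im⁻¹ • Complex.imLm

/-- The first coordinate with respect to the real basis `1`, `w_D` of `ℂ`. -/
def cx (D : ℕ) : ℂ →ₗ[ℝ] ℝ := Complex.reLm - (w D).re • cy D

lemma cy_apply (z : ℂ) : cy D z = (w D).im⁻¹ * z.im := rfl

lemma cx_apply (z : ℂ) : cx D z = z.re - (w D).re * cy D z := rfl

lemma cx_add_cy (hD : Squarefree D) (z : ℂ) : (cx D z : ℂ) + cy D z * w D = z := by
  have h := (w_im_pos hD).ne'
  apply Complex.ext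
  · simp [cx_apply]
    ring
  · simp [cy_apply]
    field_simp

lemma cy_add_mul_w (hD : Squarefree D) (a b : ℝ) : cy D (a + b * w D) = b := by
  have h := (w_im_pos hD).ne'
  simp [cy_apply]
  field_simp

lemma cx_add_mul_w (hD : Squarefree D) (a b : ℝ) : cx D (a + b * w D) = a := by
  rw [cx_apply, cy_add_mul_w hD]
  simp
  ring

lemma mem_cell (hD : Squarefree D) {z : ℂ} :
    z ∈ cell D ↔ cx D z ∈ Icc (0 : ℝ) 1 ∧ cy D z ∈ Icc (0 : ℝ) 1 := by
  constructor
  · rintro ⟨a, ha, b, hb, rfl⟩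
    rw [cx_add_mul_w hD, cy_add_mul_w hD]
    exact ⟨ha, hb⟩
  · rintro ⟨h1, h2⟩
    exact ⟨_, h1, _, h2, (cx_add_cy hD z).symm⟩

lemma isCompact_cell (D : ℕ) : IsCompact (cell D) := by
  have : cell D = (fun p : ℝ × ℝ => (p.1 : ℂ) + p.2 * w D) '' (Icc 0 1 ×ˢ Icc 0 1) := by
    ext z
    constructor
    · rintro ⟨a, ha, b, hb, rfl⟩
      exact ⟨(a, b), ⟨ha, hb⟩, rfl⟩
    · rintro ⟨⟨a, b⟩, ⟨ha, hb⟩, rfl⟩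
      exact ⟨a, ha, b, hb, rfl⟩
  rw [this]
  exact (isCompact_Icc.prod isCompact_Icc).image (by fun_prop)

end RingO

/-! ### The groups `Γ` and `Γ'_∞` -/

section Groups

variable {D : ℕ}

lemma mem_Gam {σ : SL(2, ℂ)} : σ ∈ Gam D ↔ ∀ i j, σ i j ∈ ringO D := by
  constructor
  · rintro ⟨g, rfl⟩ i j
    exact (g i j).2
  · intro h
    refine ⟨⟨Matrix.of fun i j => ⟨σ i j, h i j⟩, ?_⟩, ?_⟩
    · apply Subtype.ext
      have := det_eq σ
      rw [Matrix.det_fin_two]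
      simpa using this
    · ext i j
      rfl

instance countable_Gam : Countable (Gam D) := by
  have : Countable (Matrix (Fin 2) (Fin 2) (ringO D)) :=
    inferInstanceAs (Countable (Fin 2 → Fin 2 → ringO D))
  have : Countable SL(2, ringO D) := Subtype.val_injective.countable (α := SL(2, ringO D))
    (β := Matrix (Fin 2) (Fin 2) (ringO D))
  exact (MonoidHom.rangeRestrict_surjective
    (Matrix.SpecialLinearGroup.map (n := Fin 2) (ringO D).subtype)).countable

lemma neg_mem_Gam {σ : SL(2, ℂ)} (h : σ ∈ Gam D) : -σ ∈ Gam D :=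
  mem_Gam.2 fun i j => neg_mem (mem_Gam.1 h i j)

lemma neg_ne_self (σ : SL(2, ℂ)) : -σ ≠ σ := by
  intro h
  have h1 : ∀ i j, σ i j = 0 := fun i j => by
    have h2 : (-σ) i j = σ i j := by rw [h]
    rw [Matrix.SpecialLinearGroup.coe_neg, Matrix.neg_apply] at h2
    exact self_eq_neg.1 h2.symm
  have := det_eq σ
  simp [h1] at this

lemma mem_GamInf' {τ : SL(2, ℂ)} : τ ∈ GamInf' D ↔
    τ 1 0 = 0 ∧ τ 0 0 = 1 ∧ τ 1 1 = 1 ∧ τ 0 1 ∈ ringO D := by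
  constructor
  · rintro ⟨h1, h2, h3, h4⟩
    exact ⟨h2, h3, h4, mem_Gam.1 h1 _ _⟩
  · rintro ⟨h2, h3, h4, h1⟩
    refine ⟨mem_Gam.2 fun i j => ?_, h2, h3, h4⟩
    fin_cases i <;> fin_cases j <;> simp [h1, h2, h3, h4, one_mem, zero_mem]

lemma act_unip {τ : SL(2, ℂ)} (h : τ ∈ GamInf' D) (P : ℂ × ℝ) :
    act τ P = P + (τ 0 1, (0 : ℝ)) := by
  obtain ⟨h1, h2, h3, -⟩ := mem_GamInf'.1 h
  ext <;> simp [act, Om, h1, h2, h3]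

/-- The element of `Γ'_∞` that acts as the translation by `b`. -/
def unip (b : ℂ) : SL(2, ℂ) := ⟨!![1, b; 0, 1], by simp⟩

lemma unip_mem {b : ℂ} (hb : b ∈ ringO D) : unip b ∈ GamInf' D :=
  mem_GamInf'.2 ⟨rfl, rfl, rfl, hb⟩

lemma ext_GamInf' {τ τ' : SL(2, ℂ)} (h : τ ∈ GamInf' D) (h' : τ' ∈ GamInf' D)
    (hb : τ 0 1 = τ' 0 1) : τ = τ' := by
  obtain ⟨h1, h2, h3, -⟩ := mem_GamInf'.1 h
  obtain ⟨k1, k2, k3, -⟩ := mem_GamInf'.1 h'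
  ext i j
  fin_cases i <;> fin_cases j <;> simp [h1, h2, h3, k1, k2, k3, hb]

/-- `Γ'_∞` as a subgroup of `Γ`. -/
abbrev unipSub (D : ℕ) : Subgroup (Gam D) := (GamInf' D).subgroupOf (Gam D)

lemma out_rel (γ : Gam D) :
    ∃ τ : unipSub D, (τ : Gam D) * (Quotient.mk (QuotientGroup.rightRel (unipSub D)) γ).out = γ := by
  have h := Quotient.exact (Quotient.out_eq (Quotient.mk (QuotientGroup.rightRel (unipSub D)) γ))
  have h := QuotientGroup.rightRel_apply.1 h
  exact ⟨⟨_, h⟩, by simp⟩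

/-- Every element of `Γ` is uniquely a product of an element of `Γ'_∞` and a representative. -/
def gamEquiv (D : ℕ) : Cosets D × unipSub D ≃ Gam D :=
  Equiv.ofBijective (fun p => (p.2 : Gam D) * p.1.out) <| by
    constructor
    · rintro ⟨q, τ⟩ ⟨q', τ'⟩ h
      have h : (τ : Gam D) * q.out = τ' * q'.out := h
      have hq : q = q' := by
        rw [← Quotient.out_eq q, ← Quotient.out_eq q']
        refine Quotient.sound (QuotientGroup.rightRel_apply.2 ?_)
        have : q'.out * (q.out)⁻¹ = (τ' : Gam D)⁻¹ * τ := by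
          rw [mul_inv_eq_iff_eq_mul, mul_assoc, h, inv_mul_cancel_left]
        rw [this]
        exact mul_mem (inv_mem τ'.2) τ.2
      subst hq
      exact Prod.ext rfl (Subtype.ext (mul_right_cancel h))
    · intro γ
      obtain ⟨τ, hτ⟩ := out_rel γ
      exact ⟨(_, τ), hτ⟩

instance countable_Cosets : Countable (Cosets D) := Quotient.countable

end Groups

/-! ### Multiplicities -/

lemma ae_hypVol_of_ae {p : ℂ × ℝ → Prop} (h : ∀ᵐ P, p P) : ∀ᵐ P ∂hypVol, p P :=
  (withDensity_absolutelyContinuous _ _).ae_le (ae_restrict_of_ae h)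

lemma volume_level_eq_zero (ℓ : ℂ × ℝ →ₗ[ℝ] ℝ) (hℓ : ℓ ≠ 0) (c : ℝ) :
    volume {x | ℓ x = c} = 0 := by
  by_cases hne : ∃ p, ℓ p = c
  · obtain ⟨p, hp⟩ := hne
    have h : {x | ℓ x = c} = (AffineSubspace.mk' p (LinearMap.ker ℓ) : Set (ℂ × ℝ)) := by
      ext x
      simp only [mem_ofPred_eq, SetLike.mem_coe, AffineSubspace.mem_mk', LinearMap.mem_ker, vsub_eq_sub, map_sub, hp,
        sub_eq_zero]
    rw [h]
    refine Measure.addHaar_affineSubspace _ _ fun htop => hℓ ?_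
    have := congrArg AffineSubspace.direction htop
    rwa [AffineSubspace.direction_mk', AffineSubspace.direction_top, LinearMap.ker_eq_top] at this
  · have : {x | ℓ x = c} = ∅ := by
      ext x
      simpa using fun hx => hne ⟨x, hx⟩
    rw [this, measure_empty]

lemma existsUnique_add_mem_Icc {x : ℝ} (hx : ∀ n : ℤ, x ≠ n) :
    ∃ m : ℤ, ∀ n : ℤ, x + n ∈ Icc (0 : ℝ) 1 ↔ n = m := by
  refine ⟨-⌊x⌋, fun n => ⟨fun h => ?_, ?_⟩⟩
  · have h1 : x + n ≠ 0 := fun h0 => hx (-n) (by push_cast; linarith)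
    have h2 : x + n ≠ 1 := fun h0 => hx (1 - n) (by push_cast; linarith)
    have h3 : ⌊x⌋ = -n := Int.floor_eq_iff.2 ⟨by push_cast; linarith [h.1], by
      push_cast; linarith [lt_of_le_of_ne h.2 h2]⟩
    omega
  · rintro rfl
    push_cast
    exact ⟨by linarith [Int.floor_le x], by linarith [Int.lt_floor_add_one x]⟩

/-- The strip above the cell `C_D`, a fundamental domain of `Γ'_∞`. -/
def strip (D : ℕ) : Set (ℂ × ℝ) := cell D ×ˢ Ioi 0

lemma measurableSet_strip (D : ℕ) : MeasurableSet (strip D) :=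
  (isCompact_cell D).isClosed.measurableSet.prod measurableSet_Ioi

lemma strip_subset (D : ℕ) : strip D ⊆ H3 := fun _ h => h.2

/-- Two translates can both lie over the closed cell only if a coordinate with respect to `1, w_D`
is an integer. Such points form countably many planes, which are null sets. -/
lemma ae_exists_unip {D : ℕ} (hD : Squarefree D) :
    ∀ᵐ P ∂hypVol, ∃ τ₀ : unipSub D, ∀ τ : unipSub D, act (τ : Gam D) P ∈ strip D ↔ τ = τ₀ := by
  have hx : cx D ∘ₗ LinearMap.fst ℝ ℂ ℝ ≠ 0 := fun h => by
    have := LinearMap.congr_fun h ((1 : ℂ), (0 : ℝ))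
    simp [cx_apply, cy_apply] at this
  have hy : cy D ∘ₗ LinearMap.fst ℝ ℂ ℝ ≠ 0 := fun h => by
    have := LinearMap.congr_fun h (Complex.I, (0 : ℝ))
    simp [cy_apply, (w_im_pos hD).ne'] at this
  have hxn : ∀ᵐ P : ℂ × ℝ, ∀ n : ℤ, cx D P.1 ≠ n := ae_all_iff.2 fun n => by
    simpa [ae_iff] using volume_level_eq_zero _ hx n
  have hyn : ∀ᵐ P : ℂ × ℝ, ∀ n : ℤ, cy D P.1 ≠ n := ae_all_iff.2 fun n => by
    simpa [ae_iff] using volume_level_eq_zero _ hy n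
  filter_upwards [ae_hypVol_of_ae hxn, ae_hypVol_of_ae hyn, ae_mem_H3] with P h1 h2 hP
  obtain ⟨m, hm⟩ := existsUnique_add_mem_Icc h1
  obtain ⟨n, hn⟩ := existsUnique_add_mem_Icc h2
  have hu := unip_mem (mem_ringO.2 ⟨m, n, rfl⟩ : (m + n * w D : ℂ) ∈ ringO D)
  refine ⟨⟨⟨_, hu.1⟩, hu⟩, fun τ => ?_⟩
  obtain ⟨⟨τ, hτΓ⟩, hτ⟩ := τ
  have hτ : τ ∈ GamInf' D := hτ
  obtain ⟨a, b, hab⟩ := mem_ringO.1 (mem_GamInf'.1 hτ).2.2.2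
  have hP : 0 < P.2 := hP
  have hw : ((a : ℝ) : ℂ) + ((b : ℝ) : ℂ) * w D = a + b * w D := by push_cast; rfl
  have key : act τ P ∈ strip D ↔ a = m ∧ b = n := by
    rw [act_unip hτ, strip, mem_prod, mem_cell hD]
    simp only [Prod.fst_add, Prod.snd_add, add_zero, mem_Ioi, hP, and_true, hab]
    rw [map_add (cx D), map_add (cy D), ← hw, cx_add_mul_w hD, cy_add_mul_w hD, hm, hn]
  rw [key]
  constructor
  · rintro ⟨rfl, rfl⟩
    exact Subtype.ext (Subtype.ext (ext_GamInf' hτ hu hab))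
  · intro h
    have h3 : (a : ℂ) + b * w D = m + n * w D := by
      rw [← hab, show τ = unip (m + n * w D) from
        congrArg (fun x : unipSub D => ((x : Gam D) : SL(2, ℂ))) h]
      rfl
    have h4 : ((m : ℝ) : ℂ) + ((n : ℝ) : ℂ) * w D = m + n * w D := by push_cast; rfl
    rw [← hw, ← h4] at h3
    have h5 := congrArg (cx D) h3
    have h6 := congrArg (cy D) h3
    rw [cx_add_mul_w hD, cx_add_mul_w hD] at h5
    rw [cy_add_mul_w hD, cy_add_mul_w hD] at h6
    exact ⟨by exact_mod_cast h5, by exact_mod_cast h6⟩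

/-- Up to sign the element moving `P` into `F` is unique, outside the countably many null sets
pulled back from `F ∩ γ F`. The two signs are the source of the factor 2 in the unfolding. -/
lemma ae_exists_fund {D : ℕ} {F : Set (ℂ × ℝ)} (hF : IsFundDomain D F) :
    ∀ᵐ P ∂hypVol, ∃ γ₀ : Gam D, ∀ γ : Gam D, act γ P ∈ F ↔
      γ = γ₀ ∨ γ = ⟨-γ₀, neg_mem_Gam γ₀.2⟩ := by
  have h : ∀ᵐ P ∂hypVol, ∀ γ₁ γ₂ : Gam D, (γ₂ : SL(2, ℂ)) ≠ γ₁ → (γ₂ : SL(2, ℂ)) ≠ -γ₁ →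
      P ∈ H3 → ¬ (act γ₁ P ∈ F ∧ act γ₂ P ∈ F) := by
    refine ae_all_iff.2 fun γ₁ => ae_all_iff.2 fun γ₂ => ?_
    by_cases h1 : (γ₂ : SL(2, ℂ)) = γ₁
    · simp [h1]
    by_cases h2 : (γ₂ : SL(2, ℂ)) = -γ₁
    · simp [h2]
    have h0 := hF.disjoint (γ₂ * (γ₁ : SL(2, ℂ))⁻¹) (mul_mem γ₂.2 (inv_mem γ₁.2))
      (fun h => h1 (by rwa [mul_inv_eq_one] at h))
      (fun h => h2 (by rw [mul_inv_eq_iff_eq_mul] at h; simpa using h))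
    have h3 := (measurePreserving_act (γ₂ : SL(2, ℂ))).quasiMeasurePreserving.preimage_null h0
    rw [ae_iff]
    refine measure_mono_null (fun P hP => ?_) h3
    simp only [mem_ofPred_eq, Classical.not_imp, not_not] at hP
    obtain ⟨-, -, hPH, hP1, hP2⟩ := hP
    refine ⟨hP2, act γ₁ P, hP1, ?_⟩
    rw [← act_mul _ _ hPH, inv_mul_cancel_right]
  filter_upwards [h, hF.covers, ae_mem_H3] with P h1 h2 hP
  obtain ⟨γ₀, hγ₀, h2⟩ := h2
  refine ⟨⟨γ₀, hγ₀⟩, fun γ => ⟨fun hγ => ?_, ?_⟩⟩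
  · by_contra hne
    push Not at hne
    exact h1 ⟨γ₀, hγ₀⟩ γ (fun h => hne.1 (Subtype.ext h)) (fun h => hne.2 (Subtype.ext h)) hP
      ⟨h2, hγ⟩
  · rintro (rfl | rfl)
    · exact h2
    · simpa only [act_neg] using h2

/-! ### Unfolding -/

section Unfolding

variable {D : ℕ} {F : Set (ℂ × ℝ)}

open scoped ENNReal

/-- Both sides evaluate the sum over `γ ∈ Γ` of the integrals over `F` of `h · 1_strip` at `γP`.
Writing `γ = τσ` and summing over `τ ∈ Γ'_∞` removes the indicator, since almost every point has
exactly one translate in the strip. Moving each `γ` to the domain of integration instead covers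
almost every point of the strip exactly twice. -/
lemma lintegral_unfold (hD : Squarefree D) (hF : IsFundDomain D F) {h : ℂ × ℝ → ℝ≥0∞}
    (hm : AEMeasurable h hypVol) (hinv : ∀ τ ∈ GamInf' D, ∀ P ∈ H3, h (act τ P) = h P) :
    ∑' σ : Cosets D, ∫⁻ P in F, h (act (σ.out : Gam D) P) ∂hypVol
      = 2 * ∫⁻ P in strip D, h P ∂hypVol := by
  have hE := measurableSet_strip D
  have hmE : AEMeasurable ((strip D).indicator h) hypVol := hm.indicator hE
  have hcomp : ∀ γ : SL(2, ℂ), AEMeasurable (fun P => (strip D).indicator h (act γ P)) hypVol :=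
    fun γ => AEMeasurable.comp_quasiMeasurePreserving hmE
      (measurePreserving_act γ).quasiMeasurePreserving
  have h1 : ∀ᵐ P ∂hypVol, ∑' γ : Gam D, (act γ ⁻¹' F).indicator ((strip D).indicator h) P
      = 2 * (strip D).indicator h P := by
    filter_upwards [ae_exists_fund hF] with P hP
    obtain ⟨γ₀, hγ₀⟩ := hP
    have hne : γ₀ ≠ ⟨-γ₀, neg_mem_Gam γ₀.2⟩ := fun h =>
      neg_ne_self (γ₀ : SL(2, ℂ)) (congrArg Subtype.val h).symm
    have m1 : P ∈ act γ₀ ⁻¹' F := (hγ₀ _).2 (Or.inl rfl)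
    have m2 : P ∈ act (⟨-γ₀, neg_mem_Gam γ₀.2⟩ : Gam D) ⁻¹' F := (hγ₀ _).2 (Or.inr rfl)
    rw [tsum_eq_sum (s := {γ₀, ⟨-γ₀, neg_mem_Gam γ₀.2⟩}), Finset.sum_pair hne,
      indicator_of_mem m1, indicator_of_mem m2, two_mul]
    intro γ hγ
    refine indicator_of_notMem (fun hmem => hγ ?_) _
    simpa using (hγ₀ γ).1 hmem
  have h2 : ∀ᵐ P ∂hypVol, ∀ σ : Cosets D, ∑' τ : unipSub D,
      (strip D).indicator h (act ((τ : Gam D) * (σ.out : Gam D) : SL(2, ℂ)) P)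
        = h (act (σ.out : Gam D) P) := by
    refine ae_all_iff.2 fun σ => ?_
    filter_upwards [(measurePreserving_act (σ.out : Gam D)).quasiMeasurePreserving.ae
      (ae_exists_unip hD), ae_mem_H3] with P hP hPH
    obtain ⟨τ₀, hτ₀⟩ := hP
    rw [tsum_eq_single τ₀ fun τ hτ => ?_]
    · rw [act_mul _ _ hPH, indicator_of_mem ((hτ₀ τ₀).2 rfl)]
      exact hinv _ τ₀.2 _ (act_mem _ hPH)
    · rw [act_mul _ _ hPH]
      exact indicator_of_notMem (fun hmem => hτ ((hτ₀ τ).1 hmem)) _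
  symm
  calc 2 * ∫⁻ P in strip D, h P ∂hypVol
      = ∫⁻ P, ∑' γ : Gam D, (act γ ⁻¹' F).indicator ((strip D).indicator h) P ∂hypVol := by
        rw [lintegral_congr_ae h1, lintegral_const_mul'' _ hmE, lintegral_indicator hE]
    _ = ∑' γ : Gam D, ∫⁻ P, (act γ ⁻¹' F).indicator ((strip D).indicator h) P ∂hypVol :=
        lintegral_tsum fun γ => hmE.indicator (measurable_act _ hF.measurable)
    -- The sum is reindexed by inverses, so that the substitution `P ↦ γP` restores the domain `F`.
    _ = ∑' γ : Gam D, ∫⁻ P, (act (γ⁻¹ : Gam D) ⁻¹' F).indicator ((strip D).indicator h) P ∂hypVol :=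
        ((Equiv.inv (Gam D)).tsum_eq _).symm
    _ = ∑' γ : Gam D, ∫⁻ P in F, (strip D).indicator h (act γ P) ∂hypVol := by
        refine tsum_congr fun γ => ?_
        rw [← lintegral_indicator hF.measurable]
        have hmp := measurePreserving_act (γ : SL(2, ℂ))
        have hm' : AEMeasurable ((act (γ⁻¹ : Gam D) ⁻¹' F).indicator ((strip D).indicator h))
          (hypVol.map (act (γ : SL(2, ℂ)))) := by
          rw [hmp.map_eq]
          exact hmE.indicator (measurable_act _ hF.measurable)
        conv_lhs => rw [← hmp.map_eq]
        rw [lintegral_map' hm' hmp.aemeasurable]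
        refine lintegral_congr_ae ?_
        filter_upwards [ae_mem_H3] with P hP
        have : act (γ⁻¹ : Gam D) (act γ P) = P := act_inv_act _ hP
        by_cases hPF : P ∈ F
        · rw [indicator_of_mem hPF, indicator_of_mem]
          rwa [mem_preimage, this]
        · rw [indicator_of_notMem hPF, indicator_of_notMem]
          rwa [mem_preimage, this]
    _ = ∑' p : Cosets D × unipSub D, ∫⁻ P in F, (strip D).indicator h
          (act ((p.2 : Gam D) * (p.1.out : Gam D) : SL(2, ℂ)) P) ∂hypVol :=
        ((gamEquiv D).tsum_eq _).symm
    _ = ∑' σ : Cosets D, ∑' τ : unipSub D, ∫⁻ P in F, (strip D).indicator h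
          (act ((τ : Gam D) * (σ.out : Gam D) : SL(2, ℂ)) P) ∂hypVol := ENNReal.tsum_prod'
    _ = ∑' σ : Cosets D, ∫⁻ P in F, h (act (σ.out : Gam D) P) ∂hypVol := by
        refine tsum_congr fun σ => ?_
        rw [← lintegral_tsum fun τ => (hcomp _).restrict]
        refine lintegral_congr_ae (ae_restrict_of_ae ?_)
        filter_upwards [h2] with P hP using hP σ

lemma integrableOn_act (hD : Squarefree D) (hF : IsFundDomain D F) {E : Type*}
    [NormedAddCommGroup E] {u : ℂ × ℝ → E} (hu : AEStronglyMeasurable u hypVol)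
    (hint : IntegrableOn u (strip D) hypVol)
    (hinv : ∀ τ ∈ GamInf' D, ∀ P ∈ H3, u (act τ P) = u P) (σ : Cosets D) :
    IntegrableOn (fun P => u (act (σ.out : Gam D) P)) F hypVol := by
  refine ⟨(hu.comp_measurePreserving (measurePreserving_act _)).restrict, ?_⟩
  have h := lintegral_unfold hD hF hu.enorm fun τ hτ P hP => by rw [hinv τ hτ P hP]
  exact lt_of_le_of_lt (ENNReal.le_tsum σ) (h ▸ ENNReal.mul_lt_top (by simp) hint.2)

lemma hasSum_unfold_real (hD : Squarefree D) (hF : IsFundDomain D F)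
    {u : ℂ × ℝ → ℝ} (hu : AEStronglyMeasurable u hypVol) (hint : IntegrableOn u (strip D) hypVol)
    (hinv : ∀ τ ∈ GamInf' D, ∀ P ∈ H3, u (act τ P) = u P) :
    HasSum (fun σ : Cosets D => ∫ P in F, u (act (σ.out : Gam D) P) ∂hypVol)
      (2 * ∫ P in strip D, u P ∂hypVol) := by
  -- Stated for the truncation `max v 0`, this gives the positive part from `u` and the negative
  -- part from `-u`.
  have main : ∀ v : ℂ × ℝ → ℝ, AEStronglyMeasurable v hypVol →
      IntegrableOn v (strip D) hypVol → (∀ τ ∈ GamInf' D, ∀ P ∈ H3, v (act τ P) = v P) →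
      HasSum (fun σ : Cosets D =>
        (∫⁻ P in F, ENNReal.ofReal (v (act (σ.out : Gam D) P)) ∂hypVol).toReal)
        (2 * (∫⁻ P in strip D, ENNReal.ofReal (v P) ∂hypVol).toReal) := by
    intro v hv hvint hvinv
    have h := lintegral_unfold hD hF hv.aemeasurable.ennreal_ofReal
      fun τ hτ P hP => by rw [hvinv τ hτ P hP]
    have hfin : ∫⁻ P in strip D, ENNReal.ofReal (v P) ∂hypVol ≠ ⊤ := hvint.lintegral_lt_top.ne
    have h3 := ENNReal.hasSum_toReal (f := fun σ : Cosets D =>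
      ∫⁻ P in F, ENNReal.ofReal (v (act (σ.out : Gam D) P)) ∂hypVol)
      (by rw [h]; exact ENNReal.mul_ne_top (by simp) hfin)
    rw [← ENNReal.tsum_toReal_eq (ENNReal.ne_top_of_tsum_ne_top
      (by rw [h]; exact ENNReal.mul_ne_top (by simp) hfin)), h, ENNReal.toReal_mul] at h3
    exact h3
  have h1 := main u hu hint hinv
  have h2 := main (fun P => -u P) hu.neg hint.neg fun τ hτ P hP => by rw [hinv τ hτ P hP]
  have h3 := h1.sub h2
  rw [← mul_sub, ← integral_eq_lintegral_pos_part_sub_lintegral_neg_part hint] at h3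
  refine h3.congr_fun fun σ => ?_
  exact integral_eq_lintegral_pos_part_sub_lintegral_neg_part 
    (integrableOn_act hD hF hu hint hinv σ)

lemma hasSum_unfold (hD : Squarefree D) (hF : IsFundDomain D F)
    {u : ℂ × ℝ → ℂ} (hu : AEStronglyMeasurable u hypVol) (hint : IntegrableOn u (strip D) hypVol)
    (hinv : ∀ τ ∈ GamInf' D, ∀ P ∈ H3, u (act τ P) = u P) :
    HasSum (fun σ : Cosets D => ∫ P in F, u (act (σ.out : Gam D) P) ∂hypVol)
      (2 * ∫ P in strip D, u P ∂hypVol) := by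
  have hσ := integrableOn_act hD hF hu hint hinv
  have hre := hasSum_unfold_real hD hF (Complex.continuous_re.comp_aestronglyMeasurable hu) hint.re
    fun τ hτ P hP => congrArg Complex.re (hinv τ hτ P hP)
  have him := hasSum_unfold_real hD hF (Complex.continuous_im.comp_aestronglyMeasurable hu) hint.im
    fun τ hτ P hP => congrArg Complex.im (hinv τ hτ P hP)
  have e1 := Complex.reCLM.integral_comp_comm hint
  have e2 := Complex.imCLM.integral_comp_comm hint
  rw [Complex.hasSum_iff]
  constructor
  · convert hre using 2 with σ
    · exact (Complex.reCLM.integral_comp_comm (hσ σ)).symm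
    · simpa using e1.symm
  · convert him using 2 with σ
    · exact (Complex.imCLM.integral_comp_comm (hσ σ)).symm
    · simpa using e2.symm

end Unfolding

/-! ### Indices -/

section Index

variable {D : ℕ}

lemma SL2_mul_apply (σ τ : SL(2, ℂ)) (i j : Fin 2) :
    (σ * τ) i j = σ i 0 * τ 0 j + σ i 1 * τ 1 j := by
  rw [Matrix.SpecialLinearGroup.coe_mul, Matrix.mul_apply, Fin.sum_univ_two]

lemma SL2_inv_apply (σ : SL(2, ℂ)) : σ⁻¹ 0 0 = σ 1 1 ∧ σ⁻¹ 0 1 = -σ 0 1 ∧ σ⁻¹ 1 0 = -σ 1 0 ∧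
    σ⁻¹ 1 1 = σ 0 0 := by
  rw [Matrix.SpecialLinearGroup.SL2_inv_expl]
  exact ⟨rfl, rfl, rfl, rfl⟩

lemma GamInf'_le : GamInf' D ≤ GamInf D := fun _ h => ⟨h.1, h.2.1⟩

lemma mem_center {σ : SL(2, ℂ)} : σ ∈ Subgroup.center SL(2, ℂ) ↔ σ = 1 ∨ σ = -1 := by
  rw [Matrix.SpecialLinearGroup.mem_center_iff]
  constructor
  · rintro ⟨r, hr, h⟩
    rw [Fintype.card_fin] at hr
    rcases (sq_eq_sq_iff_eq_or_eq_neg.1 (hr.trans (one_pow 2).symm)) with rfl | rfl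
    · exact Or.inl (Subtype.ext (by simpa using h.symm))
    · refine Or.inr (Matrix.SpecialLinearGroup.ext _ _ fun i j => ?_)
      rw [← h, Matrix.SpecialLinearGroup.coe_neg, Matrix.neg_apply]
      fin_cases i <;> fin_cases j <;> simp
  · rintro (rfl | rfl)
    · exact ⟨1, by simp, by simp⟩
    · refine ⟨-1, by simp, ?_⟩
      ext i j
      rw [Matrix.SpecialLinearGroup.coe_neg, Matrix.neg_apply]
      fin_cases i <;> fin_cases j <;> simp

lemma ker_toPSL : toPSL.ker = Subgroup.center SL(2, ℂ) := QuotientGroup.ker_mk' _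

lemma neg_one_mem_GamInf : (-1 : SL(2, ℂ)) ∈ GamInf D :=
  ⟨neg_mem_Gam (one_mem _), by simp [upperTri]⟩

/-- The kernel of the projection is `{±1}`, and `-1` lies in `Γ_∞` but not in `Γ'_∞`. Adjoining it
to `Γ'_∞` doubles the group, and what remains of the index is the index of the images. -/
lemma relIndex_eq : (GamInf' D).relIndex (GamInf D) = 2 * cuspIndexPSL D := by
  have hker : toPSL.ker ≤ GamInf D := fun σ hσ => by
    rw [ker_toPSL, mem_center] at hσ
    rcases hσ with rfl | rfl
    · exact one_mem _
    · exact neg_one_mem_GamInf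
  have h2 : (GamInf' D).relIndex (GamInf' D ⊔ toPSL.ker) = 2 := by
    rw [Subgroup.relIndex_eq_two_iff_exists_notMem_and]
    have hn : (-1 : SL(2, ℂ)) ∉ GamInf' D := fun h => by
      have h1 := (mem_GamInf'.1 h).2.1
      norm_num [Matrix.SpecialLinearGroup.coe_neg] at h1
    refine ⟨-1, (le_sup_right : toPSL.ker ≤ _) (by rw [ker_toPSL, mem_center]; exact Or.inr rfl),
      hn, fun b hb => ?_⟩
    rw [← SetLike.mem_coe, Subgroup.mul_normal] at hb
    obtain ⟨x, hx, y, hy, rfl⟩ := hb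
    rw [SetLike.mem_coe, ker_toPSL, mem_center] at hy
    rcases hy with rfl | rfl
    · exact Or.inr (by simpa using hx)
    · exact Or.inl (by simpa using hx)
  have h3 := Subgroup.relIndex_mul_relIndex _ _ _ (le_sup_left : GamInf' D ≤ GamInf' D ⊔ toPSL.ker)
    (sup_le GamInf'_le hker)
  rw [cuspIndexPSL, Subgroup.relIndex_map_map, sup_eq_left.2 hker, ← h3, h2]

/-! ### Integral coordinates and finiteness of the cusp index. -/

lemma exists_coord_bound (D : ℕ) :
    ∃ C : ℝ, 0 < C ∧ ∀ z : ℂ, |cx D z| ≤ C * ‖z‖ ∧ |cy D z| ≤ C * ‖z‖ := by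
  refine ⟨max 1 (max ‖(cx D).toContinuousLinearMap‖ ‖(cy D).toContinuousLinearMap‖),
    by positivity, fun z => ⟨?_, ?_⟩⟩
  · exact ((cx D).toContinuousLinearMap.le_opNorm z).trans (by gcongr; simp)
  · exact ((cy D).toContinuousLinearMap.le_opNorm z).trans (by gcongr; simp)

/-- The integral coordinates of an element of `𝒪_D`. -/
def coordZ (D : ℕ) (z : ℂ) : ℤ × ℤ := (⌊cx D z⌋, ⌊cy D z⌋)

lemma coordZ_spec (hD : Squarefree D) {z : ℂ} (hz : z ∈ ringO D) :
    ((coordZ D z).1 : ℝ) = cx D z ∧ ((coordZ D z).2 : ℝ) = cy D z := by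
  obtain ⟨a, b, rfl⟩ := mem_ringO.1 hz
  have h : ((a : ℝ) : ℂ) + ((b : ℝ) : ℂ) * w D = a + b * w D := by push_cast; rfl
  rw [coordZ, ← h, cx_add_mul_w hD, cy_add_mul_w hD]
  simp

lemma coordZ_injOn (hD : Squarefree D) : InjOn (coordZ D) (ringO D) := by
  intro z hz z' hz' h
  rw [← cx_add_cy hD z, ← cx_add_cy hD z', ← (coordZ_spec hD hz).1, ← (coordZ_spec hD hz).2,
    ← (coordZ_spec hD hz').1, ← (coordZ_spec hD hz').2, h]

lemma finite_ringO_ball (hD : Squarefree D) (r : ℝ) : {x : ℂ | x ∈ ringO D ∧ ‖x‖ ≤ r}.Finite := by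
  obtain ⟨C, hC, h⟩ := exists_coord_bound D
  refine Set.Finite.of_finite_image (f := coordZ D) ?_ ((coordZ_injOn hD).mono fun x hx => hx.1)
  refine (finite_Icc ((-⌈C * r⌉, -⌈C * r⌉) : ℤ × ℤ) (⌈C * r⌉, ⌈C * r⌉)).subset ?_
  rintro _ ⟨x, ⟨hx, hxr⟩, rfl⟩
  have key : ∀ (n : ℤ) (y : ℝ), (n : ℝ) = y → |y| ≤ C * ‖x‖ → -⌈C * r⌉ ≤ n ∧ n ≤ ⌈C * r⌉ := by
    rintro n y rfl hy
    have h1 : |(n : ℝ)| ≤ ⌈C * r⌉ := hy.trans ((by gcongr : C * ‖x‖ ≤ C * r).trans (Int.le_ceil _))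
    exact abs_le.1 (by exact_mod_cast h1)
  have h1 := key _ _ (coordZ_spec hD hx).1 (h x).1
  have h2 := key _ _ (coordZ_spec hD hx).2 (h x).2
  exact ⟨⟨h1.1, h2.1⟩, ⟨h1.2, h2.2⟩⟩

/-- The two norms are at least 1 and have product 1. -/
lemma norm_diag {σ : SL(2, ℂ)} (h : σ ∈ GamInf D) :
    Complex.normSq (σ 0 0) = 1 ∧ Complex.normSq (σ 1 1) = 1 := by
  have hdet := det_eq σ
  rw [show σ 1 0 = 0 from h.2, mul_zero, sub_zero] at hdet
  have h0 : σ 0 0 ≠ 0 := left_ne_zero_of_mul_eq_one hdet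
  have h1 : σ 1 1 ≠ 0 := right_ne_zero_of_mul_eq_one hdet
  have k0 := one_le_normSq (mem_Gam.1 h.1 0 0) h0
  have k1 := one_le_normSq (mem_Gam.1 h.1 1 1) h1
  have hm : Complex.normSq (σ 0 0) * Complex.normSq (σ 1 1) = 1 := by
    rw [← map_mul, hdet, map_one]
  constructor <;> nlinarith

/-- A left coset is determined by the upper left entry, an element of `𝒪_D` of absolute value one,
and there are finitely many of these. An infinite index would have the value 0 and make the
normalization of `H^l_{km}` meaningless. -/
lemma relIndex_ne_zero (hD : Squarefree D) : (GamInf' D).relIndex (GamInf D) ≠ 0 := by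
  have hfin : Finite (GamInf D ⧸ (GamInf' D).subgroupOf (GamInf D)) := by
    have := (finite_ringO_ball hD 1).to_subtype
    refine Finite.of_injective (β := {x : ℂ | x ∈ ringO D ∧ ‖x‖ ≤ 1})
      (fun q => ⟨(q.out : SL(2, ℂ)) 0 0, mem_Gam.1 q.out.2.1 0 0, ?_⟩) ?_
    · have := (norm_diag q.out.2).1
      rw [Complex.normSq_eq_norm_sq] at this
      nlinarith [norm_nonneg ((q.out : SL(2, ℂ)) 0 0)]
    · intro q q' h
      have h : (q.out : SL(2, ℂ)) 0 0 = (q'.out : SL(2, ℂ)) 0 0 := congrArg Subtype.val h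
      rw [← QuotientGroup.out_eq' q, ← QuotientGroup.out_eq' q', QuotientGroup.eq,
        Subgroup.mem_subgroupOf]
      generalize q.out = a at h ⊢
      generalize q'.out = b at h ⊢
      have ha0 : (a : SL(2, ℂ)) 1 0 = 0 := a.2.2
      have hb0 : (b : SL(2, ℂ)) 1 0 = 0 := b.2.2
      have hda := det_eq a
      have hdb := det_eq b
      rw [ha0, mul_zero, sub_zero] at hda
      rw [hb0, mul_zero, sub_zero] at hdb
      have hne : (b : SL(2, ℂ)) 0 0 ≠ 0 := left_ne_zero_of_mul_eq_one hdb
      have h11 : (a : SL(2, ℂ)) 1 1 = (b : SL(2, ℂ)) 1 1 :=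
        mul_left_cancel₀ hne (by rw [hdb, ← h, hda])
      refine ⟨(Gam D).mul_mem ((Gam D).inv_mem a.2.1) b.2.1, ?_, ?_, ?_⟩ <;>
        simp only [Subgroup.coe_mul, Subgroup.coe_inv, SL2_mul_apply, SL2_inv_apply]
      · simp [ha0, hb0]
      · simp only [hb0, h11]
        linear_combination hdb
      · simp only [ha0, h]
        linear_combination hdb
  exact Nat.card_pos.ne'

end Index

/-! ### The Eisenstein series -/

/-- If `σ` and `σ'` have the same bottom row, `σ' σ⁻¹` is upper triangular with ones on the
diagonal. The sum over cosets is thereby a sum over certain pairs `(c, d)`. -/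
lemma eq_of_bottom_row {D : ℕ} {q q' : Cosets D}
    (h0 : (q.out : SL(2, ℂ)) 1 0 = (q'.out : SL(2, ℂ)) 1 0)
    (h1 : (q.out : SL(2, ℂ)) 1 1 = (q'.out : SL(2, ℂ)) 1 1) : q = q' := by
  rw [← Quotient.out_eq q, ← Quotient.out_eq q']
  refine Quotient.sound (QuotientGroup.rightRel_apply.2 ?_)
  rw [Subgroup.mem_subgroupOf]
  have ha := det_eq (q.out : Gam D)
  have hb := det_eq (q'.out : Gam D)
  refine ⟨(Gam D).mul_mem q'.out.2 ((Gam D).inv_mem q.out.2), ?_, ?_, ?_⟩ <;>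
    simp only [Subgroup.coe_mul, Subgroup.coe_inv, SL2_mul_apply, SL2_inv_apply]
  · rw [h0, h1]
    ring
  · rw [h0, h1]
    linear_combination hb
  · rw [← h0, ← h1]
    linear_combination ha

lemma summable_int_pow_norm {ι : Type*} [Fintype ι] {r : ℝ} (hr : Fintype.card ι < r) :
    Summable fun v : ι → ℤ => ‖v‖ ^ (-r) := by
  classical
  set b := Pi.basisFun ℝ ι
  set L := Submodule.span ℤ (Set.range b)
  have hmem : ∀ v : ι → ℤ, (fun i => (v i : ℝ)) ∈ L := fun v => by
    rw [Module.Basis.mem_span_iff_repr_mem]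
    intro i
    exact ⟨v i, by simp [b]⟩
  have hrank : Module.finrank ℤ L = Fintype.card ι := by
    rw [ZLattice.rank ℝ L, Module.finrank_fintype_fun_eq_card]
  have h := ZLattice.summable_norm_rpow L (-r) (by rw [hrank]; linarith)
  refine (h.comp_injective (i := fun v : ι → ℤ => (⟨_, hmem v⟩ : L)) fun v v' hv => ?_).congr fun v => ?_
  · funext i
    exact Int.cast_injective (α := ℝ) (congrFun (congrArg Subtype.val hv) i)
  · have : ‖(fun i => (v i : ℝ))‖ = ‖v‖ := by
      rw [Pi.norm_def, Pi.norm_def]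
      rfl
    simp [this]

/-- A coset is encoded by the four integral coordinates of its bottom row `(c, d)`. For fixed `P`
the norm of this vector is at most a constant times `√Ω`, so the series is dominated by a sum of
`‖v‖^(-2(1+r))` over `ℤ⁴`, convergent because `2(1+r) > 4`. -/
lemma summable_im_rpow {D : ℕ} (hD : Squarefree D) {P : ℂ × ℝ} (hP : P ∈ H3) {r : ℝ} (hr : 1 < r) :
    Summable fun σ : Cosets D => (act (σ.out : Gam D) P).2 ^ (1 + r) := by
  obtain ⟨C, hC, hcoord⟩ := exists_coord_bound D
  have hP0 : 0 < P.2 := hP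
  set v : Cosets D → Fin 4 → ℤ := fun σ => ![(coordZ D ((σ.out : SL(2, ℂ)) 1 0)).1,
    (coordZ D ((σ.out : SL(2, ℂ)) 1 0)).2, (coordZ D ((σ.out : SL(2, ℂ)) 1 1)).1,
    (coordZ D ((σ.out : SL(2, ℂ)) 1 1)).2] with hv
  have hO : ∀ (σ : Cosets D) (i j), (σ.out : SL(2, ℂ)) i j ∈ ringO D :=
    fun σ => mem_Gam.1 σ.out.2
  have hinj : Function.Injective v := by
    intro q q' h
    have e0 := congrFun h 0
    have e1 := congrFun h 1
    have e2 := congrFun h 2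
    have e3 := congrFun h 3
    simp [hv] at e0 e1 e2 e3
    exact eq_of_bottom_row (coordZ_injOn hD (hO q 1 0) (hO q' 1 0) (Prod.ext e0 e1))
      (coordZ_injOn hD (hO q 1 1) (hO q' 1 1) (Prod.ext e2 e3))
  -- The sum of the constants in `‖c‖ ≤ √Ω / λ` and `‖d‖ ≤ (1 + ‖z‖/λ) √Ω`, times the bound `C` for
  -- the coordinates.
  set B : ℝ := C * (1 / P.2 + (1 + ‖P.1‖ / P.2)) with hB
  have hB0 : 0 < B := by positivity
  have hbound : ∀ σ : Cosets D, ‖v σ‖ ≤ B * Real.sqrt (Om (σ.out : Gam D) P) := by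
    intro σ
    set c := (σ.out : SL(2, ℂ)) 1 0 with hc
    set d := (σ.out : SL(2, ℂ)) 1 1 with hd
    set S := Real.sqrt (Om (σ.out : Gam D) P) with hS
    have hS0 : 0 ≤ S := Real.sqrt_nonneg _
    have hOm : Om (σ.out : Gam D) P = ‖c * P.1 + d‖ ^ 2 + ‖c‖ ^ 2 * P.2 ^ 2 := by
      rw [Om, Complex.normSq_eq_norm_sq, Complex.normSq_eq_norm_sq]
    have h1 : ‖c * P.1 + d‖ ≤ S := Real.le_sqrt_of_sq_le (by rw [hOm]; nlinarith [sq_nonneg (‖c‖ * P.2)])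
    have h2 : ‖c‖ * P.2 ≤ S := Real.le_sqrt_of_sq_le (by rw [hOm]; nlinarith [sq_nonneg ‖c * P.1 + d‖])
    have h3 : ‖c‖ ≤ S / P.2 := by rwa [le_div_iff₀ hP0]
    have h4 : ‖d‖ ≤ S + S / P.2 * ‖P.1‖ := by
      calc ‖d‖ = ‖(c * P.1 + d) - c * P.1‖ := by ring_nf
        _ ≤ ‖c * P.1 + d‖ + ‖c * P.1‖ := norm_sub_le _ _
        _ ≤ S + S / P.2 * ‖P.1‖ := by rw [norm_mul]; gcongr
    have h5 : C * ‖c‖ ≤ B * S := by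
      calc C * ‖c‖ ≤ C * (S / P.2) := by gcongr
        _ ≤ C * (S / P.2) + C * (1 + ‖P.1‖ / P.2) * S := le_add_of_nonneg_right (by positivity)
        _ = B * S := by rw [hB]; ring
    have h6 : C * ‖d‖ ≤ B * S := by
      calc C * ‖d‖ ≤ C * (S + S / P.2 * ‖P.1‖) := by gcongr
        _ ≤ C * (S + S / P.2 * ‖P.1‖) + C * (1 / P.2) * S := le_add_of_nonneg_right (by positivity)
        _ = B * S := by rw [hB]; ring
    rw [pi_norm_le_iff_of_nonneg (by positivity)]
    have hn : ∀ n : ℤ, ‖n‖ = |(n : ℝ)| := fun n => by rw [Int.norm_eq_abs]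
    intro i
    fin_cases i
    · simpa [hv, hn, (coordZ_spec hD (hO σ 1 0)).1] using ((hcoord c).1.trans h5)
    · simpa [hv, hn, (coordZ_spec hD (hO σ 1 0)).2] using ((hcoord c).2.trans h5)
    · simpa [hv, hn, (coordZ_spec hD (hO σ 1 1)).1] using ((hcoord d).1.trans h6)
    · simpa [hv, hn, (coordZ_spec hD (hO σ 1 1)).2] using ((hcoord d).2.trans h6)
  have hsum := ((summable_int_pow_norm (ι := Fin 4) (r := 2 * (1 + r)) (by
    rw [Fintype.card_fin]; push_cast; linarith)).comp_injective hinj).mul_left ((P.2 * B ^ 2) ^ (1 + r))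
  refine Summable.of_nonneg_of_le (fun σ => Real.rpow_nonneg (le_of_lt (act_mem _ hP)) _)
    (fun σ => ?_) hsum
  have hOm := Om_pos (σ.out : Gam D) hP
  -- The bottom row cannot vanish, as the determinant is 1; this is needed to invert the norm below.
  have hv0 : 0 < ‖v σ‖ := by
    rw [norm_pos_iff]
    intro h0
    have e0 := congrFun h0 0
    have e1 := congrFun h0 1
    have e2 := congrFun h0 2
    have e3 := congrFun h0 3
    simp [hv] at e0 e1 e2 e3
    have hz : coordZ D 0 = (0, 0) := by simp [coordZ]
    have hc := coordZ_injOn hD (hO σ 1 0) (zero_mem _) ((Prod.ext e0 e1).trans hz.symm)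
    have hd := coordZ_injOn hD (hO σ 1 1) (zero_mem _) ((Prod.ext e2 e3).trans hz.symm)
    have := det_eq (σ.out : Gam D)
    simp [hc, hd] at this
  have h1 : (act (σ.out : Gam D) P).2 ≤ P.2 * B ^ 2 * (‖v σ‖ ^ 2)⁻¹ := by
    have h2 : ‖v σ‖ ^ 2 ≤ B ^ 2 * Om (σ.out : Gam D) P := by
      calc ‖v σ‖ ^ 2 ≤ (B * Real.sqrt (Om (σ.out : Gam D) P)) ^ 2 := by gcongr; exact hbound σ
        _ = _ := by rw [mul_pow, Real.sq_sqrt hOm.le]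
    rw [act, ← div_eq_mul_inv, div_le_div_iff₀ hOm (by positivity)]
    nlinarith
  calc (act (σ.out : Gam D) P).2 ^ (1 + r) ≤ (P.2 * B ^ 2 * (‖v σ‖ ^ 2)⁻¹) ^ (1 + r) :=
        Real.rpow_le_rpow (le_of_lt (act_mem _ hP)) h1 (by linarith)
    _ = (P.2 * B ^ 2) ^ (1 + r) * ‖v σ‖ ^ (-(2 * (1 + r))) := by
        rw [Real.mul_rpow (by positivity) (by positivity), Real.inv_rpow (by positivity),
          Real.rpow_neg (norm_nonneg _), Real.rpow_mul (norm_nonneg _)]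
        norm_num

/-! ### Legendre polynomials -/

section Legendre

open Polynomial

lemma derivative_sq_sub_one_pow (l : ℕ) :
    derivative ((X ^ 2 - 1 : ℝ[X]) ^ (l + 1)) = C (2 * (l + 1 : ℝ)) * X * (X ^ 2 - 1) ^ l := by
  rw [derivative_pow_succ]
  simp only [derivative_sub, derivative_X_pow, derivative_one, map_mul, map_add, map_one, map_natCast,
    map_ofNat, Nat.cast_ofNat]
  ring

/-- With `u = (X² - 1)^l` one has `(X² - 1) u' = 2 l X u`; differentiating this `n + 1` times gives
the identity. -/
lemma iterate_derivative_sq_sub_one_pow (l n : ℕ) :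
    (X ^ 2 - 1 : ℝ[X]) * (derivative^[n + 2] ((X ^ 2 - 1) ^ l) : ℝ[X]) =
      C (2 * ((l : ℝ) - n - 1)) * X * (derivative^[n + 1] ((X ^ 2 - 1) ^ l) : ℝ[X]) +
        C ((n + 1) * (2 * l - n) : ℝ) * (derivative^[n] ((X ^ 2 - 1) ^ l) : ℝ[X]) := by
  induction n with
  | zero =>
    have h : (X ^ 2 - 1 : ℝ[X]) * derivative ((X ^ 2 - 1) ^ l) = C (2 * (l : ℝ)) * X * (X ^ 2 - 1) ^ l := by
      cases l with
      | zero => simp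
      | succ l =>
        rw [derivative_sq_sub_one_pow]
        push_cast
        ring
    have h2 := congrArg derivative h
    simp only [derivative_mul, derivative_sub, derivative_X_pow, derivative_one, derivative_C, derivative_X] at h2
    simp only [Function.iterate_succ', Function.iterate_zero, Function.comp_apply, id_eq]
    simp only [map_mul, map_sub, map_add, map_one, map_natCast, map_ofNat, CharP.cast_eq_zero, map_zero] at h2 ⊢
    simp only [Nat.cast_ofNat] at h2
    linear_combination h2
  | succ n ih =>
    have h2 := congrArg derivative ih
    simp only [derivative_mul, derivative_add, derivative_sub, derivative_X_pow, derivative_one, derivative_C,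
      derivative_X, ← Function.iterate_succ_apply' derivative, Nat.cast_ofNat] at h2
    simp only [map_mul, map_sub, map_add, map_one, map_natCast, map_ofNat, Nat.cast_succ] at h2 ⊢
    linear_combination h2

/-- The value at `t` of the `m`-th derivative of the Legendre polynomial `P_l`. -/
def Q (l m : ℕ) (t : ℝ) : ℝ := (derivative^[m] (legendre l)).eval t

/-- The previous identity with `n = m + l`, in view of Rodrigues' formula. The case `m = 0` is
Legendre's equation. -/
lemma legendre_ode (l m : ℕ) :
    (X ^ 2 - 1 : ℝ[X]) * derivative^[m + 2] (legendre l) =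
      - (C (2 * (m + 1 : ℝ)) * X * derivative^[m + 1] (legendre l)) +
        C (((l : ℝ) + m + 1) * (l - m)) * derivative^[m] (legendre l) := by
  have h := iterate_derivative_sq_sub_one_pow l (m + l)
  simp only [legendre, iterate_derivative_C_mul, ← Function.iterate_add_apply] 
  rw [show m + 2 + l = m + l + 2 by ring, show m + 1 + l = m + l + 1 by ring]
  simp only [map_mul, map_sub, map_add, map_one, map_natCast, map_ofNat, Nat.cast_add] at h ⊢
  linear_combination C (1 / (2 ^ l * (l.factorial : ℝ))) * h

lemma Q_ode (l m : ℕ) (t : ℝ) : (1 - t ^ 2) * Q l (m + 2) t =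
    2 * (m + 1) * t * Q l (m + 1) t - (l + m + 1) * (l - m) * Q l m t := by
  have h := congrArg (eval t) (legendre_ode l m)
  simp only [eval_mul, eval_add, eval_sub, eval_neg, eval_pow, eval_X, eval_C, eval_one] at h
  unfold Q
  linear_combination -h

lemma hasDerivAt_Q (l m : ℕ) (t : ℝ) : HasDerivAt (Q l m) (Q l (m + 1) t) t := by
  have := (derivative^[m] (legendre l)).hasDerivAt t
  rwa [← Function.iterate_succ_apply' derivative] at this

lemma continuous_Q (l m : ℕ) : Continuous (Q l m) := Polynomial.continuous _

lemma Q_eq_zero (l : ℕ) (t : ℝ) : Q l (l + 1) t = 0 := by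
  have h : derivative^[l + 1] (legendre l) = 0 := by
    rw [legendre, iterate_derivative_C_mul, ← Function.iterate_add_apply]
    rw [iterate_derivative_eq_zero, mul_zero]
    have h1 : ((X : ℝ[X]) ^ 2 - 1).natDegree ≤ 2 := by compute_degree
    calc ((X ^ 2 - 1 : ℝ[X]) ^ l).natDegree ≤ l * ((X : ℝ[X]) ^ 2 - 1).natDegree := natDegree_pow_le
      _ ≤ l * 2 := by gcongr
      _ < l + 1 + l := by omega
  simp [Q, h]

/-- In Rodrigues' formula two of the `l + 3` derivatives are carried out explicitly on `(X² -
1)^(l+2)`; the two resulting terms are the two Legendre terms. -/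
lemma derivative_legendre_add_two (l : ℕ) :
    derivative (legendre (l + 2)) =
      C (2 * l + 3 : ℝ) * legendre (l + 1) + derivative (legendre l) := by
  have h2 : derivative^[2] ((X ^ 2 - 1 : ℝ[X]) ^ (l + 2)) =
      C (2 * (l + 2) * (2 * l + 3) : ℝ) * (X ^ 2 - 1) ^ (l + 1) +
        C (4 * (l + 1) * (l + 2) : ℝ) * (X ^ 2 - 1) ^ l := by
    have e1 := derivative_sq_sub_one_pow (l + 1)
    have e2 := derivative_sq_sub_one_pow l
    simp only [Function.iterate_succ', Function.iterate_zero, Function.comp_apply, id_eq]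
    rw [show l + 2 = l + 1 + 1 by ring, e1]
    simp only [derivative_mul, derivative_C, derivative_X, e2]
    simp only [map_mul, map_sub, map_add, map_one, map_natCast, map_ofNat, Nat.cast_add, Nat.cast_one]
    ring
  have hf : derivative (legendre (l + 2)) = C (1 / (2 ^ (l + 2) * ((l + 2).factorial : ℝ))) *
      derivative^[l + 1] (derivative^[2] ((X ^ 2 - 1 : ℝ[X]) ^ (l + 2))) := by
    rw [legendre, derivative_C_mul, ← Function.iterate_succ_apply' derivative,
      ← Function.iterate_add_apply]
  have hne : ((l.factorial : ℕ) : ℝ) ≠ 0 := by positivity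
  rw [hf, h2, iterate_map_add, iterate_derivative_C_mul, iterate_derivative_C_mul, mul_add,
    ← mul_assoc, ← mul_assoc, ← C_mul, ← C_mul, legendre, legendre, derivative_C_mul,
    ← mul_assoc (C (2 * l + 3 : ℝ)), ← C_mul, ← Function.iterate_succ_apply' derivative]
  congr 3 <;>
  · simp only [Nat.factorial_succ, pow_succ]
    push_cast
    field_simp
    ring

lemma legendre_zero : legendre 0 = 1 := by simp [legendre]

lemma legendre_one : legendre 1 = X := by
  simp [legendre]
  rw [one_add_one_eq_two, show (2 : ℝ[X]) = C 2 from rfl, ← mul_assoc, ← C_mul]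
  norm_num

/-- At `t = 1` the leading coefficient of Legendre's equation vanishes, so `P_n'(1)` is `n(n+1)/2 ·
P_n(1)`. The recurrence for the derivatives then determines the values by induction. -/
lemma Q_one_zero (l : ℕ) : Q l 0 1 = 1 ∧ Q l 1 1 = l * (l + 1) / 2 := by
  have hode : ∀ n, Q n 1 1 = n * (n + 1) / 2 * Q n 0 1 := fun n => by
    have := Q_ode n 0 1
    norm_num at this
    linarith
  have key : ∀ n, Q n 0 1 = 1 ∧ Q (n + 1) 0 1 = 1 := by
    intro n
    induction n with
    | zero => simp [Q, legendre_zero, legendre_one]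
    | succ n ih =>
      refine ⟨ih.2, ?_⟩
      have h := congrArg (eval 1) (derivative_legendre_add_two n)
      simp only [eval_add, eval_mul, eval_C] at h
      have h : Q (n + 2) 1 1 = (2 * n + 3) * Q (n + 1) 0 1 + Q n 1 1 := h
      rw [hode, hode, ih.1, ih.2] at h
      push_cast at h
      have hn : ((n : ℝ) + 2) * (n + 3) / 2 ≠ 0 := by positivity
      have : (n + 2 : ℝ) * (n + 3) / 2 * Q (n + 2) 0 1 = (n + 2 : ℝ) * (n + 3) / 2 * 1 := by
        linear_combination h
      exact mul_left_cancel₀ hn this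
  refine ⟨(key l).1, ?_⟩
  rw [hode, (key l).1, mul_one]

lemma Q_neg_one_zero (l : ℕ) : Q l 0 (-1) = (-1) ^ l := by
  have hode : ∀ n, Q n 1 (-1) = -(n * (n + 1) / 2 * Q n 0 (-1)) := fun n => by
    have := Q_ode n 0 (-1)
    norm_num at this
    linarith
  have key : ∀ n, Q n 0 (-1) = (-1) ^ n ∧ Q (n + 1) 0 (-1) = (-1) ^ (n + 1) := by
    intro n
    induction n with
    | zero => simp [Q, legendre_zero, legendre_one]
    | succ n ih =>
      refine ⟨ih.2, ?_⟩
      have h := congrArg (eval (-1)) (derivative_legendre_add_two n)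
      simp only [eval_add, eval_mul, eval_C] at h
      have h : Q (n + 2) 1 (-1) = (2 * n + 3) * Q (n + 1) 0 (-1) + Q n 1 (-1) := h
      rw [hode, hode, ih.1, ih.2] at h
      push_cast at h
      have hn : ((n : ℝ) + 2) * (n + 3) / 2 ≠ 0 := by positivity
      have : (n + 2 : ℝ) * (n + 3) / 2 * Q (n + 2) 0 (-1) = (n + 2 : ℝ) * (n + 3) / 2 * (-1) ^ (n + 2) := by
        rw [pow_succ] at h
        rw [pow_succ, pow_succ]
        linear_combination -h
      exact mul_left_cancel₀ hn this
  exact (key l).1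

/-- The integral of a polynomial over `[-1, 1]`. -/
def polyInt : ℝ[X] →ₗ[ℝ] ℝ where
  toFun p := ∫ x in (-1 : ℝ)..1, p.eval x
  map_add' p q := by
    simp only [eval_add]
    exact intervalIntegral.integral_add (p.continuous.intervalIntegrable _ _)
      (q.continuous.intervalIntegrable _ _)
  map_smul' c p := by simp

lemma polyInt_derivative (p : ℝ[X]) : polyInt (derivative p) = p.eval 1 - p.eval (-1) :=
  intervalIntegral.integral_eq_sub_of_hasDerivAt (fun x _ => p.hasDerivAt x)
    ((derivative p).continuous.intervalIntegrable _ _)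

lemma polyInt_C_mul (c : ℝ) (p : ℝ[X]) : polyInt (C c * p) = c * polyInt p := by
  rw [← smul_eq_C_mul, map_smul, smul_eq_mul]

/-- Sturm-Liouville argument: the product is, up to the nonzero difference of the eigenvalues, the
derivative of `1 - X²` times a Wronskian, which vanishes at both ends. -/
lemma polyInt_legendre_mul_legendre {l n : ℕ} (h : l ≠ n) :
    polyInt (legendre l * legendre n) = 0 := by
  have hl := legendre_ode l 0
  have hn := legendre_ode n 0
  simp only [Function.iterate_succ', Function.iterate_zero, Function.comp_apply, id_eq, zero_add] at hl hn
  have key : derivative ((1 - X ^ 2) * (legendre l * derivative (legendre n) -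
      derivative (legendre l) * legendre n)) =
      C ((l * (l + 1) - n * (n + 1) : ℝ)) * (legendre l * legendre n) := by
    simp only [derivative_mul, derivative_sub, derivative_X_pow, derivative_one]
    simp only [map_mul, map_sub, map_add, map_one, map_natCast, map_ofNat, CharP.cast_eq_zero,
      map_zero] at hl hn ⊢
    simp only [Nat.cast_ofNat]
    linear_combination legendre n * hl - legendre l * hn
  have h1 := polyInt_derivative ((1 - X ^ 2) * (legendre l * derivative (legendre n) -
      derivative (legendre l) * legendre n))
  rw [key, polyInt_C_mul] at h1
  simp only [eval_mul, eval_sub, eval_one, eval_pow, eval_X] at h1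
  norm_num at h1
  rcases h1 with h1 | h1
  · exfalso
    have h2 : ((l : ℝ) - n) * (l + n + 1) = 0 := by linear_combination h1
    rcases mul_eq_zero.1 h2 with h3 | h3
    · exact h (by exact_mod_cast sub_eq_zero.1 h3)
    · exact absurd h3 (by positivity)
  · exact h1

/-- By the recurrence `P_n'` is a combination of Legendre polynomials of degree less than `n`, all
orthogonal to `P_l`. -/
lemma polyInt_legendre_mul_derivative {l n : ℕ} (h : n ≤ l) :
    polyInt (legendre l * derivative (legendre n)) = 0 := by
  induction n using Nat.strong_induction_on with
  | _ n ih =>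
    match n, h, ih with
    | 0, _, _ => simp [legendre_zero]
    | 1, h, _ =>
      have := polyInt_legendre_mul_legendre (l := l) (n := 0) (by omega)
      rw [legendre_zero] at this
      rwa [legendre_one, derivative_X]
    | n + 2, h, ih =>
      rw [derivative_legendre_add_two, mul_add, map_add, mul_left_comm, polyInt_C_mul,
        polyInt_legendre_mul_legendre (by omega), ih n (by omega) (by omega)]
      simp

/-- Integrate `(P_l P_{l+1})'`. The boundary values give 2, the term with `P_l'` vanishes by
orthogonality, and the recurrence reduces `P_{l+1}'` to `(2l+1) P_l` plus an orthogonal term. -/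
lemma polyInt_legendre_sq (l : ℕ) : polyInt (legendre l * legendre l) = 2 / (2 * l + 1) := by
  have hl : (2 * l + 1 : ℝ) ≠ 0 := by positivity
  have h := polyInt_derivative (legendre l * legendre (l + 1))
  rw [derivative_mul, map_add, mul_comm (derivative (legendre l)),
    polyInt_legendre_mul_derivative (Nat.le_succ l), zero_add, eval_mul, eval_mul] at h
  have e1 : ∀ n, eval 1 (legendre n) = 1 := fun n => (Q_one_zero n).1
  have e2 : ∀ n, eval (-1) (legendre n) = (-1) ^ n := Q_neg_one_zero
  have e3 : (-1 : ℝ) ^ l * (-1) ^ (l + 1) = -1 := by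
    rw [← pow_add, Odd.neg_one_pow ⟨l, by ring⟩]
  rw [e1, e1, e2, e2, e3] at h
  rw [eq_div_iff hl]
  cases l with
  | zero => simp [legendre_zero, legendre_one] at h ⊢; linarith
  | succ l =>
    rw [derivative_legendre_add_two, mul_add, map_add, mul_left_comm, polyInt_C_mul,
      polyInt_legendre_mul_derivative (Nat.le_succ l)] at h
    push_cast at h ⊢
    linarith

lemma integral_cos_mul_sin (p : ℝ[X]) :
    ∫ θ in (0 : ℝ)..Real.pi, p.eval (Real.cos θ) * Real.sin θ = polyInt p := by
  have h := intervalIntegral.integral_comp_mul_deriv (a := 0) (b := Real.pi) (f := Real.cos)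
    (f' := fun x => -Real.sin x) (g := fun x => p.eval x) (fun x _ => Real.hasDerivAt_cos x)
    (by fun_prop) p.continuous
  rw [Real.cos_zero, Real.cos_pi, intervalIntegral.integral_symm (-1) 1] at h
  simp only [Function.comp_apply, mul_neg, intervalIntegral.integral_neg] at h
  exact neg_injective h

end Legendre

/-! ### Rotations -/

/-- The rotation by `β` about the third axis. -/
def rotZ (β : ℝ) : ℂ × ℝ →L[ℝ] ℂ × ℝ :=
  LinearMap.toContinuousLinearMap
    { toFun := fun v => (Complex.exp (Complex.I * β) * v.1, v.2)
      map_add' := fun v v' => by simp [mul_add]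
      map_smul' := fun c v => by
        ext1
        · simp
          ring
        · simp }

/-- The rotation by `α` in the plane of the first and the third axis. -/
def rotY (α : ℝ) : ℂ × ℝ →L[ℝ] ℂ × ℝ :=
  LinearMap.toContinuousLinearMap
    { toFun := fun v => (((Real.cos α * v.1.re + Real.sin α * v.2 : ℝ) : ℂ) + v.1.im * Complex.I,
        -(Real.sin α * v.1.re) + Real.cos α * v.2)
      map_add' := fun v v' => by
        ext1
        · simp
          ring
        · simp
          ring
      map_smul' := fun c v => by
        ext1
        · simp
          ring
        · simp
          ring }

lemma rotZ_apply (β : ℝ) (v : ℂ × ℝ) : rotZ β v = (Complex.exp (Complex.I * β) * v.1, v.2) := rfl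

lemma rotY_apply (α : ℝ) (v : ℂ × ℝ) : rotY α v =
    (((Real.cos α * v.1.re + Real.sin α * v.2 : ℝ) : ℂ) + v.1.im * Complex.I,
        -(Real.sin α * v.1.re) + Real.cos α * v.2) := rfl

lemma rotY_re (α : ℝ) (v : ℂ × ℝ) :
    (rotY α v).1.re = Real.cos α * v.1.re + Real.sin α * v.2 := by
  rw [rotY_apply]
  simp [-Complex.ofReal_add, -Complex.ofReal_mul]

lemma rotY_im (α : ℝ) (v : ℂ × ℝ) : (rotY α v).1.im = v.1.im := by
  rw [rotY_apply]
  simp [-Complex.ofReal_add, -Complex.ofReal_mul]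

lemma rotY_snd (α : ℝ) (v : ℂ × ℝ) :
    (rotY α v).2 = -(Real.sin α * v.1.re) + Real.cos α * v.2 := rfl

lemma exp_mul_conj_exp (β : ℝ) :
    Complex.exp (Complex.I * β) * conj (Complex.exp (Complex.I * β)) = 1 := by
  rw [← Complex.exp_conj, ← Complex.exp_add]
  simp

lemma isOrth_rotZ (β : ℝ) : IsOrth (rotZ β) := fun v => by
  have h : Complex.normSq (Complex.exp (Complex.I * β)) = 1 := by
    apply Complex.ofReal_injective
    rw [← Complex.mul_conj, exp_mul_conj_exp, Complex.ofReal_one]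
  rw [rotZ_apply, en, en, map_mul, h, one_mul]

lemma isOrth_rotY (α : ℝ) : IsOrth (rotY α) := fun v => by
  rw [en, en, Complex.normSq_apply, Complex.normSq_apply, rotY_re, rotY_im, rotY_snd]
  linear_combination (v.1.re ^ 2 + v.2 ^ 2) * Real.sin_sq_add_cos_sq α

lemma IsOrth.comp {R S : ℂ × ℝ →L[ℝ] ℂ × ℝ} (hR : IsOrth R) (hS : IsOrth S) :
    IsOrth (R.comp S) := fun v => by
  rw [ContinuousLinearMap.comp_apply, hR, hS]

/-- The rotation that takes the north pole to the point with spherical coordinates `(α, β)`. -/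
def frame (α β : ℝ) : ℂ × ℝ →L[ℝ] ℂ × ℝ := (rotZ β).comp (rotY α)

lemma isOrth_frame (α β : ℝ) : IsOrth (frame α β) := (isOrth_rotZ β).comp (isOrth_rotY α)

/-- The north pole of the sphere. -/
def north : ℂ × ℝ := (0, 1)

lemma frame_north (α β : ℝ) : frame α β north = spherePt α β := by
  rw [frame, ContinuousLinearMap.comp_apply, rotY_apply, rotZ_apply, spherePt, north]
  ext1
  · simp
    ring
  · simp

lemma en_spherePt (θ φ : ℝ) : en (spherePt θ φ) = 1 := by
  rw [← frame_north, isOrth_frame]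
  simp [en, north]

lemma exists_spherePt {p : ℂ × ℝ} (hp : en p = 1) :
    ∃ θ ∈ Icc 0 Real.pi, ∃ φ ∈ Icc (-Real.pi) Real.pi, spherePt θ φ = p := by
  have h1 : p.2 ^ 2 ≤ 1 := by
    have := Complex.normSq_nonneg p.1
    unfold en at hp
    linarith
  have h2 := abs_le.1 ((sq_le_one_iff_abs_le_one p.2).1 h1)
  refine ⟨Real.arccos p.2, ⟨Real.arccos_nonneg _, Real.arccos_le_pi _⟩, p.1.arg,
    ⟨(Complex.neg_pi_lt_arg _).le, Complex.arg_le_pi _⟩, ?_⟩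
  have h3 : Real.sqrt (1 - p.2 ^ 2) = ‖p.1‖ := by
    rw [← Real.sqrt_sq (norm_nonneg p.1), ← Complex.normSq_eq_norm_sq]
    congr 1
    unfold en at hp
    linarith
  rw [spherePt, Real.sin_arccos, Real.cos_arccos h2.1 h2.2, h3, mul_comm Complex.I,
    Complex.norm_mul_exp_arg_mul_I]

/-! ### The addition theorem for spherical harmonics -/

/-- The square of the normalizing factor of `Y^l_m`. -/
def nrm (l m : ℕ) : ℝ :=
  (2 * l + 1) / (4 * Real.pi) * (((l - m).factorial : ℝ) / ((l + m).factorial : ℝ))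

lemma nrm_nonneg (l m : ℕ) : 0 ≤ nrm l m := by unfold nrm; positivity

/-- The weights are those for which the derivatives in `kern_rotY` telescope. -/
lemma nrm_succ {l m : ℕ} (h : m < l) :
    nrm l (m + 1) * ((l + m + 1) * (l - m)) = nrm l m := by
  obtain ⟨j, rfl⟩ : ∃ j, l = m + 1 + j := ⟨l - (m + 1), by omega⟩
  have e1 : m + 1 + j - (m + 1) = j := by omega
  have e2 : m + 1 + j - m = j + 1 := by omega
  rw [nrm, nrm, e1, e2, ← add_assoc, Nat.factorial_succ, Nat.factorial_succ]
  have hf : ((m + 1 + j + m).factorial : ℝ) ≠ 0 := by positivity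
  have h3 : ((m : ℝ) + 1 + j + m + 1) ≠ 0 := by positivity
  push_cast
  field_simp
  ring

/-- The zonal kernel `(2 l + 1) / (4 π) P_l`. -/
def zonal (l : ℕ) (x : ℝ) : ℝ := (2 * l + 1) / (4 * Real.pi) * Q l 0 x

/-- `z ^ m P_l^(m)(t)`, a spherical harmonic without its normalizing factor. -/
def A (l : ℕ) (z : ℂ) (t : ℝ) (m : ℕ) : ℂ := z ^ m * (Q l m t : ℝ)

/-- The reproducing kernel of the spherical harmonics of degree `l`. -/
def kern (l : ℕ) (q p : ℂ × ℝ) : ℂ :=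
  nrm l 0 * (A l q.1 q.2 0 * A l (conj p.1) p.2 0) +
    ∑ m ∈ Finset.range l, nrm l (m + 1) * (A l q.1 q.2 (m + 1) * A l (conj p.1) p.2 (m + 1) +
      conj (A l q.1 q.2 (m + 1) * A l (conj p.1) p.2 (m + 1)))

lemma sum_Icc_neg {M : Type*} [AddCommMonoid M] (f : ℤ → M) (l : ℕ) :
    ∑ m ∈ Finset.Icc (-(l : ℤ)) l, f m =
      f 0 + ∑ m ∈ Finset.range l, (f ((m + 1 : ℕ) : ℤ) + f (-((m + 1 : ℕ) : ℤ))) := by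
  induction l with
  | zero => simp
  | succ l ih =>
    have h : Finset.Icc (-((l + 1 : ℕ) : ℤ)) ((l + 1 : ℕ) : ℤ) =
        insert ((l + 1 : ℕ) : ℤ) (insert (-((l + 1 : ℕ) : ℤ)) (Finset.Icc (-(l : ℤ)) l)) := by
      ext m
      simp only [Finset.mem_insert, Finset.mem_Icc]
      omega
    rw [h, Finset.sum_insert, Finset.sum_insert, ih, Finset.sum_range_succ]
    · abel
    · simp
    · simp
      omega

lemma sphHarm_natCast_mul (l m : ℕ) (q p : ℂ × ℝ) :
    sphHarm l m q * conj (sphHarm l m p) = nrm l m * (A l q.1 q.2 m * A l (conj p.1) p.2 m) := by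
  have h1 : (-1 : ℂ) ^ m * (-1) ^ m = 1 := by rw [← mul_pow]; simp
  have h2 : (Real.sqrt (nrm l m) : ℂ) * Real.sqrt (nrm l m) = nrm l m := by
    rw [← Complex.ofReal_mul, Real.mul_self_sqrt (nrm_nonneg _ _)]
  simp only [sphHarm, Int.natAbs_natCast, Nat.cast_nonneg, if_true, Int.natCast_nonneg]
  rw [← nrm, ← Q, ← Q]
  simp only [map_mul, map_pow, map_neg, map_one, Complex.conj_ofReal, A]
  calc _ = ((-1 : ℂ) ^ m * (-1) ^ m) * ((Real.sqrt (nrm l m) : ℂ) * Real.sqrt (nrm l m)) *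
        (q.1 ^ m * Q l m q.2 * (conj p.1 ^ m * Q l m p.2)) := by ring
    _ = _ := by rw [h1, h2, one_mul]

lemma sphHarm_neg_mul (l m : ℕ) (q p : ℂ × ℝ) :
    sphHarm l (-((m + 1 : ℕ) : ℤ)) q * conj (sphHarm l (-((m + 1 : ℕ) : ℤ)) p) =
      nrm l (m + 1) * conj (A l q.1 q.2 (m + 1) * A l (conj p.1) p.2 (m + 1)) := by
  have h2 : (Real.sqrt (nrm l (m + 1)) : ℂ) * Real.sqrt (nrm l (m + 1)) = nrm l (m + 1) := by
    rw [← Complex.ofReal_mul, Real.mul_self_sqrt (nrm_nonneg _ _)]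
  have h3 : ¬ (0 : ℤ) ≤ -((m + 1 : ℕ) : ℤ) := by omega
  simp only [sphHarm, Int.natAbs_neg, Int.natAbs_natCast, h3, if_false]
  rw [← nrm, ← Q, ← Q]
  simp only [map_mul, map_pow, map_one, Complex.conj_ofReal, Complex.conj_conj, A]
  calc _ = ((Real.sqrt (nrm l (m + 1)) : ℂ) * Real.sqrt (nrm l (m + 1))) *
        (conj q.1 ^ (m + 1) * Q l (m + 1) q.2 * (p.1 ^ (m + 1) * Q l (m + 1) p.2)) := by ring
    _ = _ := by rw [h2]

lemma sum_sphHarm (l : ℕ) (q p : ℂ × ℝ) :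
    ∑ m ∈ Finset.Icc (-(l : ℤ)) l, sphHarm l m q * conj (sphHarm l m p) = kern l q p := by
  rw [sum_Icc_neg, kern]
  have h0 := sphHarm_natCast_mul l 0 q p
  rw [Nat.cast_zero] at h0
  rw [h0]
  congr 1
  refine Finset.sum_congr rfl fun m _ => ?_
  rw [sphHarm_natCast_mul, sphHarm_neg_mul, mul_add]

lemma kern_rotZ (l : ℕ) (β : ℝ) (q p : ℂ × ℝ) : kern l (rotZ β q) (rotZ β p) = kern l q p := by
  have h : ∀ m, A l (rotZ β q).1 (rotZ β q).2 m * A l (conj (rotZ β p).1) (rotZ β p).2 m =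
      A l q.1 q.2 m * A l (conj p.1) p.2 m := fun m => by
    have h1 : Complex.exp (Complex.I * β) ^ m * conj (Complex.exp (Complex.I * β)) ^ m = 1 := by
      rw [← mul_pow, exp_mul_conj_exp, one_pow]
    simp only [A, rotZ_apply, map_mul, mul_pow]
    linear_combination (q.1 ^ m * (Q l m q.2 : ℂ) * (conj p.1 ^ m * (Q l m p.2 : ℂ))) * h1
  simp only [kern, h]

/-- Ladder relation: along a rotation in the plane of the first and third axes, the derivative of
order `m + 1` involves only the orders `m` and `m + 2`. It follows from the differentiated Legendre
equation on the unit sphere. -/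
lemma hasDerivAt_A (l : ℕ) {z : ℝ → ℂ} {t : ℝ → ℝ} {α : ℝ} (hz : HasDerivAt z (t α) α)
    (ht : HasDerivAt t (-(z α).re) α) (hn : Complex.normSq (z α) + t α ^ 2 = 1) (m : ℕ) :
    HasDerivAt (fun a => A l (z a) (t a) (m + 1))
      ((-A l (z α) (t α) (m + 2) + ((l + m + 1) * (l - m)) * A l (z α) (t α) m) / 2) α := by
  have h1 := (hz.pow (m + 1)).mul ((hasDerivAt_Q l (m + 1) (t α)).comp α ht).ofReal_comp
  refine h1.congr_deriv ?_
  have hode : ((1 - t α ^ 2) * Q l (m + 2) (t α) : ℂ) =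
      2 * (m + 1) * t α * Q l (m + 1) (t α) - (l + m + 1) * (l - m) * Q l m (t α) := by
    exact_mod_cast Q_ode l m (t α)
  have hn' : z α * conj (z α) = 1 - (t α : ℂ) ^ 2 := by
    rw [Complex.mul_conj]
    have : Complex.normSq (z α) = 1 - t α ^ 2 := by linarith
    rw [this]
    push_cast
    ring
  have hre : (((z α).re : ℝ) : ℂ) = (z α + conj (z α)) / 2 := by
    rw [Complex.add_conj]
    push_cast
    ring
  simp only [A, Function.comp_apply, Pi.pow_apply, Complex.ofReal_mul, Complex.ofReal_neg, hre,
    Nat.add_sub_cancel]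
  push_cast
  linear_combination (-(z α) ^ m / 2) * hode - ((z α) ^ m * Q l (m + 2) (t α) / 2) * hn'

lemma hasDerivAt_A_zero (l : ℕ) {z : ℝ → ℂ} {t : ℝ → ℝ} {α : ℝ}
    (ht : HasDerivAt t (-(z α).re) α) :
    HasDerivAt (fun a => A l (z a) (t a) 0)
      (-(A l (z α) (t α) 1 + conj (A l (z α) (t α) 1)) / 2) α := by
  have h1 := ((hasDerivAt_Q l 0 (t α)).comp α ht).ofReal_comp
  simp only [A, pow_zero, one_mul]
  refine h1.congr_deriv ?_
  have hre : (((z α).re : ℝ) : ℂ) = (z α + conj (z α)) / 2 := by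
    rw [Complex.add_conj]
    push_cast
    ring
  simp only [Complex.ofReal_mul, Complex.ofReal_neg, hre, map_mul, Complex.conj_ofReal, pow_one]
  ring

lemma A_succ_eq_zero (l : ℕ) (z : ℂ) (t : ℝ) : A l z t (l + 1) = 0 := by
  simp [A, Q_eq_zero]

/-- The kernel is constant in `α` because its derivative vanishes: by the ladder relation the
derivative of the summand of order `m + 1` is a difference of consecutive terms. The sum telescopes,
its end at `m = l` vanishes since the derivative of `P_l` of order `l + 1` is zero, and its start
cancels the derivative of the summand of order 0. -/
lemma kern_rotY (l : ℕ) (α : ℝ) {q p : ℂ × ℝ} (hq : en q = 1) (hp : en p = 1) :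
    kern l (rotY α q) (rotY α p) = kern l q p := by
  have hz : ∀ (v : ℂ × ℝ) (a : ℝ), HasDerivAt (fun a => (rotY a v).1) ((rotY a v).2 : ℂ) a := by
    intro v a
    have h1 : HasDerivAt (fun a => Real.cos a * v.1.re + Real.sin a * v.2) (rotY a v).2 a := by
      refine (((Real.hasDerivAt_cos a).mul_const _).add ((Real.hasDerivAt_sin a).mul_const _)).congr_deriv ?_
      rw [rotY_apply]
      ring
    exact h1.ofReal_comp.add_const _
  have ht : ∀ (v : ℂ × ℝ) (a : ℝ), HasDerivAt (fun a => (rotY a v).2) (-(rotY a v).1.re) a := by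
    intro v a
    have h1 : HasDerivAt (fun a => -(Real.sin a * v.1.re) + Real.cos a * v.2)
        (-(Real.cos a * v.1.re) + -Real.sin a * v.2) a :=
      (((Real.hasDerivAt_sin a).mul_const _).neg).add ((Real.hasDerivAt_cos a).mul_const _)
    refine h1.congr_deriv ?_
    rw [rotY_re]
    ring
  have hzc : ∀ (v : ℂ × ℝ) (a : ℝ),
      HasDerivAt (fun a => conj (rotY a v).1) ((rotY a v).2 : ℂ) a := by
    intro v a
    have := (hz v a).star
    simpa using this
  have htc : ∀ (v : ℂ × ℝ) (a : ℝ),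
      HasDerivAt (fun a => (rotY a v).2) (-(conj (rotY a v).1).re) a := by
    intro v a
    simpa using ht v a
  have hnorm : ∀ {v : ℂ × ℝ} (a : ℝ), en v = 1 →
      Complex.normSq (rotY a v).1 + (rotY a v).2 ^ 2 = 1 := fun a hv => (isOrth_rotY a _).trans hv
  set f : ℕ → ℝ → ℂ := fun m a => A l (rotY a q).1 (rotY a q).2 m with hf
  set g : ℕ → ℝ → ℂ := fun m a => A l (conj (rotY a p).1) (rotY a p).2 m with hg
  have hf0 : ∀ a, HasDerivAt (f 0) (-(f 1 a + conj (f 1 a)) / 2) a := fun a =>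
    hasDerivAt_A_zero l (ht q a)
  have hg0 : ∀ a, HasDerivAt (g 0) (-(g 1 a + conj (g 1 a)) / 2) a := fun a =>
    hasDerivAt_A_zero l (htc p a)
  have hfs : ∀ m a, HasDerivAt (f (m + 1))
      ((-f (m + 2) a + ((l + m + 1) * (l - m)) * f m a) / 2) a := fun m a =>
    hasDerivAt_A l (hz q a) (ht q a) (hnorm a hq) m
  have hgs : ∀ m a, HasDerivAt (g (m + 1))
      ((-g (m + 2) a + ((l + m + 1) * (l - m)) * g m a) / 2) a := fun m a =>
    hasDerivAt_A l (hzc p a) (htc p a) (by rw [Complex.normSq_conj]; exact hnorm a hp) m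
  -- The telescoping quantity, taken below together with its conjugate.
  set E : ℕ → ℝ → ℂ := fun m a => nrm l m * (f (m + 1) a * g m a + f m a * g (m + 1) a) / 2 with hE
  have hterm : ∀ m < l, ∀ a, HasDerivAt (fun a => (nrm l (m + 1) : ℂ) * (f (m + 1) a * g (m + 1) a +
      conj (f (m + 1) a * g (m + 1) a)))
      ((E m a + conj (E m a)) - (E (m + 1) a + conj (E (m + 1) a))) a := by
    intro m hm a
    have hn : (nrm l (m + 1) : ℂ) * ((l + m + 1) * (l - m)) = nrm l m := by
      exact_mod_cast nrm_succ hm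
    have h1 := (hfs m a).mul (hgs m a)
    have h2 := (h1.add h1.star).const_mul (nrm l (m + 1) : ℂ)
    refine h2.congr_deriv ?_
    simp only [hE, star_add, star_mul', Complex.star_def, map_add, map_mul, map_div₀, map_sub, map_neg,
      Complex.conj_ofReal, map_natCast, map_one, map_ofNat]
    rw [← hn]
    ring
  have hder : ∀ a, HasDerivAt (fun a => kern l (rotY a q) (rotY a p)) 0 a := by
    intro a
    have h0 := (((hf0 a).mul (hg0 a)).const_mul (nrm l 0 : ℂ)).add
      (HasDerivAt.fun_sum fun m (hm : m ∈ Finset.range l) => hterm m (Finset.mem_range.1 hm) a)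
    refine h0.congr_deriv ?_
    rw [Finset.sum_range_sub' (fun m => E m a + conj (E m a))]
    have e1 : f (l + 1) a = 0 := A_succ_eq_zero _ _ _
    have e2 : g (l + 1) a = 0 := A_succ_eq_zero _ _ _
    have r1 : conj (f 0 a) = f 0 a := by simp [hf, A]
    have r2 : conj (g 0 a) = g 0 a := by simp [hg, A]
    simp only [hE, e1, e2, map_add, map_mul, map_div₀, Complex.conj_ofReal, r1, r2, map_ofNat, map_zero,
      zero_add]
    ring
  have hconst := is_const_of_deriv_eq_zero (f := fun a => kern l (rotY a q) (rotY a p))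
    (fun a => (hder a).differentiableAt) (fun a => (hder a).deriv) α 0
  have h0 : ∀ v, rotY 0 v = v := fun v => by
    rw [rotY_apply]
    ext1
    · simp
    · simp
  simpa [h0] using hconst

lemma kern_north (l : ℕ) (p : ℂ × ℝ) : kern l north p = zonal l p.2 := by
  have h : ∀ m, A l north.1 north.2 (m + 1) = 0 := fun m => by simp [A, north]
  have h1 : Q l 0 1 = 1 := (Q_one_zero l).1
  have hf : (l.factorial : ℂ) ≠ 0 := by exact_mod_cast l.factorial_ne_zero
  simp only [kern, h]
  simp [A, north, h1, zonal, nrm, div_self hf]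

/-- By invariance `q` may be moved to the north pole, where every summand with `m ≠ 0` vanishes; the
height of the rotated `p` is the inner product of `q` and `p`. -/
lemma kern_eq_zonal (l : ℕ) {q p : ℂ × ℝ} (hq : en q = 1) (hp : en p = 1) :
    kern l q p = zonal l (ed q p) := by
  obtain ⟨α, -, β, -, rfl⟩ := exists_spherePt hq
  set p' := (frame α β).inverse p with hp'
  have hpp : p = rotZ β (rotY α p') := ((isOrth_frame α β).apply_inverse p).symm
  have hen : en p' = 1 := by rw [hp', (isOrth_frame α β).inverse, hp]
  have hN : en north = 1 := by simp [en, north]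
  have hd : ed (spherePt α β) p = p'.2 := by
    rw [← frame_north, ← (isOrth_frame α β).apply_inverse p, (isOrth_frame α β).ed]
    simp [ed, north, hp']
  rw [hd, ← frame_north, hpp, frame, ContinuousLinearMap.comp_apply, kern_rotZ,
    kern_rotY l α hN hen, kern_north]

/-- The addition theorem for spherical harmonics. -/
theorem addition_theorem (l : ℕ) {q p : ℂ × ℝ} (hq : en q = 1) (hp : en p = 1) :
    ∑ m ∈ Finset.Icc (-(l : ℤ)) l, sphHarm l m q * conj (sphHarm l m p) = zonal l (ed q p) := by
  rw [sum_sphHarm, kern_eq_zonal l hq hp]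

/-! ### Spherical coordinates -/

section Spherical

open scoped ENNReal

lemma lintegral_polar_halfPlane {g : ℝ × ℝ → ℝ≥0∞} (hg : Measurable g) :
    ∫⁻ t, ∫⁻ ρ in Ioi (0 : ℝ), g (t, ρ) = ∫⁻ θ in Ioo 0 Real.pi, ∫⁻ r in Ioi (0 : ℝ),
      ENNReal.ofReal r * g (r * Real.cos θ, r * Real.sin θ) := by
  set h : ℝ × ℝ → ℝ≥0∞ := (univ ×ˢ Ioi (0 : ℝ)).indicator g with hh
  have hS : MeasurableSet ((univ : Set ℝ) ×ˢ Ioi (0 : ℝ)) := MeasurableSet.univ.prod measurableSet_Ioi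
  have hm : Measurable h := hg.indicator hS
  have hm2 : Measurable fun p : ℝ × ℝ => ENNReal.ofReal p.1 * h (p.1 * Real.cos p.2, p.1 * Real.sin p.2) :=
    (by fun_prop : Measurable fun p : ℝ × ℝ => ENNReal.ofReal p.1).mul
      (hm.comp (by fun_prop))
  have e1 : ∫⁻ t, ∫⁻ ρ in Ioi (0 : ℝ), g (t, ρ) = ∫⁻ p, h p := by
    rw [Measure.volume_eq_prod, lintegral_prod _ hm.aemeasurable]
    refine lintegral_congr fun t => ?_
    rw [← lintegral_indicator measurableSet_Ioi]
    refine lintegral_congr fun ρ => ?_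
    simp [hh, indicator]
  rw [e1, ← lintegral_comp_polarCoord_symm, polarCoord_target, Measure.volume_eq_prod,
    ← Measure.prod_restrict, lintegral_prod_symm]
  · have hsub : Ioo 0 Real.pi ⊆ Ioo (-Real.pi) Real.pi := Ioo_subset_Ioo_left (by linarith [Real.pi_pos])
    symm
    rw [← lintegral_indicator measurableSet_Ioo, ← lintegral_indicator measurableSet_Ioo]
    refine lintegral_congr fun θ => ?_
    by_cases hθ : θ ∈ Ioo 0 Real.pi
    · rw [indicator_of_mem hθ, indicator_of_mem (hsub hθ)]
      refine setLIntegral_congr_fun measurableSet_Ioi fun r hr => ?_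
      have hpos : 0 < r * Real.sin θ := mul_pos hr (Real.sin_pos_of_mem_Ioo hθ)
      simp [hh, polarCoord, indicator, hpos]
    · rw [indicator_of_notMem hθ]
      by_cases hθ' : θ ∈ Ioo (-Real.pi) Real.pi
      · rw [indicator_of_mem hθ']
        symm
        refine setLIntegral_eq_zero measurableSet_Ioi fun r hr => ?_
        have hle : θ ≤ 0 := by
          by_contra hcon
          exact hθ ⟨not_le.1 hcon, hθ'.2⟩
        have hpos : ¬ 0 < r * Real.sin θ := not_lt.2 (mul_nonpos_of_nonneg_of_nonpos (le_of_lt hr)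
          (Real.sin_nonpos_of_nonpos_of_neg_pi_le hle hθ'.1.le))
        simp [hh, polarCoord, indicator, hpos]
      · rw [indicator_of_notMem hθ']
  · refine (Measurable.aemeasurable ?_)
    simpa [polarCoord] using hm2

lemma lintegral_cylindrical {f : ℂ × ℝ → ℝ≥0∞} (hf : Measurable f) :
    ∫⁻ x, f x = ∫⁻ φ in Ioo (-Real.pi) Real.pi, ∫⁻ t, ∫⁻ ρ in Ioi (0 : ℝ),
      ENNReal.ofReal ρ * f (ρ * Complex.exp (Complex.I * φ), t) := by
  have hm : Measurable fun x : (ℝ × ℝ) × ℝ =>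
      ENNReal.ofReal x.1.1 * f (x.1.1 * Complex.exp (Complex.I * x.1.2), x.2) :=
    (by fun_prop : Measurable fun x : (ℝ × ℝ) × ℝ => ENNReal.ofReal x.1.1).mul
      (hf.comp (by fun_prop))
  have h1 : ∀ t : ℝ, ∫⁻ z : ℂ, f (z, t) = ∫⁻ φ in Ioo (-Real.pi) Real.pi, ∫⁻ ρ in Ioi (0 : ℝ),
      ENNReal.ofReal ρ * f (ρ * Complex.exp (Complex.I * φ), t) := by
    intro t
    have hm' : Measurable fun p : ℝ × ℝ =>
        ENNReal.ofReal p.1 * f (p.1 * Complex.exp (Complex.I * p.2), t) :=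
      hm.comp (by fun_prop : Measurable fun p : ℝ × ℝ => (p, t))
    rw [← Complex.lintegral_comp_polarCoord_symm, polarCoord_target, Measure.volume_eq_prod,
      ← Measure.prod_restrict]
    have e : ∀ p : ℝ × ℝ, ENNReal.ofReal p.1 • f (Complex.polarCoord.symm p, t) =
        ENNReal.ofReal p.1 * f (p.1 * Complex.exp (Complex.I * p.2), t) := fun p => by
      rw [Complex.polarCoord_symm_apply, mul_comm Complex.I, Complex.exp_mul_I]
      simp
    simp only [e]
    rw [lintegral_prod_symm _ hm'.aemeasurable]
  rw [Measure.volume_eq_prod, lintegral_prod_symm _ hf.aemeasurable]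
  simp only [h1]
  refine lintegral_lintegral_swap (Measurable.aemeasurable ?_)
  exact Measurable.lintegral_prod_right' (f := fun x : (ℝ × ℝ) × ℝ =>
    ENNReal.ofReal x.2 * f (x.2 * Complex.exp (Complex.I * x.1.2), x.1.1))
    (hm.comp (by fun_prop : Measurable fun x : (ℝ × ℝ) × ℝ => ((x.2, x.1.2), x.1.1)))

/-- Polar coordinates are used twice: in the plane of the first two coordinates, then in the
half-plane of height and radius, where the angle runs over `(0, π)`. -/
lemma lintegral_spherical {f : ℂ × ℝ → ℝ≥0∞} (hf : Measurable f) :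
    ∫⁻ x, f x = ∫⁻ φ in Ioo (-Real.pi) Real.pi, ∫⁻ θ in Ioo 0 Real.pi, ∫⁻ r in Ioi (0 : ℝ),
      ENNReal.ofReal r * (ENNReal.ofReal (r * Real.sin θ) * f (r • spherePt θ φ)) := by
  rw [lintegral_cylindrical hf]
  refine lintegral_congr fun φ => ?_
  have hm : Measurable fun x : ℝ × ℝ =>
      ENNReal.ofReal x.2 * f (x.2 * Complex.exp (Complex.I * φ), x.1) :=
    (by fun_prop : Measurable fun x : ℝ × ℝ => ENNReal.ofReal x.2).mul (hf.comp (by fun_prop))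
  rw [lintegral_polar_halfPlane hm]
  refine lintegral_congr fun θ => lintegral_congr fun r => ?_
  have : ((((r * Real.sin θ : ℝ) : ℂ) * Complex.exp (Complex.I * φ), r * Real.cos θ) : ℂ × ℝ) =
      r • spherePt θ φ := by
    simp [spherePt, mul_assoc]
  simp only [this]

lemma continuous_spherePt : Continuous fun x : ℝ × ℝ => spherePt x.2 x.1 := by
  unfold spherePt
  fun_prop

/-- The parameter measure `dφ dθ` of spherical coordinates. -/
def angMeas : Measure (ℝ × ℝ) :=
  (volume.restrict (Ioo (-Real.pi) Real.pi)).prod (volume.restrict (Ioo 0 Real.pi))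

/-- The surface measure of the unit sphere. -/
def sphMeas : Measure (ℂ × ℝ) :=
  (angMeas.withDensity fun x => ENNReal.ofReal (Real.sin x.2)).map fun x => spherePt x.2 x.1

/-- The unit sphere. -/
def sph : Set (ℂ × ℝ) := {p | en p = 1}

lemma isCompact_sph : IsCompact sph :=
  (isCompact_en_le 1).of_isClosed_subset (isClosed_eq continuous_en continuous_const)
    fun _ h => le_of_eq h

lemma measurableSet_sph : MeasurableSet sph := isCompact_sph.isClosed.measurableSet

/-- The part of the unit ball over a set of directions. -/
def cone (A : Set (ℂ × ℝ)) : Set (ℂ × ℝ) :=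
  {x | 0 < en x ∧ en x ≤ 1 ∧ (Real.sqrt (en x))⁻¹ • x ∈ A}

lemma measurableSet_cone {A : Set (ℂ × ℝ)} (hA : MeasurableSet A) : MeasurableSet (cone A) := by
  have h1 : Measurable en := continuous_en.measurable
  refine (measurableSet_lt measurable_const h1).inter
    ((measurableSet_le h1 measurable_const).inter ?_)
  exact (by fun_prop : Measurable fun x : ℂ × ℝ => (Real.sqrt (en x))⁻¹ • x) hA

lemma smul_spherePt_mem_cone {A : Set (ℂ × ℝ)} {r : ℝ} (hr : 0 < r) (θ φ : ℝ) :
    r • spherePt θ φ ∈ cone A ↔ r ≤ 1 ∧ spherePt θ φ ∈ A := by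
  have h1 : en (r • spherePt θ φ) = r ^ 2 := by rw [en_smul, en_spherePt, mul_one]
  rw [cone, mem_ofPred_eq, h1, Real.sqrt_sq hr.le, smul_smul, inv_mul_cancel₀ hr.ne', one_smul,
    sq_le_one_iff_abs_le_one, abs_of_pos hr]
  exact ⟨fun h => h.2, fun h => ⟨by positivity, h⟩⟩

lemma sphMeas_apply {A : Set (ℂ × ℝ)} (hA : MeasurableSet A) :
    sphMeas A = ∫⁻ φ in Ioo (-Real.pi) Real.pi, ∫⁻ θ in Ioo 0 Real.pi,
      ENNReal.ofReal (Real.sin θ) * A.indicator 1 (spherePt θ φ) := by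
  have hc := continuous_spherePt.measurable
  have hm : Measurable fun x : ℝ × ℝ =>
      ENNReal.ofReal (Real.sin x.2) * A.indicator (1 : ℂ × ℝ → ℝ≥0∞) (spherePt x.2 x.1) :=
    (by fun_prop : Measurable fun x : ℝ × ℝ => ENNReal.ofReal (Real.sin x.2)).mul
      ((measurable_one.indicator hA).comp hc)
  rw [sphMeas, Measure.map_apply hc hA, withDensity_apply _ (hc hA), ← lintegral_indicator (hc hA),
    ← lintegral_prod (fun x : ℝ × ℝ =>
      ENNReal.ofReal (Real.sin x.2) * A.indicator 1 (spherePt x.2 x.1)) hm.aemeasurable]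
  refine lintegral_congr fun x => ?_
  by_cases hx : spherePt x.2 x.1 ∈ A
  · rw [indicator_of_mem (show x ∈ (fun x : ℝ × ℝ => spherePt x.2 x.1) ⁻¹' A from hx),
      indicator_of_mem hx]
    simp
  · rw [indicator_of_notMem (show x ∉ (fun x : ℝ × ℝ => spherePt x.2 x.1) ⁻¹' A from hx),
      indicator_of_notMem hx]
    simp

/-- The constant is the integral of `r²` over `(0, 1]`; only that it is finite and nonzero matters.
The lemma expresses surface measure by Lebesgue measure, whose behaviour under linear maps is known.
-/
lemma exists_volume_cone : ∃ K : ℝ≥0∞, K ≠ 0 ∧ K ≠ ⊤ ∧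
    ∀ A : Set (ℂ × ℝ), MeasurableSet A → volume (cone A) = K * sphMeas A := by
  refine ⟨∫⁻ r in Ioi (0 : ℝ), (Iic (1 : ℝ)).indicator
    (fun r => ENNReal.ofReal r * ENNReal.ofReal r) r, ?_, ?_, fun A hA => ?_⟩
  · rw [← pos_iff_ne_zero, setLIntegral_pos_iff]
    · refine lt_of_lt_of_le ?_ (measure_mono (s := Ioo (0 : ℝ) 1) fun r hr => ⟨?_, hr.1⟩)
      · simp
      · rw [Function.mem_support, indicator_of_mem (show r ∈ Iic (1 : ℝ) from hr.2.le)]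
        simpa using hr.1
    · exact Measurable.indicator (by fun_prop) measurableSet_Iic
  · refine ne_top_of_le_ne_top (b := ∫⁻ r in Ioc (0 : ℝ) 1, 1) (by simp) ?_
    rw [← lintegral_indicator measurableSet_Ioi, ← lintegral_indicator measurableSet_Ioc]
    refine lintegral_mono fun r => ?_
    by_cases h0 : r ∈ Ioi (0 : ℝ)
    · rw [indicator_of_mem h0]
      by_cases h1 : r ∈ Iic (1 : ℝ)
      · rw [indicator_of_mem h1, indicator_of_mem (show r ∈ Ioc (0 : ℝ) 1 from ⟨h0, h1⟩)]
        have : ENNReal.ofReal r ≤ 1 := ENNReal.ofReal_le_one.2 h1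
        exact mul_le_one' this this
      · rw [indicator_of_notMem h1]
        exact zero_le
    · rw [indicator_of_notMem h0]
      exact zero_le
  · rw [sphMeas_apply hA, ← lintegral_indicator_one (measurableSet_cone hA),
      lintegral_spherical (measurable_one.indicator (measurableSet_cone hA))]
    have hm : Measurable fun x : ℝ × ℝ =>
        ENNReal.ofReal (Real.sin x.2) * A.indicator (1 : ℂ × ℝ → ℝ≥0∞) (spherePt x.2 x.1) :=
      (by fun_prop : Measurable fun x : ℝ × ℝ => ENNReal.ofReal (Real.sin x.2)).mul
        ((measurable_one.indicator hA).comp continuous_spherePt.measurable)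
    rw [← lintegral_const_mul _ (Measurable.lintegral_prod_right' hm)]
    refine lintegral_congr fun φ => ?_
    have hm' : Measurable fun θ : ℝ =>
        ENNReal.ofReal (Real.sin θ) * A.indicator (1 : ℂ × ℝ → ℝ≥0∞) (spherePt θ φ) :=
      (by fun_prop : Measurable fun θ : ℝ => ENNReal.ofReal (Real.sin θ)).mul
        ((measurable_one.indicator hA).comp (by unfold spherePt; fun_prop))
    refine Eq.trans ?_ (lintegral_const_mul _ hm')
    refine lintegral_congr fun θ => ?_
    rw [mul_comm, ← lintegral_const_mul _ (Measurable.indicator (by fun_prop) measurableSet_Iic)]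
    refine setLIntegral_congr_fun measurableSet_Ioi fun r hr => ?_
    have hmem := smul_spherePt_mem_cone (A := A) hr θ φ
    have hr : 0 < r := hr
    simp only [ENNReal.ofReal_mul hr.le]
    by_cases hA' : spherePt θ φ ∈ A
    · by_cases h1 : r ≤ 1
      · rw [indicator_of_mem (hmem.2 ⟨h1, hA'⟩), indicator_of_mem hA', indicator_of_mem (show r ∈ Iic 1 from h1)]
        simp only [Pi.one_apply, mul_one]
        ring
      · rw [indicator_of_notMem (fun h => h1 (hmem.1 h).1), indicator_of_notMem (show r ∉ Iic 1 from h1)]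
        simp
    · rw [indicator_of_notMem (fun h => hA' (hmem.1 h).2), indicator_of_notMem hA']
      simp

/-- Cones over preimages are preimages of cones, and Lebesgue measure is preserved since `|det R| =
1`. -/
lemma measurePreserving_sphMeas {R : ℂ × ℝ →L[ℝ] ℂ × ℝ} (hR : IsOrth R) :
    MeasurePreserving R sphMeas sphMeas := by
  obtain ⟨K, h0, h1, hK⟩ := exists_volume_cone
  have hRm : Measurable R := R.continuous.measurable
  refine ⟨hRm, Measure.ext fun A hA => ?_⟩
  rw [Measure.map_apply hRm hA, ← ENNReal.mul_right_inj h0 h1, ← hK _ (hRm hA), ← hK _ hA]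
  have hc : cone (R ⁻¹' A) = R ⁻¹' cone A := by
    ext x
    simp only [cone, mem_ofPred_eq, mem_preimage, hR x, map_smul]
  have hdet := hR.abs_det
  rw [hc, Measure.addHaar_preimage_continuousLinearMap]
  · rw [abs_inv, hdet]
    simp
  · intro h
    rw [ContinuousLinearMap.det, h] at hdet
    simp at hdet

instance : IsFiniteMeasure sphMeas := by
  obtain ⟨K, h0, h1, hK⟩ := exists_volume_cone
  have h2 : volume (cone univ) ≠ ⊤ :=
    ne_top_of_le_ne_top (isCompact_en_le 1).measure_ne_top (measure_mono fun x hx => hx.2.1)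
  rw [hK _ MeasurableSet.univ] at h2
  refine ⟨lt_top_iff_ne_top.2 fun h => h2 ?_⟩
  rw [h, ENNReal.mul_top h0]

lemma ae_mem_sph : ∀ᵐ p ∂sphMeas, p ∈ sph := by
  rw [ae_iff, show {p | p ∉ sph} = sphᶜ from rfl, sphMeas_apply measurableSet_sph.compl]
  have : ∀ θ φ, (sphᶜ).indicator (1 : ℂ × ℝ → ℝ≥0∞) (spherePt θ φ) = 0 := fun θ φ =>
    indicator_of_notMem (fun h : spherePt θ φ ∈ sphᶜ => h (en_spherePt θ φ)) _
  simp [this]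

end Spherical

/-! ### Integrals over the sphere in coordinates. -/

section SphereIntegral

variable {E : Type*} [NormedAddCommGroup E] [NormedSpace ℝ E]

lemma integrable_angMeas {G : ℝ × ℝ → E} (hG : Continuous G) : Integrable G angMeas := by
  rw [angMeas, Measure.prod_restrict]
  exact (hG.continuousOn.integrableOn_compact (isCompact_Icc.prod isCompact_Icc)).mono_set
    (prod_mono Ioo_subset_Icc_self Ioo_subset_Icc_self)

lemma integrable_sphMeas {g : ℂ × ℝ → E} (hg : ContinuousOn g sph) : Integrable g sphMeas := by
  have h := hg.integrableOn_compact (μ := sphMeas) isCompact_sph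
  rwa [IntegrableOn, Measure.restrict_eq_self_of_ae_mem ae_mem_sph] at h

lemma integral_sphMeas {g : ℂ × ℝ → E} (hg : ContinuousOn g sph) :
    ∫ p, g p ∂sphMeas = ∫ x, Real.sin x.2 • g (spherePt x.2 x.1) ∂angMeas := by
  have hc := continuous_spherePt.measurable
  rw [sphMeas, integral_map hc.aemeasurable (integrable_sphMeas hg).1,
    integral_withDensity_eq_integral_toReal_smul (by fun_prop) (by simp)]
  have hθ : ∀ᵐ x ∂angMeas, x.2 ∈ Ioo 0 Real.pi := by
    rw [angMeas, Measure.prod_restrict]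
    refine (ae_restrict_mem (measurableSet_Ioo.prod measurableSet_Ioo)).mono fun x hx => hx.2
  refine integral_congr_ae ?_
  filter_upwards [hθ] with x hx
  rw [ENNReal.toReal_ofReal (Real.sin_nonneg_of_nonneg_of_le_pi hx.1.le hx.2.le)]

lemma spherePt_add_two_pi (θ φ : ℝ) : spherePt θ (φ + 2 * Real.pi) = spherePt θ φ := by
  have : Complex.I * ((φ + 2 * Real.pi : ℝ) : ℂ) = Complex.I * φ + 2 * Real.pi * Complex.I := by
    push_cast
    ring
  rw [spherePt, spherePt, this, Complex.exp_periodic]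

lemma continuous_comp_spherePt {g : ℂ × ℝ → E} (hg : ContinuousOn g sph) :
    Continuous fun x : ℝ × ℝ => g (spherePt x.2 x.1) :=
  hg.comp_continuous continuous_spherePt fun x => en_spherePt _ _

/-- The mean of a function on the sphere over the circle of latitude `θ`. -/
def mean (g : ℂ × ℝ → ℂ) (θ : ℝ) : ℂ :=
  ∫ φ in (0 : ℝ)..(2 * Real.pi), g (spherePt θ φ)

/-- The two ranges of `φ`, `[0, 2π]` and `(-π, π)`, are interchangeable by periodicity. -/
lemma sphereInt_eq {g : ℂ × ℝ → ℂ} (hg : ContinuousOn g sph) :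
    sphereInt g = ∫ p, g p ∂sphMeas := by
  have hG := continuous_comp_spherePt hg
  have hi : Integrable (fun x : ℝ × ℝ => Real.sin x.2 • g (spherePt x.2 x.1)) angMeas :=
    integrable_angMeas ((by fun_prop : Continuous fun x : ℝ × ℝ => Real.sin x.2).smul hG)
  have hper : Function.Periodic (fun φ : ℝ => ∫ θ in (0 : ℝ)..Real.pi,
      g (spherePt θ φ) * (Real.sin θ : ℂ)) (2 * Real.pi) := fun φ => by
    simp only [spherePt_add_two_pi]
  have h1 := hper.intervalIntegral_add_eq 0 (-Real.pi)
  rw [zero_add, show -Real.pi + 2 * Real.pi = Real.pi by ring] at h1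
  rw [sphereInt, h1, integral_sphMeas hg, angMeas, integral_prod _ hi,
    intervalIntegral.integral_of_le (by linarith [Real.pi_pos]), integral_Ioc_eq_integral_Ioo]
  refine integral_congr_ae (Filter.Eventually.of_forall fun φ => ?_)
  simp only
  rw [intervalIntegral.integral_of_le Real.pi_pos.le, integral_Ioc_eq_integral_Ioo]
  simp only [Complex.real_smul, mul_comm]

lemma integral_mul_snd {g : ℂ × ℝ → ℂ} (hg : ContinuousOn g sph) {k : ℝ → ℝ} (hk : Continuous k) :
    ∫ p, g p * k p.2 ∂sphMeas =
      ∫ θ in (0 : ℝ)..Real.pi, mean g θ * (k (Real.cos θ) * Real.sin θ : ℝ) := by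
  have hG := continuous_comp_spherePt hg
  have hgk : ContinuousOn (fun p : ℂ × ℝ => g p * k p.2) sph := hg.mul (by fun_prop)
  have hi : Integrable (fun x : ℝ × ℝ => Real.sin x.2 • (g (spherePt x.2 x.1) * k (spherePt x.2 x.1).2))
      angMeas := integrable_angMeas (by
        have := continuous_comp_spherePt hgk
        fun_prop)
  rw [integral_sphMeas hgk, angMeas, integral_prod_symm _ hi,
    intervalIntegral.integral_of_le Real.pi_pos.le, integral_Ioc_eq_integral_Ioo]
  refine integral_congr_ae (Filter.Eventually.of_forall fun θ => ?_)
  have hper : Function.Periodic (fun φ : ℝ => g (spherePt θ φ)) (2 * Real.pi) := fun φ => by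
    simp only [spherePt_add_two_pi]
  have h1 := hper.intervalIntegral_add_eq 0 (-Real.pi)
  rw [zero_add, show -Real.pi + 2 * Real.pi = Real.pi by ring] at h1
  simp only
  rw [mean, h1, ← intervalIntegral.integral_mul_const,
    intervalIntegral.integral_of_le (by linarith [Real.pi_pos]), integral_Ioc_eq_integral_Ioo]
  refine integral_congr_ae (Filter.Eventually.of_forall fun φ => ?_)
  simp only [spherePt, Complex.real_smul]
  push_cast
  ring

end SphereIntegral

/-! ### Legendre expansions -/

section LegendreSeries

/-- The `l`-th term of the Legendre series at `t = 1` of a function of `θ = arccos t`. -/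
def legInt (l : ℕ) (a : ℝ → ℂ) : ℂ :=
  (2 * l + 1) / 2 * ∫ θ in (0 : ℝ)..Real.pi, a θ * (Q l 0 (Real.cos θ) * Real.sin θ : ℝ)

lemma integral_Q_sq (l : ℕ) : ∫ θ in (0 : ℝ)..Real.pi, Q l 0 (Real.cos θ) ^ 2 * Real.sin θ =
    2 / (2 * l + 1) := by
  rw [← polyInt_legendre_sq, ← integral_cos_mul_sin]
  refine intervalIntegral.integral_congr fun θ _ => ?_
  simp only [Polynomial.eval_mul, Q, Function.iterate_zero, id_eq]
  ring

/-- The `L²` norm of `P_l` enters through `|x| ≤ (ε/2) x² + 1/(2ε)`, with the optimal `ε = √(2l+1)`.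
-/
lemma integral_abs_Q_le (l : ℕ) :
    ∫ θ in (0 : ℝ)..Real.pi, |Q l 0 (Real.cos θ)| * Real.sin θ ≤ 2 / Real.sqrt (2 * l + 1) := by
  have hQ := continuous_Q l 0
  have h0 : (0 : ℝ) < 2 * l + 1 := by positivity
  set ε := Real.sqrt (2 * l + 1) with hε
  have hε0 : 0 < ε := Real.sqrt_pos.2 h0
  have hε2 : ε ^ 2 = 2 * l + 1 := Real.sq_sqrt h0.le
  calc ∫ θ in (0 : ℝ)..Real.pi, |Q l 0 (Real.cos θ)| * Real.sin θ
      ≤ ∫ θ in (0 : ℝ)..Real.pi, (ε / 2 * (Q l 0 (Real.cos θ) ^ 2 * Real.sin θ) +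
          1 / (2 * ε) * Real.sin θ) := by
        refine intervalIntegral.integral_mono_on Real.pi_pos.le
          ((by fun_prop : Continuous _).intervalIntegrable _ _)
          ((by fun_prop : Continuous _).intervalIntegrable _ _) fun θ hθ => ?_
        have hs := Real.sin_nonneg_of_nonneg_of_le_pi hθ.1 hθ.2
        have key : |Q l 0 (Real.cos θ)| ≤ ε / 2 * Q l 0 (Real.cos θ) ^ 2 + 1 / (2 * ε) := by
          rw [← sq_abs (Q l 0 (Real.cos θ))]
          have : 0 ≤ (ε * |Q l 0 (Real.cos θ)| - 1) ^ 2 / (2 * ε) := by positivity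
          have e : (ε * |Q l 0 (Real.cos θ)| - 1) ^ 2 / (2 * ε) =
            ε / 2 * |Q l 0 (Real.cos θ)| ^ 2 + 1 / (2 * ε) - |Q l 0 (Real.cos θ)| := by
            field_simp
            ring
          linarith
        calc _ ≤ (ε / 2 * Q l 0 (Real.cos θ) ^ 2 + 1 / (2 * ε)) * Real.sin θ := by gcongr
          _ = _ := by ring
    _ = 2 / ε := by
        rw [intervalIntegral.integral_add ((by fun_prop : Continuous _).intervalIntegrable _ _)
          ((by fun_prop : Continuous _).intervalIntegrable _ _),
          intervalIntegral.integral_const_mul, intervalIntegral.integral_const_mul, integral_Q_sq,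
          integral_sin, Real.cos_zero, Real.cos_pi, ← hε2]
        field_simp
        ring

/-- By the mean value inequality `a1` is bounded by `C` times the distance to the nearer endpoint,
and that distance is at most `2 sin θ` by Jordan's inequality and `π ≤ 4`. -/
lemma norm_le_sin_mul {a1 a2 : ℝ → ℂ} (h2 : ∀ θ, HasDerivAt a1 (a2 θ) θ) (h10 : a1 0 = 0)
    (h1π : a1 Real.pi = 0) {C : ℝ} (hC : ∀ θ ∈ Icc 0 Real.pi, ‖a2 θ‖ ≤ C) :
    ∀ θ ∈ Icc 0 Real.pi, ‖a1 θ‖ ≤ 2 * C * Real.sin θ := by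
  intro θ hθ
  have hC0 : 0 ≤ C := (norm_nonneg _).trans (hC 0 ⟨le_rfl, Real.pi_pos.le⟩)
  have hmv : ∀ x ∈ Icc 0 Real.pi, ∀ y ∈ Icc 0 Real.pi, ‖a1 y - a1 x‖ ≤ C * ‖y - x‖ :=
    fun x hx y hy => (convex_Icc 0 Real.pi).norm_image_sub_le_of_norm_hasDerivWithin_le
      (fun z _ => (h2 z).hasDerivWithinAt) hC hx hy
  have hpi : ∀ x, 0 ≤ x → x ≤ Real.pi / 2 → x ≤ 2 * Real.sin x := by
    intro x h0 h1
    have h3 := Real.mul_le_sin h0 h1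
    have h4 : 2 / Real.pi * x ≥ x / 2 := by
      rw [ge_iff_le, div_mul_eq_mul_div, div_le_div_iff₀ (by norm_num) Real.pi_pos]
      nlinarith [Real.pi_le_four]
    linarith
  rcases le_total θ (Real.pi / 2) with h | h
  · have h3 := hmv 0 ⟨le_rfl, Real.pi_pos.le⟩ θ hθ
    rw [h10, sub_zero, sub_zero, Real.norm_of_nonneg hθ.1] at h3
    nlinarith [hpi θ hθ.1 h]
  · have h3 := hmv Real.pi ⟨Real.pi_pos.le, le_rfl⟩ θ hθ
    rw [h1π, sub_zero, norm_sub_rev, Real.norm_of_nonneg (by linarith [hθ.2])] at h3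
    have h4 := hpi (Real.pi - θ) (by linarith [hθ.2]) (by linarith)
    rw [Real.sin_pi_sub] at h4
    nlinarith

lemma norm_integral_Q_mul_le {h : ℝ → ℂ} {B : ℝ}
    (hB : ∀ θ ∈ Icc 0 Real.pi, ‖h θ‖ ≤ B * Real.sin θ) (l : ℕ) :
    ‖∫ θ in (0 : ℝ)..Real.pi, (Q l 0 (Real.cos θ) : ℂ) * h θ‖ ≤ B * (2 / Real.sqrt (2 * l + 1)) := by
  have hQ := continuous_Q l 0
  have hB0 : 0 ≤ B := by
    have := (norm_nonneg _).trans (hB (Real.pi / 2) ⟨by positivity, by linarith [Real.pi_pos]⟩)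
    simpa using this
  calc ‖∫ θ in (0 : ℝ)..Real.pi, (Q l 0 (Real.cos θ) : ℂ) * h θ‖
      ≤ ∫ θ in (0 : ℝ)..Real.pi, B * (|Q l 0 (Real.cos θ)| * Real.sin θ) := by
        refine intervalIntegral.norm_integral_le_of_norm_le Real.pi_pos.le
          (Filter.Eventually.of_forall fun θ hθ => ?_)
          ((by fun_prop : Continuous _).intervalIntegrable _ _)
        rw [norm_mul, Complex.norm_real, Real.norm_eq_abs]
        have := hB θ ⟨hθ.1.le, hθ.2⟩
        calc _ ≤ |Q l 0 (Real.cos θ)| * (B * Real.sin θ) := by gcongr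
          _ = _ := by ring
    _ ≤ B * (2 / Real.sqrt (2 * l + 1)) := by
        rw [intervalIntegral.integral_const_mul]
        exact mul_le_mul_of_nonneg_left (integral_abs_Q_le l) hB0

variable {a a1 a2 : ℝ → ℂ} {C M : ℝ}

lemma hasDerivAt_Q_cos (l m : ℕ) (θ : ℝ) : HasDerivAt (fun θ : ℝ => (Q l m (Real.cos θ) : ℂ))
    ((Q l (m + 1) (Real.cos θ) * -Real.sin θ : ℝ) : ℂ) θ :=
  ((hasDerivAt_Q l m _).comp θ (Real.hasDerivAt_cos θ)).ofReal_comp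

/-- Self-adjointness of the Legendre operator `(sin θ · a')'`, for which `P_l(cos θ)` has the
eigenvalue `-l(l+1)` relative to the weight `sin θ`. The boundary terms carry a factor `sin θ`. -/
lemma legInt_by_parts (h1 : ∀ θ, HasDerivAt a (a1 θ) θ) (h2 : ∀ θ, HasDerivAt a1 (a2 θ) θ)
    (hc : Continuous a2) (l : ℕ) :
    (l * (l + 1) : ℂ) * ∫ θ in (0 : ℝ)..Real.pi, a θ * (Q l 0 (Real.cos θ) * Real.sin θ : ℝ) =
      -∫ θ in (0 : ℝ)..Real.pi, (Q l 0 (Real.cos θ) : ℂ) *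
        (Real.cos θ * a1 θ + Real.sin θ * a2 θ) := by
  have hQ := continuous_Q l 0
  have ca : Continuous a := continuous_iff_continuousAt.2 fun θ => (h1 θ).continuousAt
  have ca1 : Continuous a1 := continuous_iff_continuousAt.2 fun θ => (h2 θ).continuousAt
  have hs : ∀ θ : ℝ, HasDerivAt (fun θ : ℝ => (Real.sin θ : ℂ)) (Real.cos θ : ℂ) θ := fun θ =>
    (Real.hasDerivAt_sin θ).ofReal_comp
  have hd : ∀ θ : ℝ, HasDerivAt (fun θ : ℝ => (Real.sin θ : ℂ) ^ 2 * Q l 1 (Real.cos θ) * a θ +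
      Q l 0 (Real.cos θ) * Real.sin θ * a1 θ)
      ((l * (l + 1) : ℂ) * (a θ * (Q l 0 (Real.cos θ) * Real.sin θ : ℝ)) +
        (Q l 0 (Real.cos θ) : ℂ) * (Real.cos θ * a1 θ + Real.sin θ * a2 θ)) θ := by
    intro θ
    have hode : ((1 - Real.cos θ ^ 2) * Q l 2 (Real.cos θ) : ℂ) =
        2 * Real.cos θ * Q l 1 (Real.cos θ) - (l + 1) * l * Q l 0 (Real.cos θ) := by
      have := Q_ode l 0 (Real.cos θ)
      norm_num at this
      exact_mod_cast this
    have hsc : (Real.sin θ : ℂ) ^ 2 = 1 - (Real.cos θ : ℂ) ^ 2 := by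
      have := Real.sin_sq θ
      exact_mod_cast this
    refine (((((hs θ).pow 2).mul (hasDerivAt_Q_cos l 1 θ)).mul (h1 θ)).add
      (((hasDerivAt_Q_cos l 0 θ).mul (hs θ)).mul (h2 θ))).congr_deriv ?_
    simp only [Pi.mul_apply, Pi.pow_apply, Complex.ofReal_mul, Complex.ofReal_neg]
    push_cast at *
    linear_combination (-(Complex.sin θ) * a θ) * hode - (Complex.sin θ * a θ * Q l 2 (Real.cos θ)) * hsc
  have hF := intervalIntegral.integral_eq_sub_of_hasDerivAt (a := 0) (b := Real.pi)
    (fun θ _ => hd θ) (Continuous.intervalIntegrable (by fun_prop) _ _)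
  rw [intervalIntegral.integral_add (Continuous.intervalIntegrable (by fun_prop) _ _)
    (Continuous.intervalIntegrable (by fun_prop) _ _), intervalIntegral.integral_const_mul] at hF
  simp only [Real.sin_zero, Real.sin_pi, Complex.ofReal_zero] at hF
  rw [eq_neg_iff_add_eq_zero, hF]
  ring

/-- Integration by parts gains `1/(l(l+1))` and the bound for the integral of `|P_l|` gains
`1/√(2l+1)`, against the factor `(2l+1)/2`. The constant `M` serves only the degree `l = 0`, where
no integration by parts is possible. -/
lemma norm_legInt_le (h1 : ∀ θ, HasDerivAt a (a1 θ) θ) (h2 : ∀ θ, HasDerivAt a1 (a2 θ) θ)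
    (hc : Continuous a2) (h10 : a1 0 = 0) (h1π : a1 Real.pi = 0)
    (hC : ∀ θ ∈ Icc 0 Real.pi, ‖a2 θ‖ ≤ C) (hM : ∀ θ ∈ Icc 0 Real.pi, ‖a θ‖ ≤ M) (l : ℕ) :
    ‖legInt l a‖ ≤ (M + 12 * C) * ((l : ℝ) + 1) ^ (-(3 / 2 : ℝ)) := by
  have hC0 : 0 ≤ C := (norm_nonneg _).trans (hC 0 ⟨le_rfl, Real.pi_pos.le⟩)
  have hM0 : 0 ≤ M := (norm_nonneg _).trans (hM 0 ⟨le_rfl, Real.pi_pos.le⟩)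
  have ca1 : Continuous a1 := continuous_iff_continuousAt.2 fun θ => (h2 θ).continuousAt
  rcases Nat.eq_zero_or_pos l with rfl | hl
  · have hQ : ∀ t, Q 0 0 t = 1 := fun t => by simp [Q, legendre_zero]
    have : ‖∫ θ in (0 : ℝ)..Real.pi, a θ * (Q 0 0 (Real.cos θ) * Real.sin θ : ℝ)‖ ≤
        ∫ θ in (0 : ℝ)..Real.pi, M * Real.sin θ := by
      refine intervalIntegral.norm_integral_le_of_norm_le Real.pi_pos.le
        (Filter.Eventually.of_forall fun θ hθ => ?_)
        (Continuous.intervalIntegrable (by fun_prop) _ _)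
      rw [hQ, one_mul, norm_mul, Complex.norm_real, Real.norm_of_nonneg
        (Real.sin_nonneg_of_nonneg_of_le_pi hθ.1.le hθ.2)]
      exact mul_le_mul_of_nonneg_right (hM θ ⟨hθ.1.le, hθ.2⟩)
        (Real.sin_nonneg_of_nonneg_of_le_pi hθ.1.le hθ.2)
    rw [intervalIntegral.integral_const_mul, integral_sin, Real.cos_zero, Real.cos_pi] at this
    rw [legInt, norm_mul]
    norm_num at this ⊢
    linarith
  · have hs := norm_le_sin_mul h2 h10 h1π hC
    have hb := norm_integral_Q_mul_le (h := fun θ => Real.cos θ * a1 θ + Real.sin θ * a2 θ)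
      (B := 3 * C) (fun θ hθ => ?_) l
    · have hbp := congrArg norm (legInt_by_parts h1 h2 hc l)
      rw [norm_neg, norm_mul] at hbp
      rw [← hbp] at hb
      have hl1 : (1 : ℝ) ≤ l := by exact_mod_cast hl
      have hl0 : (0 : ℝ) < l := by linarith
      have hn : ‖(l * (l + 1) : ℂ)‖ = l * (l + 1) := by
        rw [show (l * (l + 1) : ℂ) = ((l * (l + 1) : ℝ) : ℂ) by push_cast; rfl, Complex.norm_real,
          Real.norm_of_nonneg (by positivity)]
      have hn2 : ‖((2 * l + 1) / 2 : ℂ)‖ = (2 * l + 1) / 2 := by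
        rw [show ((2 * l + 1) / 2 : ℂ) = (((2 * l + 1) / 2 : ℝ) : ℂ) by push_cast; rfl,
          Complex.norm_real, Real.norm_of_nonneg (by positivity)]
      rw [hn] at hb
      set I := ‖∫ θ in (0 : ℝ)..Real.pi, a θ * (Q l 0 (Real.cos θ) * Real.sin θ : ℝ)‖ with hI
      have h0 : (0 : ℝ) < 2 * l + 1 := by positivity
      set ε := Real.sqrt (2 * l + 1) with hε
      have hε0 : 0 < ε := Real.sqrt_pos.2 h0
      have hε2 : ε ^ 2 = 2 * l + 1 := Real.sq_sqrt h0.le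
      set r := ((l : ℝ) + 1) ^ (-(3 / 2 : ℝ)) with hr
      have hr0 : 0 < r := by positivity
      have hr2 : r ^ 2 * (l + 1) ^ 3 = 1 := by
        rw [hr, ← Real.rpow_natCast, ← Real.rpow_mul (by positivity),
          ← Real.rpow_natCast ((l : ℝ) + 1) 3, ← Real.rpow_add (by positivity)]
        norm_num
      -- After squaring and multiplying by `l + 1` this is `(2l+1)(l+1) ≤ 16 l²`, true for `l ≥ 1`.
      have key : ε ≤ 4 * (l * (l + 1)) * r := by
        refine le_of_sq_le_sq ?_ (by positivity)
        have e : (4 * (l * (l + 1)) * r) ^ 2 * (l + 1) = 16 * l ^ 2 * (r ^ 2 * (l + 1 : ℝ) ^ 3) := by ring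
        have e2 : ε ^ 2 * (l + 1) ≤ (4 * (l * (l + 1)) * r) ^ 2 * (l + 1) := by
          rw [e, hr2, hε2]
          nlinarith
        exact le_of_mul_le_mul_right e2 (by positivity)
      rw [legInt, norm_mul, hn2, ← hε2]
      have h5 : ε * (l * (l + 1) * I) ≤ 6 * C := by
        calc ε * (l * (l + 1) * I) ≤ ε * (3 * C * (2 / ε)) := by gcongr
          _ = 6 * C := by field_simp; ring
      have h6 : ε ^ 2 / 2 * I ≤ 12 * C * r := by
        calc ε ^ 2 / 2 * I = ε * (ε * I / 2) := by ring
          _ ≤ (4 * (l * (l + 1)) * r) * (ε * I / 2) := by gcongr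
          _ = (ε * (l * (l + 1) * I)) * (2 * r) := by ring
          _ ≤ 6 * C * (2 * r) := by gcongr
          _ = 12 * C * r := by ring
      nlinarith [mul_nonneg hM0 hr0.le]
    · have hsin := Real.sin_nonneg_of_nonneg_of_le_pi hθ.1 hθ.2
      calc ‖(Real.cos θ : ℂ) * a1 θ + Real.sin θ * a2 θ‖
          ≤ ‖(Real.cos θ : ℂ) * a1 θ‖ + ‖(Real.sin θ : ℂ) * a2 θ‖ := norm_add_le _ _
        _ ≤ 1 * (2 * C * Real.sin θ) + Real.sin θ * C := by
            rw [norm_mul, norm_mul, Complex.norm_real, Complex.norm_real, Real.norm_eq_abs,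
              Real.norm_of_nonneg hsin]
            have h3 := hs θ hθ
            have h4 := hC θ hθ
            have h5 := Real.abs_cos_le_one θ
            gcongr
        _ = 3 * C * Real.sin θ := by ring

lemma summable_rate : Summable fun l : ℕ => ((l : ℝ) + 1) ^ (-(3 / 2 : ℝ)) := by
  have h := (summable_nat_add_iff 1).2 (Real.summable_nat_rpow.2 (by norm_num : -(3 / 2 : ℝ) < -1))
  simpa using h

/-- The recurrence for the derivatives makes the sum telescope. -/
lemma sum_legendre (n : ℕ) (t : ℝ) :
    ∑ l ∈ Finset.range (n + 1), (2 * (l : ℝ) + 1) * Q l 0 t = Q (n + 1) 1 t + Q n 1 t := by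
  induction n with
  | zero => simp [Q, legendre_zero, legendre_one]
  | succ n ih =>
    have h := congrArg (Polynomial.eval t) (derivative_legendre_add_two n)
    simp only [Polynomial.eval_add, Polynomial.eval_mul, Polynomial.eval_C] at h
    have h : Q (n + 2) 1 t = (2 * n + 3) * Q (n + 1) 0 t + Q n 1 t := h
    rw [Finset.sum_range_succ, ih, h]
    push_cast
    ring

/-- By `sum_legendre` the partial sum is the integral of `a` against an exact derivative. Since
`P_{n+1} + P_n` is 2 at `1` and 0 at `-1`, integration by parts leaves `a 0` and an error term. -/
lemma sum_legInt (h1 : ∀ θ, HasDerivAt a (a1 θ) θ) (hc : Continuous a1) (n : ℕ) :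
    ∑ l ∈ Finset.range (n + 1), legInt l a = a 0 +
      ((∫ θ in (0 : ℝ)..Real.pi, (Q (n + 1) 0 (Real.cos θ) : ℂ) * a1 θ) +
        ∫ θ in (0 : ℝ)..Real.pi, (Q n 0 (Real.cos θ) : ℂ) * a1 θ) / 2 := by
  have hQ := continuous_Q
  have ca : Continuous a := continuous_iff_continuousAt.2 fun θ => (h1 θ).continuousAt
  have hd : ∀ θ : ℝ, HasDerivAt (fun θ : ℝ => ((Q (n + 1) 0 (Real.cos θ) : ℂ) + Q n 0 (Real.cos θ)) * a θ)
      (-(a θ * (((Q (n + 1) 1 (Real.cos θ) + Q n 1 (Real.cos θ)) * Real.sin θ : ℝ) : ℂ)) +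
        (Q (n + 1) 0 (Real.cos θ) * a1 θ + Q n 0 (Real.cos θ) * a1 θ)) θ := by
    intro θ
    refine (((hasDerivAt_Q_cos (n + 1) 0 θ).add (hasDerivAt_Q_cos n 0 θ)).mul (h1 θ)).congr_deriv ?_
    simp only [Pi.add_apply]
    push_cast
    ring
  have c1 : Continuous fun θ : ℝ =>
      a θ * (((Q (n + 1) 1 (Real.cos θ) + Q n 1 (Real.cos θ)) * Real.sin θ : ℝ) : ℂ) := by
    have := hQ (n + 1) 1
    have := hQ n 1
    fun_prop
  have c2 : ∀ m, Continuous fun θ : ℝ => (Q m 0 (Real.cos θ) : ℂ) * a1 θ := fun m => by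
    have := hQ m 0
    fun_prop
  have c3 : Continuous fun θ : ℝ =>
      -(a θ * (((Q (n + 1) 1 (Real.cos θ) + Q n 1 (Real.cos θ)) * Real.sin θ : ℝ) : ℂ)) := c1.neg
  have c4 : Continuous fun θ : ℝ => (Q (n + 1) 0 (Real.cos θ) : ℂ) * a1 θ +
      (Q n 0 (Real.cos θ) : ℂ) * a1 θ := (c2 _).add (c2 _)
  have hF := intervalIntegral.integral_eq_sub_of_hasDerivAt (a := 0) (b := Real.pi)
    (fun θ _ => hd θ) ((c3.add c4).intervalIntegrable _ _)
  rw [intervalIntegral.integral_add (c3.intervalIntegrable _ _)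
    (c4.intervalIntegrable _ _), intervalIntegral.integral_neg,
    intervalIntegral.integral_add ((c2 _).intervalIntegrable _ _) ((c2 _).intervalIntegrable _ _),
    Real.cos_pi, Real.cos_zero, Q_neg_one_zero, Q_neg_one_zero, (Q_one_zero _).1, (Q_one_zero _).1] at hF
  have hsum : ∑ l ∈ Finset.range (n + 1), legInt l a = 1 / 2 * ∫ θ in (0 : ℝ)..Real.pi,
      a θ * (((Q (n + 1) 1 (Real.cos θ) + Q n 1 (Real.cos θ)) * Real.sin θ : ℝ) : ℂ) := by
    simp only [legInt, ← intervalIntegral.integral_const_mul]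
    rw [← intervalIntegral.integral_finsetSum]
    · refine intervalIntegral.integral_congr fun θ _ => ?_
      rw [← sum_legendre]
      push_cast
      rw [Finset.sum_mul, Finset.mul_sum, Finset.mul_sum]
      refine Finset.sum_congr rfl fun l _ => ?_
      ring
    · intro l _
      have := hQ l 0
      exact Continuous.intervalIntegrable (by fun_prop) _ _
  rw [hsum]
  push_cast at hF ⊢
  rw [pow_succ] at hF
  linear_combination (-1 / 2 : ℂ) * hF

/-- The decay estimate gives summability, and the error terms in `sum_legInt` are `O(n^(-1/2))`,
which identifies the sum. -/
theorem hasSum_legInt (h1 : ∀ θ, HasDerivAt a (a1 θ) θ) (h2 : ∀ θ, HasDerivAt a1 (a2 θ) θ)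
    (hc : Continuous a2) (h10 : a1 0 = 0) (h1π : a1 Real.pi = 0) :
    HasSum (fun l => legInt l a) (a 0) := by
  have ca : Continuous a := continuous_iff_continuousAt.2 fun θ => (h1 θ).continuousAt
  have ca1 : Continuous a1 := continuous_iff_continuousAt.2 fun θ => (h2 θ).continuousAt
  obtain ⟨C, hC⟩ := isCompact_Icc.exists_bound_of_continuousOn (s := Icc 0 Real.pi) hc.continuousOn
  obtain ⟨M, hM⟩ := isCompact_Icc.exists_bound_of_continuousOn (s := Icc 0 Real.pi) ca.continuousOn
  have hsum : Summable fun l => legInt l a :=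
    Summable.of_norm_bounded (summable_rate.mul_left _)
      (norm_legInt_le h1 h2 hc h10 h1π hC hM)
  have hlim : Filter.Tendsto (fun n : ℕ => ∫ θ in (0 : ℝ)..Real.pi, (Q n 0 (Real.cos θ) : ℂ) * a1 θ)
      Filter.atTop (nhds 0) := by
    refine squeeze_zero_norm (norm_integral_Q_mul_le (norm_le_sin_mul h2 h10 h1π hC)) ?_
    rw [← mul_zero (2 * C)]
    refine tendsto_const_nhds.mul (tendsto_const_nhds.div_atTop ?_)
    refine Real.tendsto_sqrt_atTop.comp ?_
    exact Filter.tendsto_atTop_add_const_right _ _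
      (tendsto_natCast_atTop_atTop.const_mul_atTop (by norm_num))
  have h := (Filter.tendsto_add_atTop_iff_nat 1).2 hsum.hasSum.tendsto_sum_nat
  simp only [sum_legInt h1 ca1] at h
  have h' := (((hlim.comp (Filter.tendsto_add_atTop_nat 1)).add hlim).div_const 2).const_add (a 0)
  rw [add_zero, zero_div, add_zero] at h'
  rw [← tendsto_nhds_unique h h']
  exact hsum.hasSum

end LegendreSeries

/-! ### Expansions in zonal harmonics -/

section ParametricDerivative

variable {E : Type*} [NormedAddCommGroup E] [NormedSpace ℝ E]

lemma hasDerivAt_intervalIntegral {G G1 : ℝ → ℝ → E}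
    (h1 : ∀ θ φ, HasDerivAt (fun t => G t φ) (G1 θ φ) θ) (hG : Continuous fun x : ℝ × ℝ => G x.1 x.2)
    (hG1 : Continuous fun x : ℝ × ℝ => G1 x.1 x.2) (a b θ : ℝ) :
    HasDerivAt (fun t => ∫ φ in a..b, G t φ) (∫ φ in a..b, G1 θ φ) θ := by
  have hs : ∀ t, Continuous (G t) := fun t => hG.comp (by fun_prop : Continuous fun φ : ℝ => (t, φ))
  have hs1 : ∀ t, Continuous (G1 t) := fun t =>
    hG1.comp (by fun_prop : Continuous fun φ : ℝ => (t, φ))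
  obtain ⟨C, hC⟩ := (isCompact_Icc.prod isCompact_uIcc).exists_bound_of_continuousOn
    (s := Icc (θ - 1) (θ + 1) ×ˢ uIcc a b) hG1.continuousOn
  refine (intervalIntegral.hasDerivAt_integral_of_dominated_loc_of_deriv_le (bound := fun _ => C)
    (s := Icc (θ - 1) (θ + 1)) (Icc_mem_nhds (by linarith) (by linarith))
    (Filter.Eventually.of_forall fun t => (hs t).aestronglyMeasurable)
    ((hs θ).intervalIntegrable _ _) (hs1 θ).aestronglyMeasurable
    (Filter.Eventually.of_forall fun φ hφ t ht => hC (t, φ) ⟨ht, uIoc_subset_uIcc hφ⟩)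
    intervalIntegrable_const (Filter.Eventually.of_forall fun φ _ t _ => h1 t φ)).2

end ParametricDerivative

section Zonal

lemma spherePt_neg (θ φ : ℝ) : spherePt (-θ) φ = spherePt θ (φ + Real.pi) := by
  have : Complex.I * ((φ + Real.pi : ℝ) : ℂ) = Complex.I * φ + Real.pi * Complex.I := by
    push_cast
    ring
  rw [spherePt, spherePt, this, Complex.exp_add, Complex.exp_pi_mul_I, Real.sin_neg, Real.cos_neg]
  simp

lemma spherePt_two_pi_sub (θ φ : ℝ) : spherePt (2 * Real.pi - θ) φ = spherePt (-θ) φ := by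
  rw [spherePt, spherePt, Real.sin_two_pi_sub, Real.cos_two_pi_sub, Real.sin_neg, Real.cos_neg]

lemma mean_neg (g : ℂ × ℝ → ℂ) (θ : ℝ) : mean g (-θ) = mean g θ := by
  have hper : Function.Periodic (fun φ : ℝ => g (spherePt θ φ)) (2 * Real.pi) := fun φ => by
    simp only [spherePt_add_two_pi]
  have h1 := hper.intervalIntegral_add_eq 0 Real.pi
  rw [zero_add] at h1
  simp only [mean, spherePt_neg]
  rw [intervalIntegral.integral_comp_add_right (fun φ => g (spherePt θ φ)), h1, zero_add, add_comm]

lemma mean_two_pi_sub (g : ℂ × ℝ → ℂ) (θ : ℝ) : mean g (2 * Real.pi - θ) = mean g θ := by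
  rw [← mean_neg g θ]
  simp only [mean, spherePt_two_pi_sub]

lemma mean_zero (g : ℂ × ℝ → ℂ) : mean g 0 = 2 * Real.pi * g north := by
  have : ∀ φ, spherePt 0 φ = north := fun φ => by simp [spherePt, north]
  simp [mean, this]

lemma integral_mul_zonal {g : ℂ × ℝ → ℂ} (hg : ContinuousOn g sph) (l : ℕ) :
    ∫ p, g p * zonal l p.2 ∂sphMeas = 1 / (2 * Real.pi) * legInt l (mean g) := by
  have hQ := continuous_Q l 0
  rw [integral_mul_snd hg (k := zonal l) (by unfold zonal; fun_prop), legInt,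
    ← intervalIntegral.integral_const_mul, ← intervalIntegral.integral_const_mul]
  refine intervalIntegral.integral_congr fun θ _ => ?_
  have := Real.pi_pos.ne'
  simp only [zonal]
  push_cast
  field_simp
  ring

variable {g : ℂ × ℝ → ℂ} {g1 g2 : ℝ → ℝ → ℂ}

/-- Circular means are even about both poles, because crossing a pole only shifts `φ` by `π`. Hence
the conditions at the endpoints required by `hasSum_legInt` are automatic. -/
lemma mean_deriv_eq_zero {a1 : ℝ → ℂ} (h1 : ∀ θ, HasDerivAt (mean g) (a1 θ) θ) :
    a1 0 = 0 ∧ a1 Real.pi = 0 := by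
  constructor
  · have h : HasDerivAt (fun θ => mean g (-θ)) (-a1 0) 0 := by
      have := (h1 (-0)).scomp (0 : ℝ) (hasDerivAt_neg (0 : ℝ))
      simpa [Function.comp_def] using this
    simp only [mean_neg] at h
    have := h.unique (h1 0)
    linear_combination (-1 / 2 : ℂ) * this
  · have h : HasDerivAt (fun θ => mean g (2 * Real.pi - θ)) (-a1 Real.pi) Real.pi := by
      have h0 := h1 (2 * Real.pi - Real.pi)
      have := h0.scomp Real.pi ((hasDerivAt_id Real.pi).const_sub (2 * Real.pi))
      rw [show 2 * Real.pi - Real.pi = Real.pi by ring] at this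
      simpa [Function.comp_def] using this
    simp only [mean_two_pi_sub] at h
    have := h.unique (h1 Real.pi)
    linear_combination (-1 / 2 : ℂ) * this

lemma norm_intervalIntegral_two_pi_le {h : ℝ → ℂ} {C : ℝ}
    (hC : ∀ φ ∈ Icc 0 (2 * Real.pi), ‖h φ‖ ≤ C) :
    ‖∫ φ in (0 : ℝ)..(2 * Real.pi), h φ‖ ≤ 2 * Real.pi * C := by
  have hpi := Real.two_pi_pos
  have := intervalIntegral.norm_integral_le_of_norm_le_const (a := 0) (b := 2 * Real.pi) (f := h)
    (C := C) fun φ hφ => hC φ (by rw [uIoc_of_le hpi.le] at hφ; exact Ioc_subset_Icc_self hφ)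
  rw [sub_zero, abs_of_pos hpi] at this
  linarith

lemma continuous_comp_spherePt' {g : ℂ × ℝ → ℂ} (hg : ContinuousOn g sph) :
    Continuous fun x : ℝ × ℝ => g (spherePt x.1 x.2) :=
  hg.comp_continuous (f := fun x : ℝ × ℝ => spherePt x.1 x.2) (by unfold spherePt; fun_prop)
    fun x => en_spherePt _ _

theorem norm_integral_mul_zonal_le (hg : ContinuousOn g sph)
    (h1 : ∀ θ φ, HasDerivAt (fun t => g (spherePt t φ)) (g1 θ φ) θ)
    (h2 : ∀ θ φ, HasDerivAt (fun t => g1 t φ) (g2 θ φ) θ)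
    (hc1 : Continuous fun x : ℝ × ℝ => g1 x.1 x.2) (hc2 : Continuous fun x : ℝ × ℝ => g2 x.1 x.2)
    {M C : ℝ} (hM : ∀ p ∈ sph, ‖g p‖ ≤ M)
    (hC : ∀ θ ∈ Icc 0 Real.pi, ∀ φ ∈ Icc 0 (2 * Real.pi), ‖g2 θ φ‖ ≤ C) (l : ℕ) :
    ‖∫ p, g p * zonal l p.2 ∂sphMeas‖ ≤ (M + 12 * C) * ((l : ℝ) + 1) ^ (-(3 / 2 : ℝ)) := by
  have hpi := Real.two_pi_pos
  have d1 : ∀ θ, HasDerivAt (mean g) (∫ φ in (0 : ℝ)..(2 * Real.pi), g1 θ φ) θ :=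
    hasDerivAt_intervalIntegral h1 (continuous_comp_spherePt' hg) hc1 0 (2 * Real.pi)
  have d2 := hasDerivAt_intervalIntegral h2 hc1 hc2 0 (2 * Real.pi)
  obtain ⟨h10, h1π⟩ := mean_deriv_eq_zero d1
  have hc : Continuous fun θ => ∫ φ in (0 : ℝ)..(2 * Real.pi), g2 θ φ :=
    intervalIntegral.continuous_parametric_intervalIntegral_of_continuous' hc2 _ _
  have := norm_legInt_le d1 d2 hc h10 h1π (C := 2 * Real.pi * C) (M := 2 * Real.pi * M)
    (fun θ hθ => norm_intervalIntegral_two_pi_le (hC θ hθ))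
    (fun θ _ => norm_intervalIntegral_two_pi_le fun φ _ => hM _ (en_spherePt θ φ)) l
  rw [integral_mul_zonal hg, norm_mul]
  have e : ‖(1 / (2 * Real.pi) : ℂ)‖ = 1 / (2 * Real.pi) := by
    rw [norm_div, norm_mul, Complex.norm_real, Real.norm_of_nonneg Real.pi_pos.le]
    simp
  rw [e]
  calc _ ≤ 1 / (2 * Real.pi) * ((2 * Real.pi * M + 12 * (2 * Real.pi * C)) *
        ((l : ℝ) + 1) ^ (-(3 / 2 : ℝ))) := by gcongr
    _ = _ := by field_simp

theorem hasSum_integral_mul_zonal (hg : ContinuousOn g sph)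
    (h1 : ∀ θ φ, HasDerivAt (fun t => g (spherePt t φ)) (g1 θ φ) θ)
    (h2 : ∀ θ φ, HasDerivAt (fun t => g1 t φ) (g2 θ φ) θ)
    (hc1 : Continuous fun x : ℝ × ℝ => g1 x.1 x.2) (hc2 : Continuous fun x : ℝ × ℝ => g2 x.1 x.2) :
    HasSum (fun l => ∫ p, g p * zonal l p.2 ∂sphMeas) (g north) := by
  have d1 : ∀ θ, HasDerivAt (mean g) (∫ φ in (0 : ℝ)..(2 * Real.pi), g1 θ φ) θ :=
    hasDerivAt_intervalIntegral h1 (continuous_comp_spherePt' hg) hc1 0 (2 * Real.pi)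
  have d2 := hasDerivAt_intervalIntegral h2 hc1 hc2 0 (2 * Real.pi)
  obtain ⟨h10, h1π⟩ := mean_deriv_eq_zero d1
  have hc : Continuous fun θ => ∫ φ in (0 : ℝ)..(2 * Real.pi), g2 θ φ :=
    intervalIntegral.continuous_parametric_intervalIntegral_of_continuous' hc2 _ _
  have h := (hasSum_legInt d1 d2 hc h10 h1π).mul_left (1 / (2 * Real.pi) : ℂ)
  have e : (1 / (2 * Real.pi) : ℂ) * mean g 0 = g north := by
    have := Real.pi_pos.ne'
    rw [mean_zero]
    field_simp
  rw [e] at h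
  simpa only [integral_mul_zonal hg] using h

end Zonal

/-! ### Rotation invariance and the reproducing property of the zonal kernel. -/

section Rotation

lemma continuous_zonal (l : ℕ) : Continuous (zonal l) := by
  have := continuous_Q l 0
  unfold zonal
  fun_prop

lemma continuous_ed {X : Type*} [TopologicalSpace X] {a b : X → ℂ × ℝ} (ha : Continuous a)
    (hb : Continuous b) : Continuous fun x => ed (a x) (b x) := by
  simp only [ed_eq]
  have := continuous_en
  fun_prop

lemma IsOrth.mapsTo_sph {R : ℂ × ℝ →L[ℝ] ℂ × ℝ} (hR : IsOrth R) : MapsTo R sph sph :=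
  fun p hp => (hR p).trans hp

lemma integral_comp_isOrth {E : Type*} [NormedAddCommGroup E] [NormedSpace ℝ E]
    {R : ℂ × ℝ →L[ℝ] ℂ × ℝ} (hR : IsOrth R) (g : ℂ × ℝ → E) :
    ∫ p, g (R p) ∂sphMeas = ∫ p, g p ∂sphMeas :=
  (measurePreserving_sphMeas hR).integral_comp
    (hR.equiv.toHomeomorph.measurableEmbedding) g

lemma ed_north (p : ℂ × ℝ) : ed north p = p.2 := by simp [ed, north]

lemma integral_mul_zonal_ed (g : ℂ × ℝ → ℂ) (l : ℕ) {R : ℂ × ℝ →L[ℝ] ℂ × ℝ} (hR : IsOrth R) :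
    ∫ p, g p * zonal l (ed (R north) p) ∂sphMeas = ∫ p, g (R p) * zonal l p.2 ∂sphMeas := by
  rw [← integral_comp_isOrth hR]
  simp only [hR.ed, ed_north]

lemma sphMeas_swap_integrable {E : Type*} [NormedAddCommGroup E] [NormedSpace ℝ E]
    {G : (ℂ × ℝ) × (ℂ × ℝ) → E} (hG : ContinuousOn G (sph ×ˢ sph)) :
    Integrable G (sphMeas.prod sphMeas) := by
  have h := hG.integrableOn_compact (μ := sphMeas.prod sphMeas) (isCompact_sph.prod isCompact_sph)
  rwa [IntegrableOn, ← Measure.prod_restrict, Measure.restrict_eq_self_of_ae_mem ae_mem_sph] at h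

lemma ed_comm (p q : ℂ × ℝ) : ed p q = ed q p := by
  simp only [ed_eq, add_comm p q]
  ring

lemma north_mem_sph : north ∈ sph := by simp [sph, en, north]

lemma integral_exp_neg_succ (m : ℕ) :
    ∫ φ in (0 : ℝ)..(2 * Real.pi), Complex.exp (-Complex.I * (m + 1) * φ) = 0 := by
  have hm : (m + 1 : ℂ) ≠ 0 := Nat.cast_add_one_ne_zero m
  rw [integral_exp_mul_complex (by simp [hm])]
  have : -Complex.I * (m + 1) * ((2 * Real.pi : ℝ) : ℂ) =
      ((-(m + 1 : ℤ) : ℤ) : ℂ) * (2 * Real.pi * Complex.I) := by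
    push_cast
    ring
  rw [this, Complex.exp_int_mul_two_pi_mul_I]
  simp

lemma integral_A_spherePt (l m : ℕ) (θ : ℝ) :
    ∫ φ in (0 : ℝ)..(2 * Real.pi), A l (conj (spherePt θ φ).1) (spherePt θ φ).2 (m + 1) = 0 := by
  have : ∀ φ : ℝ, A l (conj (spherePt θ φ).1) (spherePt θ φ).2 (m + 1) =
      (Real.sin θ : ℂ) ^ (m + 1) * (Q l (m + 1) (Real.cos θ) : ℝ) *
        Complex.exp (-Complex.I * (m + 1) * φ) := fun φ => by
    have he : Complex.exp (-Complex.I * (m + 1) * φ) = Complex.exp (-Complex.I * φ) ^ (m + 1) := by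
      rw [← Complex.exp_nat_mul]
      congr 1
      push_cast
      ring
    rw [he]
    simp only [A, spherePt, map_mul, Complex.conj_ofReal, ← Complex.exp_conj, Complex.conj_I, mul_pow]
    ring
  simp only [this]
  rw [intervalIntegral.integral_const_mul, integral_exp_neg_succ, mul_zero]

lemma continuous_A (l m : ℕ) : Continuous fun p : ℂ × ℝ => A l p.1 p.2 m := by
  have := continuous_Q l m
  unfold A
  fun_prop

/-- Averaging over a circle of latitude kills all summands with `m ≠ 0`. -/
lemma integral_kern_spherePt (l : ℕ) (q : ℂ × ℝ) (θ : ℝ) :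
    ∫ φ in (0 : ℝ)..(2 * Real.pi), kern l q (spherePt θ φ) =
      2 * Real.pi * (zonal l q.2 * Q l 0 (Real.cos θ) : ℝ) := by
  have hA : ∀ m, Continuous fun φ : ℝ => A l (conj (spherePt θ φ).1) (spherePt θ φ).2 m := fun m => by
    have h1 : Continuous fun φ : ℝ => ((conj (spherePt θ φ).1, (spherePt θ φ).2) : ℂ × ℝ) := by
      unfold spherePt
      fun_prop
    exact (continuous_A l m).comp h1
  have hB : ∀ m, Continuous fun φ : ℝ => nrm l (m + 1) *
      (A l q.1 q.2 (m + 1) * A l (conj (spherePt θ φ).1) (spherePt θ φ).2 (m + 1) +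
      conj (A l q.1 q.2 (m + 1) * A l (conj (spherePt θ φ).1) (spherePt θ φ).2 (m + 1))) := fun m => by
    have := hA (m + 1)
    fun_prop
  have hz : ∀ m, ∫ φ in (0 : ℝ)..(2 * Real.pi), (nrm l (m + 1) : ℂ) *
      (A l q.1 q.2 (m + 1) * A l (conj (spherePt θ φ).1) (spherePt θ φ).2 (m + 1) +
      conj (A l q.1 q.2 (m + 1) * A l (conj (spherePt θ φ).1) (spherePt θ φ).2 (m + 1))) = 0 := fun m => by
    have h1 : Continuous fun φ : ℝ =>
        A l q.1 q.2 (m + 1) * A l (conj (spherePt θ φ).1) (spherePt θ φ).2 (m + 1) :=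
      continuous_const.mul (hA _)
    have h2 : ∫ φ in (0 : ℝ)..(2 * Real.pi),
        A l q.1 q.2 (m + 1) * A l (conj (spherePt θ φ).1) (spherePt θ φ).2 (m + 1) = 0 := by
      rw [intervalIntegral.integral_const_mul, integral_A_spherePt, mul_zero]
    have h3 : ∫ φ in (0 : ℝ)..(2 * Real.pi), conj
        (A l q.1 q.2 (m + 1) * A l (conj (spherePt θ φ).1) (spherePt θ φ).2 (m + 1)) = 0 := by
      rw [intervalIntegral.integral_of_le Real.two_pi_pos.le] at h2 ⊢
      rw [integral_conj, h2, map_zero]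
    have h4 : Continuous fun φ : ℝ => conj
        (A l q.1 q.2 (m + 1) * A l (conj (spherePt θ φ).1) (spherePt θ φ).2 (m + 1)) :=
      Complex.continuous_conj.comp h1
    rw [intervalIntegral.integral_const_mul, intervalIntegral.integral_add
      (h1.intervalIntegrable _ _) (h4.intervalIntegrable _ _), h2,
      h3, add_zero, mul_zero]
  have h0 : ∀ φ : ℝ, A l (conj (spherePt θ φ).1) (spherePt θ φ).2 0 = (Q l 0 (Real.cos θ) : ℝ) :=
    fun φ => by simp [A, spherePt]
  simp only [kern]
  rw [intervalIntegral.integral_add, intervalIntegral.integral_finsetSum,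
    Finset.sum_eq_zero fun m _ => hz m]
  · simp only [h0]
    have := Nat.cast_ne_zero (R := ℂ).2 l.factorial_ne_zero
    simp [zonal, nrm, A]
    field_simp
  · exact fun m _ => (hB m).intervalIntegrable _ _
  · have := hA 0
    exact Continuous.intervalIntegrable (by fun_prop) _ _
  · exact Continuous.intervalIntegrable (continuous_finsetSum _ fun m _ => hB m) _ _

/-- After a rotation `p` is the north pole. The other factor may then be averaged over circles of
latitude, where it becomes a multiple of `P_l(cos θ)`, and the norm of `P_l` supplies the constant.
-/
theorem integral_zonal_mul_zonal (l : ℕ) {q p : ℂ × ℝ} (hq : q ∈ sph) (hp : p ∈ sph) :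
    ∫ x, (zonal l (ed q x) : ℂ) * zonal l (ed p x) ∂sphMeas = zonal l (ed q p) := by
  have hzc := continuous_zonal l
  obtain ⟨α, -, β, -, rfl⟩ := exists_spherePt hp
  have hR := isOrth_frame α β
  set R := frame α β with hRd
  rw [← frame_north α β, ← hRd, integral_mul_zonal_ed (fun x => (zonal l (ed q x) : ℂ)) l hR]
  set q' := R.inverse q with hq'
  have hqR : q = R q' := (hR.apply_inverse q).symm
  have hq1 : en q' = 1 := (hR.inverse q).trans hq
  have e1 : ∀ x, ed q (R x) = ed q' x := fun x => by rw [hqR, hR.ed]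
  have hcont : Continuous fun x : ℂ × ℝ => (zonal l (ed q' x) : ℂ) :=
    Complex.continuous_ofReal.comp (hzc.comp (continuous_ed continuous_const continuous_id))
  have hmean : mean (fun x => (zonal l (ed q' x) : ℂ)) =
      fun θ : ℝ => (2 * Real.pi * (zonal l q'.2 * Q l 0 (Real.cos θ) : ℝ) : ℂ) := by
    funext θ
    rw [← integral_kern_spherePt, mean]
    refine intervalIntegral.integral_congr fun φ _ => ?_
    exact (kern_eq_zonal l hq1 (en_spherePt θ φ)).symm
  simp only [e1]
  rw [integral_mul_zonal hcont.continuousOn, hmean, legInt, ed_comm, ed_north]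
  have e2 : ∀ θ : ℝ, (2 * Real.pi * (zonal l q'.2 * Q l 0 (Real.cos θ) : ℝ) : ℂ) *
      (Q l 0 (Real.cos θ) * Real.sin θ : ℝ) =
      (2 * Real.pi * zonal l q'.2 : ℂ) * ((Q l 0 (Real.cos θ) ^ 2 * Real.sin θ : ℝ) : ℂ) :=
    fun θ => by
      push_cast
      ring
  simp only [e2]
  rw [intervalIntegral.integral_const_mul, intervalIntegral.integral_ofReal, integral_Q_sq]
  have h1 := Real.pi_pos.ne'
  have h2 : (2 * l + 1 : ℂ) ≠ 0 := by
    have : ((2 * l + 1 : ℕ) : ℂ) ≠ 0 := Nat.cast_ne_zero.2 (by omega)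
    simpa using this
  push_cast
  field_simp

end Rotation

/-! ### Wigner coefficients and the zonal kernel. -/

section Wigner

lemma continuous_sphHarm (l : ℕ) (m : ℤ) : Continuous (sphHarm l m) := by
  unfold sphHarm
  refine Continuous.mul (Continuous.mul continuous_const (Continuous.pow ?_ _)) ?_
  · split_ifs
    · fun_prop
    · fun_prop
  · exact Complex.continuous_ofReal.comp ((Polynomial.continuous _).comp continuous_snd)

lemma conj_wigner_inverse (l : ℕ) (k m : ℤ) {R : ℂ × ℝ →L[ℝ] ℂ × ℝ} (hR : IsOrth R) :
    conj (wigner l k m R.inverse) =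
      ∫ p, conj (sphHarm l m (R p)) * sphHarm l k p ∂sphMeas := by
  have h1 := continuous_sphHarm l m
  have h2 := continuous_sphHarm l k
  rw [wigner, hR.inverse_inverse, sphereInt_eq (Continuous.continuousOn (by fun_prop)),
    ← integral_conj]
  simp only [map_mul, Complex.conj_conj]

lemma sum_integral_mul_sphHarm (l : ℕ) {g : ℂ × ℝ → ℂ} (hg : ContinuousOn g sph) {q : ℂ × ℝ}
    (hq : q ∈ sph) :
    ∑ k ∈ Finset.Icc (-(l : ℤ)) l, sphHarm l k q * sphereInt (fun p => g p * conj (sphHarm l k p)) =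
      ∫ p, g p * zonal l (ed q p) ∂sphMeas := by
  have hc : ∀ k, ContinuousOn (fun p => g p * conj (sphHarm l k p)) sph := fun k => by
    have := continuous_sphHarm l k
    exact hg.mul (by fun_prop)
  simp only [sphereInt_eq (hc _), ← integral_const_mul]
  rw [← integral_finsetSum _ fun k _ => (integrable_sphMeas (hc k)).const_mul _]
  refine integral_congr_ae ?_
  filter_upwards [ae_mem_sph] with p hp
  rw [← addition_theorem l hq hp, Finset.mul_sum]
  refine Finset.sum_congr rfl fun k _ => ?_
  ring

/-- Written as integrals, the sums over `m` and `k` are two instances of the addition theorem, which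
yield the zonal kernels at `(q, R x)` and `(x, p)`. Integrating over `x` merges them by the
reproducing property, so it is not needed that rotations preserve the harmonics of degree `l`. -/
theorem sum_sphHarm_mul_wigner (l : ℕ) {g : ℂ × ℝ → ℂ} (hg : ContinuousOn g sph)
    {R : ℂ × ℝ →L[ℝ] ℂ × ℝ} (hR : IsOrth R) {q : ℂ × ℝ} (hq : q ∈ sph) :
    ∑ m ∈ Finset.Icc (-(l : ℤ)) l, ∑ k ∈ Finset.Icc (-(l : ℤ)) l,
      sphHarm l m q * (sphereInt (fun p => g p * conj (sphHarm l k p)) *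
        conj (wigner l k m R.inverse)) =
      ∫ p, g p * zonal l (ed (R.inverse q) p) ∂sphMeas := by
  have hz := continuous_zonal l
  set a : ℤ → ℂ := fun k => sphereInt (fun p => g p * conj (sphHarm l k p)) with ha
  have hq' : R.inverse q ∈ sph := hR.inverse.mapsTo_sph hq
  have h1 : ∀ m k, sphHarm l m q * (a k * conj (wigner l k m R.inverse)) =
      ∫ p, (sphHarm l m q * conj (sphHarm l m (R p))) * (sphHarm l k p * a k) ∂sphMeas := by
    intro m k
    rw [conj_wigner_inverse l k m hR, ← integral_const_mul, ← integral_const_mul]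
    refine integral_congr_ae (Filter.Eventually.of_forall fun p => ?_)
    simp only
    ring
  have hcont : ∀ m k, Continuous fun p =>
      (sphHarm l m q * conj (sphHarm l m (R p))) * (sphHarm l k p * a k) := fun m k => by
    have h1 := continuous_sphHarm l m
    have h2 := continuous_sphHarm l k
    fun_prop
  have h2 : ∑ m ∈ Finset.Icc (-(l : ℤ)) l, ∑ k ∈ Finset.Icc (-(l : ℤ)) l,
      sphHarm l m q * (a k * conj (wigner l k m R.inverse)) =
      ∫ x, ∫ p, (zonal l (ed (R.inverse q) x) : ℂ) * (g p * zonal l (ed x p)) ∂sphMeas ∂sphMeas := by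
    simp only [h1]
    rw [Finset.sum_congr rfl fun m _ => (integral_finsetSum _ fun k _ =>
      integrable_sphMeas (hcont m k).continuousOn).symm, ← integral_finsetSum]
    · refine integral_congr_ae ?_
      filter_upwards [ae_mem_sph] with x hx
      rw [← Finset.sum_mul_sum, addition_theorem l hq (hR.mapsTo_sph hx), ha,
        sum_integral_mul_sphHarm l hg hx, integral_const_mul]
      rw [← hR.ed (R.inverse q), hR.apply_inverse]
    · exact fun m _ => integrable_finsetSum _ fun k _ => integrable_sphMeas (hcont m k).continuousOn
  rw [h2, integral_integral_swap]
  · refine integral_congr_ae ?_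
    filter_upwards [ae_mem_sph] with p hp
    rw [← integral_zonal_mul_zonal l hq' hp, ← integral_const_mul]
    refine integral_congr_ae (Filter.Eventually.of_forall fun x => ?_)
    simp only [ed_comm x p]
    ring
  · refine sphMeas_swap_integrable ?_
    refine ContinuousOn.mul (Continuous.continuousOn ?_) (ContinuousOn.mul ?_
      (Continuous.continuousOn ?_))
    · exact Complex.continuous_ofReal.comp (hz.comp (continuous_ed continuous_const continuous_fst))
    · exact hg.comp continuousOn_snd fun x hx => hx.2
    · exact Complex.continuous_ofReal.comp (hz.comp (continuous_ed continuous_fst continuous_snd))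

lemma exists_norm_wigner_le (l : ℕ) (k m : ℤ) :
    ∃ C, ∀ R : ℂ × ℝ →L[ℝ] ℂ × ℝ, IsOrth R → ‖conj (wigner l k m R.inverse)‖ ≤ C := by
  have h1 := continuous_sphHarm l m
  have h2 := continuous_sphHarm l k
  obtain ⟨C, hC⟩ := isCompact_sph.exists_bound_of_continuousOn h1.continuousOn
  obtain ⟨C', hC'⟩ := isCompact_sph.exists_bound_of_continuousOn h2.continuousOn
  refine ⟨C * C' * sphMeas.real univ, fun R hR => ?_⟩
  rw [conj_wigner_inverse l k m hR]
  refine norm_integral_le_of_norm_le_const ?_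
  filter_upwards [ae_mem_sph] with p hp
  rw [norm_mul, RCLike.norm_conj]
  have := hC _ (hR.mapsTo_sph hp)
  exact mul_le_mul this (hC' _ hp) (norm_nonneg _) ((norm_nonneg _).trans this)

end Wigner

/-! ### Test functions on the unit tangent bundle -/

section TestFunction

variable {D : ℕ} {f : T1M D → ℂ}

lemma mem_T1H3 {P v : ℂ × ℝ} : (P, v) ∈ T1H3 ↔ P ∈ H3 ∧ en v = P.2 ^ 2 := Iff.rfl

lemma mem_T1H3_smul {P p : ℂ × ℝ} (hP : P ∈ H3) (hp : p ∈ sph) : (P, P.2 • p) ∈ T1H3 := by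
  have hp : en p = 1 := hp
  rw [mem_T1H3, en_smul, hp, mul_one]
  exact ⟨hP, rfl⟩

lemma dAct_mem_T1H3 (σ : SL(2, ℂ)) {P v : ℂ × ℝ} (h : (P, v) ∈ T1H3) :
    (act σ P, dAct σ P v) ∈ T1H3 := by
  obtain ⟨hP, hv⟩ := mem_T1H3.1 h
  have h2 : P.2 ≠ 0 := ne_of_gt hP
  refine mem_T1H3.2 ⟨act_mem σ hP, ?_⟩
  rw [dAct_apply σ hP, en_smul, isOrth_rot σ hP, hv]
  field_simp

lemma lift_act {γ : SL(2, ℂ)} (hγ : γ ∈ Gam D) {P v : ℂ × ℝ} (h : (P, v) ∈ T1H3) :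
    lift f (act γ P, dAct γ P v) = lift f (P, v) := by
  have h' := dAct_mem_T1H3 γ h
  rw [lift, lift, dif_pos h, dif_pos h']
  exact congrArg f (Quot.sound ⟨γ, hγ, rfl⟩).symm

/-- The restriction to the fibre at `P` of the lift of `f`, as a function on the unit sphere. -/
def fib (f : T1M D → ℂ) (P p : ℂ × ℝ) : ℂ := lift f (P, P.2 • p)

lemma fib_act {γ : SL(2, ℂ)} (hγ : γ ∈ Gam D) {P p : ℂ × ℝ} (hP : P ∈ H3) (hp : p ∈ sph) :
    fib f (act γ P) (rot γ P p) = fib f P p := by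
  have h2 : P.2 ≠ 0 := ne_of_gt hP
  rw [fib, fib, ← lift_act hγ (mem_T1H3_smul hP hp), dAct_apply γ hP, map_smul, smul_smul,
    div_mul_cancel₀ _ h2]

/-- The points of `ℍ³` whose orbit meets `K`. -/
def orbitSet (D : ℕ) (K : Set (ℂ × ℝ)) : Set (ℂ × ℝ) := {P | P ∈ H3 ∧ ∃ γ ∈ Gam D, act γ P ∈ K}

lemma act_mem_orbitSet {K : Set (ℂ × ℝ)} {γ : SL(2, ℂ)} (hγ : γ ∈ Gam D) {P : ℂ × ℝ} (hP : P ∈ H3) :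
    act γ P ∈ orbitSet D K ↔ P ∈ orbitSet D K := by
  constructor
  · rintro ⟨-, δ, hδ, h⟩
    exact ⟨hP, δ * γ, mul_mem hδ hγ, by rwa [act_mul _ _ hP]⟩
  · rintro ⟨-, δ, hδ, h⟩
    refine ⟨act_mem γ hP, δ * γ⁻¹, mul_mem hδ (inv_mem hγ), ?_⟩
    rwa [act_mul _ _ (act_mem γ hP), act_inv_act γ hP]

lemma measurableSet_orbitSet {K : Set (ℂ × ℝ)} (hK : MeasurableSet K) :
    MeasurableSet (orbitSet D K) := by
  have : orbitSet D K = H3 ∩ ⋃ γ ∈ (Gam D : Set SL(2, ℂ)), act γ ⁻¹' K := by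
    ext P
    simp [orbitSet]
  rw [this]
  exact measurableSet_H3.inter (MeasurableSet.biUnion (countable_coe_iff.1 (countable_Gam (D := D))) fun γ _ => measurable_act γ hK)

lemma isOpen_exists_act {U : Set (ℂ × ℝ)} (hU : IsOpen U) :
    IsOpen {x : T1H3 | ∃ γ ∈ Gam D, act γ x.1.1 ∈ U} := by
  have : {x : T1H3 | ∃ γ ∈ Gam D, act γ x.1.1 ∈ U} =
      ⋃ γ ∈ Gam D, (fun x : T1H3 => act γ x.1.1) ⁻¹' U := by
    ext x
    simp
  rw [this]
  refine isOpen_biUnion fun γ _ => hU.preimage ?_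
  exact (contDiffOn_act γ).continuousOn.comp_continuous (by fun_prop) fun x => x.2.1

/-- The set of classes of pairs `(P, v)` such that the orbit of `P` meets `U`. -/
def quotSet (D : ℕ) (U : Set (ℂ × ℝ)) : Set (T1M D) :=
  Quot.lift (fun x : T1H3 => ∃ γ ∈ Gam D, act γ x.1.1 ∈ U) (by
    rintro ⟨x, hx⟩ ⟨y, hy⟩ ⟨γ, hγ, rfl⟩
    have hx1 : x.1 ∈ H3 := hx.1
    refine propext ⟨?_, ?_⟩
    · rintro ⟨δ, hδ, h⟩
      refine ⟨δ * γ⁻¹, mul_mem hδ (inv_mem hγ), ?_⟩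
      simp only at h ⊢
      rwa [act_mul _ _ (act_mem γ hx1), act_inv_act γ hx1]
    · rintro ⟨δ, hδ, h⟩
      refine ⟨δ * γ, mul_mem hδ hγ, ?_⟩
      simp only at h ⊢
      rwa [act_mul _ _ hx1])

lemma isOpen_quotSet {U : Set (ℂ × ℝ)} (hU : IsOpen U) : IsOpen (quotSet D U) :=
  isOpen_coinduced.2 (isOpen_exists_act hU)

/-- An exhaustion of `ℍ³`. -/
def box (n : ℕ) : Set (ℂ × ℝ) := {P | ‖P.1‖ ≤ n + 1 ∧ 1 ≤ (n + 1) * P.2 ∧ P.2 ≤ n + 1}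

lemma isCompact_box (n : ℕ) : IsCompact (box n) := by
  refine ((isCompact_closedBall (0 : ℂ) (n + 1)).prod (isCompact_Icc (a := (0 : ℝ)) (b := n + 1))).of_isClosed_subset
    ?_ fun P hP => ⟨by simpa using hP.1, ?_, hP.2.2⟩
  · have h1 : IsClosed {P : ℂ × ℝ | ‖P.1‖ ≤ n + 1} := isClosed_le (by fun_prop) (by fun_prop)
    have h2 : IsClosed {P : ℂ × ℝ | 1 ≤ (n + 1) * P.2} := isClosed_le (by fun_prop) (by fun_prop)
    have h3 : IsClosed {P : ℂ × ℝ | P.2 ≤ n + 1} := isClosed_le (by fun_prop) (by fun_prop)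
    exact h1.inter (h2.inter h3)
  · have h := hP.2.1
    by_contra hcon
    have : ((n : ℝ) + 1) * P.2 ≤ 0 := mul_nonpos_of_nonneg_of_nonpos (by positivity) (not_le.1 hcon).le
    linarith

lemma box_subset_H3 (n : ℕ) : box n ⊆ H3 := fun P hP => by
  have h := hP.2.1
  by_contra hcon
  have : ((n : ℝ) + 1) * P.2 ≤ 0 := mul_nonpos_of_nonneg_of_nonpos (by positivity) (not_lt.1 hcon)
  linarith

/-- A test function is supported over the `Γ`-orbit of a compact subset of `ℍ³`. -/
lemma IsTestFunction.exists_box (hf : IsTestFunction f) :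
    ∃ n, ∀ P v, lift f (P, v) ≠ 0 → P ∈ orbitSet D (box n) := by
  -- Open versions of the boxes: their saturations are open in the quotient, so finitely many of
  -- them, hence the largest, cover the compact support.
  set U : ℕ → Set (ℂ × ℝ) := fun n => {P | ‖P.1‖ < n + 1 ∧ 1 < (n + 1) * P.2 ∧ P.2 < n + 1} with hU
  have hUo : ∀ n, IsOpen (U n) := fun n => by
    have h1 : IsOpen {P : ℂ × ℝ | ‖P.1‖ < n + 1} := isOpen_lt (by fun_prop) (by fun_prop)
    have h2 : IsOpen {P : ℂ × ℝ | 1 < (n + 1) * P.2} := isOpen_lt (by fun_prop) (by fun_prop)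
    have h3 : IsOpen {P : ℂ × ℝ | P.2 < n + 1} := isOpen_lt (by fun_prop) (by fun_prop)
    exact h1.inter (h2.inter h3)
  have hmono : ∀ {n m : ℕ}, n ≤ m → U n ⊆ U m := fun {n m} h P hP => by
    have h' : (n : ℝ) ≤ m := Nat.cast_le.2 h
    have hpos : 0 < P.2 := by
      by_contra hcon
      have : ((n : ℝ) + 1) * P.2 ≤ 0 :=
        mul_nonpos_of_nonneg_of_nonpos (by positivity) (not_lt.1 hcon)
      linarith [hP.2.1]
    exact ⟨by linarith [hP.1], by nlinarith [hP.2.1], by linarith [hP.2.2]⟩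
  have hcov : tsupport f ⊆ ⋃ n, quotSet D (U n) := by
    intro x _
    induction x using Quot.ind with
    | mk x =>
    have hx : 0 < x.1.1.2 := x.2.1
    obtain ⟨n, hn⟩ := exists_nat_gt (max ‖x.1.1.1‖ (max x.1.1.2 (1 / x.1.1.2)))
    simp only [max_lt_iff] at hn
    have h3 : 1 < n * x.1.1.2 := by
      have := hn.2.2
      rwa [div_lt_iff₀ hx] at this
    refine mem_iUnion.2 ⟨n, ⟨1, one_mem _, ?_⟩⟩
    rw [act_one]
    exact ⟨by linarith, by linarith, by linarith⟩
  obtain ⟨t, ht⟩ := hf.compact.elim_finite_subcover _ (fun n => isOpen_quotSet (hUo n)) hcov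
  refine ⟨t.sup id, fun P v hne => ?_⟩
  have hmem : (P, v) ∈ T1H3 := by
    by_contra hcon
    exact hne (dif_neg hcon)
  rw [lift, dif_pos hmem] at hne
  obtain ⟨n, hn, γ, hγ, h⟩ := mem_iUnion₂.1 (ht (subset_tsupport f hne))
  obtain ⟨h1, h2, h3⟩ := hmono (Finset.le_sup (f := id) hn) h
  exact ⟨hmem.1, γ, hγ, h1.le, h2.le, h3.le⟩

/-- If `c = 0`, then `|d| ≥ 1` and the height does not grow; otherwise `|c| ≥ 1` and it is at most
`1/λ`. -/
lemma im_act_le {σ : SL(2, ℂ)} (hσ : σ ∈ Gam D) {P : ℂ × ℝ} (hP : P ∈ H3) :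
    (act σ P).2 ≤ P.2 + 1 / P.2 := by
  have hP0 : 0 < P.2 := hP
  have hO := Om_pos σ hP
  have hm := mem_Gam.1 hσ
  rw [show (act σ P).2 = P.2 / Om σ P from rfl]
  by_cases hc : σ 1 0 = 0
  · have hd : σ 1 1 ≠ 0 := by
      have := det_eq σ
      intro h
      simp [hc, h] at this
    have h1 : 1 ≤ Om σ P := by
      simpa [Om, hc] using one_le_normSq (hm 1 1) hd
    have : P.2 / Om σ P ≤ P.2 := div_le_self hP0.le h1
    have : 0 < 1 / P.2 := by positivity
    linarith
  · have h1 : P.2 ^ 2 ≤ Om σ P := by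
      have := one_le_normSq (hm 1 0) hc
      have := Complex.normSq_nonneg (σ 1 0 * P.1 + σ 1 1)
      unfold Om
      nlinarith [sq_nonneg P.2]
    have : P.2 / Om σ P ≤ 1 / P.2 := by
      rw [div_le_div_iff₀ hO hP0]
      nlinarith
    linarith

lemma im_le_of_mem_orbitSet {n : ℕ} {P : ℂ × ℝ} (h : P ∈ orbitSet D (box n)) : P.2 ≤ 2 * (n + 1) := by
  obtain ⟨hP, γ, hγ, hb⟩ := h
  have h1 := im_act_le (inv_mem hγ) (act_mem γ hP)
  rw [act_inv_act γ hP] at h1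
  have h2 : 0 < (act γ P).2 := act_mem γ hP
  have h3 : 1 / (act γ P).2 ≤ n + 1 := by
    rw [div_le_iff₀ h2]
    exact hb.2.1
  linarith [hb.2.2]

lemma continuousOn_fib (hf : IsTestFunction f) :
    ContinuousOn (fun x : (ℂ × ℝ) × (ℂ × ℝ) => fib f x.1 x.2) (H3 ×ˢ sph) :=
  hf.smooth.continuousOn.comp (by fun_prop) fun _ hx => mem_T1H3_smul hx.1 hx.2

lemma continuousOn_fib_right (hf : IsTestFunction f) {P : ℂ × ℝ} (hP : P ∈ H3) :
    ContinuousOn (fib f P) sph :=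
  (continuousOn_fib hf).comp (f := fun p : ℂ × ℝ => (P, p)) (by fun_prop) fun _ hp => ⟨hP, hp⟩

lemma continuousOn_fib_left (hf : IsTestFunction f) {p : ℂ × ℝ} (hp : p ∈ sph) :
    ContinuousOn (fun P => fib f P p) H3 :=
  (continuousOn_fib hf).comp (f := fun P : ℂ × ℝ => (P, p)) (by fun_prop) fun _ hP => ⟨hP, hp⟩

/-- A bound over the compact box spreads to all of `ℍ³` by invariance, as elements of `Γ` permute
the fibres through rotations. -/
lemma IsTestFunction.exists_bound (hf : IsTestFunction f) :
    ∃ M, ∀ P ∈ H3, ∀ p ∈ sph, ‖fib f P p‖ ≤ M := by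
  obtain ⟨n, hn⟩ := hf.exists_box
  obtain ⟨M, hM⟩ := ((isCompact_box n).prod isCompact_sph).exists_bound_of_continuousOn
    ((continuousOn_fib hf).mono (prod_mono_left (box_subset_H3 n)))
  have hN : (((0, 1) : ℂ × ℝ)) ∈ box n := by
    refine ⟨by simp; positivity, by simp, by simp⟩
  have hM0 : 0 ≤ M := (norm_nonneg _).trans (hM ((0, 1), north) ⟨hN, north_mem_sph⟩)
  refine ⟨M, fun P hP p hp => ?_⟩
  by_cases h0 : fib f P p = 0
  · rw [h0, norm_zero]
    exact hM0
  · obtain ⟨-, γ, hγ, hb⟩ := hn _ _ h0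
    rw [← fib_act hγ hP hp]
    exact hM (act γ P, rot γ P p) ⟨hb, (isOrth_rot γ hP).mapsTo_sph hp⟩

lemma continuousOn_integral_fib_mul (hf : IsTestFunction f) {h : ℂ × ℝ → ℂ} (hh : ContinuousOn h sph) :
    ContinuousOn (fun P => ∫ p, fib f P p * h p ∂sphMeas) H3 := by
  obtain ⟨M, hM⟩ := hf.exists_bound
  obtain ⟨C, hC⟩ := isCompact_sph.exists_bound_of_continuousOn hh
  refine continuousOn_of_dominated (bound := fun _ => M * C)
    (fun P hP => (integrable_sphMeas ((continuousOn_fib_right hf hP).mul hh)).1) (fun P hP => ?_)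
    (integrable_const _) ?_
  · filter_upwards [ae_mem_sph] with p hp
    rw [norm_mul]
    exact mul_le_mul (hM P hP p hp) (hC p hp) (norm_nonneg _) ((norm_nonneg _).trans (hM P hP p hp))
  · filter_upwards [ae_mem_sph] with p hp
    exact (continuousOn_fib_left hf hp).mul continuousOn_const

/-- The projection of the fibre function to the spherical harmonics of degree `l`, at `q`. -/
def proj (f : T1M D → ℂ) (l : ℕ) (P q : ℂ × ℝ) : ℂ :=
  ∫ p, fib f P p * zonal l (ed q p) ∂sphMeas

/-- Both the surface measure and the zonal kernel are invariant under the rotation `rot γ P`. -/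
lemma proj_act (l : ℕ) {γ : SL(2, ℂ)} (hγ : γ ∈ Gam D) {P : ℂ × ℝ} (hP : P ∈ H3) (q : ℂ × ℝ) :
    proj f l (act γ P) (rot γ P q) = proj f l P q := by
  have hR := isOrth_rot γ hP
  rw [proj, ← integral_comp_isOrth hR]
  refine integral_congr_ae ?_
  filter_upwards [ae_mem_sph] with p hp
  rw [fib_act hγ hP hp, hR.ed]

lemma continuousOn_proj (hf : IsTestFunction f) (l : ℕ) (q : ℂ × ℝ) :
    ContinuousOn (fun P => proj f l P q) H3 :=
  continuousOn_integral_fib_mul hf (Continuous.continuousOn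
    (Complex.continuous_ofReal.comp ((continuous_zonal l).comp
      (continuous_ed continuous_const continuous_id))))

lemma coeff_eq (hf : IsTestFunction f) (l : ℕ) (k : ℤ) {P : ℂ × ℝ} (hP : P ∈ H3) :
    coeff f l k P = ∫ p, fib f P p * conj (sphHarm l k p) ∂sphMeas := by
  have := continuous_sphHarm l k
  exact sphereInt_eq ((continuousOn_fib_right hf hP).mul (by fun_prop))

lemma continuousOn_coeff (hf : IsTestFunction f) (l : ℕ) (k : ℤ) :
    ContinuousOn (coeff f l k) H3 := by
  have := continuous_sphHarm l k
  exact (continuousOn_integral_fib_mul hf (by fun_prop)).congr fun P hP => coeff_eq hf l k hP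

/-- The parameter space of `(P, (α, β), (θ, φ))`. -/
abbrev Param : Type := (ℂ × ℝ) × (ℝ × ℝ) × (ℝ × ℝ)

/-- The unit tangent vector at `P` with spherical coordinates `(θ, φ)` in the frame `(α, β)`. -/
def paramMap (x : Param) : (ℂ × ℝ) × (ℂ × ℝ) :=
  (x.1, x.1.2 • frame x.2.1.1 x.2.1.2 (spherePt x.2.2.1 x.2.2.2))

lemma contDiff_ofReal_comp {g : Param → ℝ} (hg : ContDiff ℝ ∞ g) :
    ContDiff ℝ ∞ (fun x => (g x : ℂ)) := Complex.ofRealCLM.contDiff.comp hg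

/-- Smoothness on the submanifold `T₁(ℍ³)` is transported to an open parameter set, where
derivatives in `θ` exist in the ordinary sense and are jointly continuous. The frame `(α, β)` lets
any point of the sphere play the role of the pole. -/
lemma contDiff_paramMap : ContDiff ℝ ∞ paramMap := by
  have hsp : ContDiff ℝ ∞ fun x : Param => spherePt x.2.2.1 x.2.2.2 := by
    unfold spherePt
    refine ContDiff.prodMk (ContDiff.mul (contDiff_ofReal_comp (by fun_prop)) ?_) (by fun_prop)
    exact (ContDiff.mul contDiff_const (contDiff_ofReal_comp (by fun_prop))).cexp
  have hre : ContDiff ℝ ∞ fun x : Param => (spherePt x.2.2.1 x.2.2.2).1.re :=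
    Complex.reCLM.contDiff.comp (contDiff_fst.comp hsp)
  have him : ContDiff ℝ ∞ fun x : Param => (spherePt x.2.2.1 x.2.2.2).1.im :=
    Complex.imCLM.contDiff.comp (contDiff_fst.comp hsp)
  have hY : ContDiff ℝ ∞ fun x : Param => rotY x.2.1.1 (spherePt x.2.2.1 x.2.2.2) := by
    simp only [rotY_apply]
    refine ContDiff.prodMk (ContDiff.add (contDiff_ofReal_comp ?_)
      ((contDiff_ofReal_comp him).mul contDiff_const)) ?_
    · fun_prop
    · fun_prop
  have hZ : ContDiff ℝ ∞ fun x : Param => frame x.2.1.1 x.2.1.2 (spherePt x.2.2.1 x.2.2.2) := by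
    simp only [frame, ContinuousLinearMap.comp_apply, rotZ_apply]
    refine ContDiff.prodMk (ContDiff.mul ?_ (contDiff_fst.comp hY)) (contDiff_snd.comp hY)
    exact (ContDiff.mul contDiff_const (contDiff_ofReal_comp (by fun_prop))).cexp
  unfold paramMap
  fun_prop

/-- The parameters with base point in `ℍ³`. -/
def paramSet : Set Param := H3 ×ˢ univ

lemma isOpen_paramSet : IsOpen paramSet := isOpen_H3.prod isOpen_univ

/-- The direction of the coordinate `θ`. -/
def dirTheta : Param := (0, 0, (1, 0))

lemma contDiffOn_dirDeriv {Φ : Param → ℂ} (h : ContDiffOn ℝ ∞ Φ paramSet) :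
    ContDiffOn ℝ ∞ (fun x => fderiv ℝ Φ x dirTheta) paramSet :=
  (h.fderiv_of_isOpen isOpen_paramSet (m := ∞) (by simp)).clm_apply contDiffOn_const

lemma hasDerivAt_dirDeriv {Φ : Param → ℂ} (h : ContDiffOn ℝ ∞ Φ paramSet) {P : ℂ × ℝ} (hP : P ∈ H3)
    (α β θ φ : ℝ) :
    HasDerivAt (fun t : ℝ => Φ (P, (α, β), (t, φ))) (fderiv ℝ Φ (P, (α, β), (θ, φ)) dirTheta) θ := by
  have hd : HasFDerivAt Φ (fderiv ℝ Φ (P, (α, β), (θ, φ))) (P, (α, β), (θ, φ)) :=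
    ((h.differentiableOn (by simp)).differentiableAt
      (isOpen_paramSet.mem_nhds ⟨hP, mem_univ _⟩)).hasFDerivAt
  have hl : HasDerivAt (fun t : ℝ => ((P, (α, β), (t, φ)) : Param)) dirTheta θ :=
    (hasDerivAt_const θ P).prodMk ((hasDerivAt_const θ (α, β)).prodMk
      ((hasDerivAt_id θ).prodMk (hasDerivAt_const θ φ)))
  exact hd.comp_hasDerivAt θ hl

lemma continuous_slice {Φ : Param → ℂ} (h : ContDiffOn ℝ ∞ Φ paramSet) {P : ℂ × ℝ} (hP : P ∈ H3)
    (α β : ℝ) : Continuous fun x : ℝ × ℝ => Φ (P, (α, β), (x.1, x.2)) :=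
  h.continuousOn.comp_continuous (by fun_prop) fun _ => ⟨hP, mem_univ _⟩

lemma contDiffOn_lift_paramMap (hf : IsTestFunction f) :
    ContDiffOn ℝ ∞ (fun x => lift f (paramMap x)) paramSet :=
  hf.smooth.comp contDiff_paramMap.contDiffOn fun x hx =>
    mem_T1H3_smul hx.1 ((isOrth_frame _ _).mapsTo_sph (en_spherePt _ _))

lemma proj_spherePt (l : ℕ) (P : ℂ × ℝ) (α β : ℝ) : proj f l P (spherePt α β) =
    ∫ p, fib f P (frame α β p) * zonal l p.2 ∂sphMeas := by
  rw [proj, ← frame_north, integral_mul_zonal_ed (fib f P) l (isOrth_frame α β)]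

lemma continuousOn_fib_frame (hf : IsTestFunction f) {P : ℂ × ℝ} (hP : P ∈ H3) (α β : ℝ) :
    ContinuousOn (fun p => fib f P (frame α β p)) sph :=
  (continuousOn_fib_right hf hP).comp (by fun_prop) (isOrth_frame α β).mapsTo_sph

/-- The expansion at the pole, applied in a frame that carries the pole to `q`. -/
lemma hasSum_proj (hf : IsTestFunction f) {P q : ℂ × ℝ} (hP : P ∈ H3) (hq : q ∈ sph) :
    HasSum (fun l => proj f l P q) (fib f P q) := by
  obtain ⟨α, -, β, -, rfl⟩ := exists_spherePt hq
  have hΦ := contDiffOn_lift_paramMap hf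
  have hΦ1 := contDiffOn_dirDeriv hΦ
  have := hasSum_integral_mul_zonal (continuousOn_fib_frame hf hP α β)
    (hasDerivAt_dirDeriv hΦ hP α β) (hasDerivAt_dirDeriv hΦ1 hP α β) (continuous_slice hΦ1 hP α β)
    (continuous_slice (contDiffOn_dirDeriv hΦ1) hP α β)
  simpa only [proj_spherePt, frame_north] using this

/-- The second derivative in `θ` is bounded uniformly over the compact set of base points and the
compact ranges of all angles. -/
lemma exists_norm_proj_le (hf : IsTestFunction f) {K : Set (ℂ × ℝ)} (hK : IsCompact K) (hKH : K ⊆ H3) :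
    ∃ C, ∀ P ∈ K, ∀ q ∈ sph, ∀ l, ‖proj f l P q‖ ≤ C * ((l : ℝ) + 1) ^ (-(3 / 2 : ℝ)) := by
  obtain ⟨M, hM⟩ := hf.exists_bound
  have hΦ := contDiffOn_lift_paramMap hf
  have hΦ1 := contDiffOn_dirDeriv hΦ
  have hΦ2 := contDiffOn_dirDeriv hΦ1
  obtain ⟨C, hC⟩ := (hK.prod ((isCompact_Icc (a := (0 : ℝ)) (b := Real.pi)).prod
    (isCompact_Icc (a := -Real.pi) (b := Real.pi)) |>.prod
      ((isCompact_Icc (a := (0 : ℝ)) (b := Real.pi)).prod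
        (isCompact_Icc (a := (0 : ℝ)) (b := 2 * Real.pi))))).exists_bound_of_continuousOn
    (hΦ2.continuousOn.mono (prod_mono hKH (subset_univ _)))
  refine ⟨M + 12 * C, fun P hP q hq l => ?_⟩
  obtain ⟨α, hα, β, hβ, rfl⟩ := exists_spherePt hq
  have hPH := hKH hP
  rw [proj_spherePt]
  exact norm_integral_mul_zonal_le (continuousOn_fib_frame hf hPH α β)
    (hasDerivAt_dirDeriv hΦ hPH α β) (hasDerivAt_dirDeriv hΦ1 hPH α β) (continuous_slice hΦ1 hPH α β)
    (continuous_slice hΦ2 hPH α β) (fun p hp => hM P hPH _ ((isOrth_frame α β).mapsTo_sph hp))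
    (fun θ hθ φ hφ => hC (P, (α, β), (θ, φ)) ⟨hP, ⟨hα, hβ⟩, hθ, hφ⟩) l

lemma IsTestFunction.exists_proj_bound (hf : IsTestFunction f) :
    ∃ C, 0 ≤ C ∧ ∀ P ∈ H3, ∀ q ∈ sph, ∀ l, ‖proj f l P q‖ ≤ C * ((l : ℝ) + 1) ^ (-(3 / 2 : ℝ)) := by
  obtain ⟨n, hn⟩ := hf.exists_box
  obtain ⟨C, hC⟩ := exists_norm_proj_le hf (isCompact_box n) (box_subset_H3 n)
  refine ⟨max C 0, le_max_right _ _, fun P hP q hq l => ?_⟩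
  have hl : 0 ≤ ((l : ℝ) + 1) ^ (-(3 / 2 : ℝ)) := by positivity
  by_cases h : P ∈ orbitSet D (box n)
  · obtain ⟨-, γ, hγ, hb⟩ := h
    rw [← proj_act l hγ hP]
    exact (hC _ hb _ ((isOrth_rot γ hP).mapsTo_sph hq) l).trans
      (mul_le_mul_of_nonneg_right (le_max_left _ _) hl)
  · have h0 : ∀ p, fib f P p = 0 := fun p => by
      by_contra hne
      exact h (hn _ _ hne)
    simp only [proj, h0, zero_mul, integral_zero, norm_zero]
    positivity

end TestFunction

/-! ### Integrals over the strip -/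

section Strip

open scoped ENNReal

lemma integrable_tsum_of_norm_le {α ι : Type*} [MeasurableSpace α] {μ : Measure α} [Countable ι]
    {T : ι → α → ℂ} {b : ι → α → ℝ} (hT : ∀ i, AEStronglyMeasurable (T i) μ)
    (hle : ∀ i, ∀ᵐ a ∂μ, ‖T i a‖ ≤ b i a) (hb : ∀ i, Integrable (b i) μ)
    (hs : Summable fun i => ∫ a, b i a ∂μ) :
    (∀ i, Integrable (T i) μ) ∧ Integrable (fun a => ∑' i, T i a) μ ∧
      HasSum (fun i => ∫ a, T i a ∂μ) (∫ a, ∑' i, T i a ∂μ) := by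
  have hi : ∀ i, Integrable (T i) μ := fun i => (hb i).mono' (hT i) (hle i)
  have hs' : Summable fun i => ∫ a, ‖T i a‖ ∂μ :=
    hs.of_nonneg_of_le (fun i => integral_nonneg fun a => norm_nonneg _)
      fun i => integral_mono_ae (hi i).norm (hb i) (hle i)
  refine ⟨hi, ⟨(AEMeasurable.tsum fun i => (hT i).aemeasurable).aestronglyMeasurable, ?_⟩,
    hasSum_integral_of_summable_integral_norm hi hs'⟩
  calc ∫⁻ a, ‖∑' i, T i a‖ₑ ∂μ ≤ ∫⁻ a, ∑' i, ‖T i a‖ₑ ∂μ :=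
        lintegral_mono fun a => enorm_tsum_le_tsum_enorm
    _ = ∑' i, ∫⁻ a, ‖T i a‖ₑ ∂μ := lintegral_tsum fun i => (hT i).enorm
    _ = ∑' i, ENNReal.ofReal (∫ a, ‖T i a‖ ∂μ) := by
        simp only [ofReal_integral_norm_eq_lintegral_enorm (hi _)]
    _ < ⊤ := lt_top_iff_ne_top.2 hs'.tsum_ofReal_ne_top

lemma aestronglyMeasurable_hypVol {g : ℂ × ℝ → ℂ} (hg : ContinuousOn g H3) :
    AEStronglyMeasurable g hypVol :=
  (hg.aestronglyMeasurable measurableSet_H3).mono_ac (withDensity_absolutelyContinuous _ _)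

/-- The measure `dx dy dλ` on the strip over the cell `C_D`. -/
def stripMeas (D : ℕ) : Measure (ℂ × ℝ) :=
  (volume.restrict (cell D)).prod (volume.restrict (Ioi 0))

lemma hypVol_restrict_strip (D : ℕ) : hypVol.restrict (strip D) =
    (stripMeas D).withDensity fun P => ENNReal.ofReal (1 / P.2 ^ 3) := by
  rw [hypVol, restrict_withDensity (measurableSet_strip D),
    Measure.restrict_restrict (measurableSet_strip D), inter_eq_left.2 (strip_subset D), stripMeas,
    Measure.prod_restrict, strip, ← Measure.volume_eq_prod]

lemma measurable_density : Measurable fun P : ℂ × ℝ => ENNReal.ofReal (1 / P.2 ^ 3) := by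
  fun_prop

instance (D : ℕ) : IsFiniteMeasure (volume.restrict (cell D)) :=
  ⟨by simpa using (isCompact_cell D).measure_lt_top⟩

lemma ae_stripMeas (D : ℕ) : ∀ᵐ P ∂stripMeas D, 0 < P.2 := by
  rw [stripMeas, Measure.prod_restrict]
  exact (ae_restrict_mem (measurableSet_strip D)).mono fun P hP => hP.2

lemma integrableOn_strip_iff (D : ℕ) {g : ℂ × ℝ → ℂ} :
    IntegrableOn g (strip D) hypVol ↔ Integrable (fun P => (1 / P.2 ^ 3 : ℝ) • g P) (stripMeas D) := by
  rw [IntegrableOn, hypVol_restrict_strip,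
    integrable_withDensity_iff_integrable_smul' measurable_density (by simp)]
  refine integrable_congr ?_
  filter_upwards [ae_stripMeas D] with P hP
  rw [ENNReal.toReal_ofReal (by positivity)]

lemma integral_strip (D : ℕ) (g : ℂ × ℝ → ℂ) :
    ∫ P in strip D, g P ∂hypVol = ∫ P, (1 / P.2 ^ 3 : ℝ) • g P ∂stripMeas D := by
  rw [hypVol_restrict_strip, integral_withDensity_eq_integral_toReal_smul measurable_density (by simp)]
  refine integral_congr_ae ?_
  filter_upwards [ae_stripMeas D] with P hP
  rw [ENNReal.toReal_ofReal (by positivity)]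

variable {D : ℕ}

/-- The function `λ ^ (1 + r)`, cut off to the orbit of a compact set. -/
def cut (D n : ℕ) (r : ℝ) : ℂ × ℝ → ℝ := (orbitSet D (box n)).indicator fun P => P.2 ^ (1 + r)

lemma measurableSet_orbit_box (D n : ℕ) : MeasurableSet (orbitSet D (box n)) :=
  measurableSet_orbitSet (isCompact_box n).isClosed.measurableSet

lemma measurable_cut (D n : ℕ) (r : ℝ) : Measurable (cut D n r) :=
  Measurable.indicator (by fun_prop) (measurableSet_orbit_box D n)

lemma cut_nonneg (D n : ℕ) (r : ℝ) (P : ℂ × ℝ) : 0 ≤ cut D n r P :=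
  indicator_nonneg (fun P hP => Real.rpow_nonneg (le_of_lt hP.1) _) P

lemma cut_act_unip {n : ℕ} {r : ℝ} {τ : SL(2, ℂ)} (hτ : τ ∈ GamInf' D) {P : ℂ × ℝ} (hP : P ∈ H3) :
    cut D n r (act τ P) = cut D n r P := by
  have h2 : (act τ P).2 = P.2 := by simp [act_unip hτ]
  by_cases h : P ∈ orbitSet D (box n)
  · rw [cut, indicator_of_mem h, indicator_of_mem ((act_mem_orbitSet hτ.1 hP).2 h), h2]
  · rw [cut, indicator_of_notMem h, indicator_of_notMem fun h' => h ((act_mem_orbitSet hτ.1 hP).1 h')]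

/-- The orbit of the box has bounded height, so the integral is at most the area of the cell times
that of `λ^(r-2)` over a bounded interval. It is finite since `r - 2 > -1`. -/
lemma integrableOn_cut (D n : ℕ) {r : ℝ} (hr : 1 < r) : IntegrableOn (cut D n r) (strip D) hypVol := by
  set B : ℝ := 2 * (n + 1) with hB
  have hB0 : 0 ≤ B := by positivity
  refine ⟨(measurable_cut D n r).aestronglyMeasurable, ?_⟩
  rw [HasFiniteIntegral, hypVol_restrict_strip, lintegral_withDensity_eq_lintegral_mul _
    measurable_density (measurable_cut D n r).enorm]
  set k : ℝ → ℝ≥0∞ := (Ioc 0 B).indicator fun t => ENNReal.ofReal (t ^ (r - 2)) with hk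
  have hkm : Measurable k := Measurable.indicator (by fun_prop) measurableSet_Ioc
  have hle : ∀ᵐ P ∂stripMeas D,
      ((fun P : ℂ × ℝ => ENNReal.ofReal (1 / P.2 ^ 3)) * fun P => ‖cut D n r P‖ₑ) P ≤ 1 * k P.2 := by
    filter_upwards [ae_stripMeas D] with P hP
    by_cases h : P ∈ orbitSet D (box n)
    · rw [Pi.mul_apply, hk, indicator_of_mem (show P.2 ∈ Ioc 0 B from ⟨hP, im_le_of_mem_orbitSet h⟩),
        Real.enorm_of_nonneg (cut_nonneg D n r P), ← ENNReal.ofReal_mul (by positivity), one_mul,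
        cut, indicator_of_mem h]
      refine le_of_eq (congrArg _ ?_)
      rw [show r - 2 = 1 + r - (3 : ℕ) by push_cast; ring, Real.rpow_sub_natCast hP.ne']
      ring
    · rw [Pi.mul_apply, cut, indicator_of_notMem h]
      simp
  refine lt_of_le_of_lt (lintegral_mono_ae hle) ?_
  have h1 := lintegral_prod_mul (μ := volume.restrict (cell D)) (ν := volume.restrict (Ioi (0 : ℝ)))
    (f := fun _ => 1) (g := k) aemeasurable_const hkm.aemeasurable
  rw [stripMeas, h1, lintegral_one]
  refine ENNReal.mul_lt_top (measure_lt_top _ _) ?_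
  have hint : IntegrableOn (fun t : ℝ => t ^ (r - 2)) (Ioc 0 B) :=
    (intervalIntegrable_iff_integrableOn_Ioc_of_le hB0).1
      (intervalIntegral.intervalIntegrable_rpow' (by linarith))
  calc ∫⁻ t in Ioi 0, k t ≤ ∫⁻ t, k t := setLIntegral_le_lintegral _ _
    _ = ∫⁻ t in Ioc 0 B, ENNReal.ofReal (t ^ (r - 2)) := lintegral_indicator measurableSet_Ioc _
    _ < ⊤ := hint.lintegral_lt_top

end Strip

/-! ### The formula for the Mellin transform -/

section Mellin

variable {D : ℕ} {f : T1M D → ℂ} {s : ℂ}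

/-- The unit vector `e₁`. -/
def east : ℂ × ℝ := (1, 0)

lemma east_mem_sph : east ∈ sph := by simp [sph, en, east]

lemma norm_im_cpow {P : ℂ × ℝ} (hP : P ∈ H3) (s : ℂ) : ‖(P.2 : ℂ) ^ (1 + s)‖ = P.2 ^ (1 + s.re) := by
  rw [Complex.norm_cpow_eq_rpow_re_of_pos hP]
  simp

lemma norm_cpow_mul_le_cut {n : ℕ} {g : ℂ × ℝ → ℂ} {C : ℝ} {P : ℂ × ℝ} (hP : P ∈ H3)
    (h0 : P ∉ orbitSet D (box n) → g P = 0) (hC : ‖g P‖ ≤ C) (s : ℂ) :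
    ‖(P.2 : ℂ) ^ (1 + s) * g P‖ ≤ C * cut D n s.re P := by
  rw [norm_mul, norm_im_cpow hP]
  by_cases h : P ∈ orbitSet D (box n)
  · rw [cut, indicator_of_mem h, mul_comm]
    exact mul_le_mul_of_nonneg_right hC (Real.rpow_nonneg (le_of_lt hP) _)
  · rw [h0 h, norm_zero, mul_zero, cut, indicator_of_notMem h, mul_zero]

lemma continuousOn_im_cpow (s : ℂ) : ContinuousOn (fun P : ℂ × ℝ => (P.2 : ℂ) ^ (1 + s)) H3 := by
  refine ContinuousOn.cpow (by fun_prop) continuousOn_const fun P hP => ?_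
  exact Complex.ofReal_mem_slitPlane.2 hP

lemma fib_act_unip {τ : SL(2, ℂ)} (hτ : τ ∈ GamInf' D) {P : ℂ × ℝ} (hP : P ∈ H3) {p : ℂ × ℝ}
    (hp : p ∈ sph) : fib f (act τ P) p = fib f P p := by
  have hd : dAct τ P = ContinuousLinearMap.id ℝ (ℂ × ℝ) := by
    have : act τ = fun P => P + (τ 0 1, (0 : ℝ)) := funext (act_unip hτ)
    rw [dAct, this, fderiv_add_const, fderiv_fun_id]
  have h2 : (act τ P).2 = P.2 := by simp [act_unip hτ]
  have hrot : rot τ P p = p := by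
    rw [rot, hd, h2, div_self (ne_of_gt hP), one_smul]
    rfl
  conv_lhs => rw [← hrot]
  exact fib_act hτ.1 hP hp

lemma proj_act_unip (l : ℕ) {τ : SL(2, ℂ)} (hτ : τ ∈ GamInf' D) {P : ℂ × ℝ} (hP : P ∈ H3)
    (q : ℂ × ℝ) : proj f l (act τ P) q = proj f l P q := by
  refine integral_congr_ae ?_
  filter_upwards [ae_mem_sph] with p hp
  rw [fib_act_unip hτ hP hp]

lemma continuousOn_wigner (l : ℕ) (k m : ℤ) (σ : SL(2, ℂ)) :
    ContinuousOn (fun P => conj (wigner l k m (rot σ P).inverse)) H3 := by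
  have h1 := continuous_sphHarm l m
  have h2 := continuous_sphHarm l k
  obtain ⟨C, hC⟩ := isCompact_sph.exists_bound_of_continuousOn h1.continuousOn
  obtain ⟨C', hC'⟩ := isCompact_sph.exists_bound_of_continuousOn h2.continuousOn
  refine ContinuousOn.congr (f := fun P => ∫ p, conj (sphHarm l m (rot σ P p)) * sphHarm l k p ∂sphMeas)
    ?_ fun P hP => conj_wigner_inverse l k m (isOrth_rot σ hP)
  refine continuousOn_of_dominated (bound := fun _ => C * C') (fun P _ =>
    (integrable_sphMeas (Continuous.continuousOn (by fun_prop))).1) (fun P hP => ?_)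
    (integrable_const _) ?_
  · filter_upwards [ae_mem_sph] with p hp
    have := hC _ ((isOrth_rot σ hP).mapsTo_sph hp)
    rw [norm_mul, RCLike.norm_conj]
    exact mul_le_mul this (hC' p hp) (norm_nonneg _) ((norm_nonneg _).trans this)
  · filter_upwards with p
    refine ContinuousOn.mul (Complex.continuous_conj.comp_continuousOn (h1.comp_continuousOn ?_))
      continuousOn_const
    exact (continuousOn_rot σ).clm_apply continuousOn_const

lemma continuousOn_HTerm (l : ℕ) (k m : ℤ) (s : ℂ) (σ : SL(2, ℂ)) :
    ContinuousOn (fun P => HTerm l k m P s σ) H3 :=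
  (continuousOn_wigner l k m σ).mul ((continuousOn_im_cpow s).comp (contDiffOn_act σ).continuousOn
    fun _ hP => act_mem σ hP)

lemma exists_norm_coeff_le (hf : IsTestFunction f) (l : ℕ) (k : ℤ) :
    ∃ C, ∀ P ∈ H3, ‖coeff f l k P‖ ≤ C := by
  obtain ⟨M, hM⟩ := hf.exists_bound
  obtain ⟨C, hC⟩ := isCompact_sph.exists_bound_of_continuousOn (continuous_sphHarm l k).continuousOn
  refine ⟨M * C * sphMeas.real univ, fun P hP => ?_⟩
  rw [coeff_eq hf l k hP]
  refine norm_integral_le_of_norm_le_const ?_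
  filter_upwards [ae_mem_sph] with p hp
  rw [norm_mul, RCLike.norm_conj]
  exact mul_le_mul (hM P hP p hp) (hC p hp) (norm_nonneg _) ((norm_nonneg _).trans (hM P hP p hp))

lemma fib_eq_zero {n : ℕ} (hn : ∀ P v, lift f (P, v) ≠ 0 → P ∈ orbitSet D (box n)) {P : ℂ × ℝ}
    (h : P ∉ orbitSet D (box n)) (p : ℂ × ℝ) : fib f P p = 0 := by
  by_contra hne
  exact h (hn _ _ hne)

lemma exists_norm_coeff_mul_HTerm_le (hf : IsTestFunction f) {n : ℕ}
    (hn : ∀ P v, lift f (P, v) ≠ 0 → P ∈ orbitSet D (box n)) (l : ℕ) (k m : ℤ) (s : ℂ) :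
    ∃ C, ∀ σ ∈ Gam D, ∀ P ∈ H3, ‖coeff f l k P * HTerm l k m P s σ‖ ≤ C * cut D n s.re (act σ P) := by
  obtain ⟨C, hC⟩ := exists_norm_coeff_le hf l k
  obtain ⟨C', hC'⟩ := exists_norm_wigner_le l k m
  refine ⟨C * C', fun σ hσ P hP => ?_⟩
  have h := norm_cpow_mul_le_cut (D := D) (n := n) (C := C * C')
    (g := fun _ => coeff f l k P * conj (wigner l k m (rot σ P).inverse)) (act_mem σ hP)
    (fun h => ?_) ?_ s
  · refine le_trans (le_of_eq (congrArg _ ?_)) h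
    rw [HTerm]
    ring
  · rw [act_mem_orbitSet hσ hP] at h
    rw [coeff_eq hf l k hP]
    simp only [fib_eq_zero hn h, zero_mul, integral_zero]
  · rw [norm_mul]
    exact mul_le_mul (hC P hP) (hC' _ (isOrth_rot σ hP)) (norm_nonneg _)
      ((norm_nonneg _).trans (hC P hP))

theorem summable_HTerm (hD : Squarefree D) (hs : 1 < s.re) (l : ℕ) (k m : ℤ) {P : ℂ × ℝ} (hP : P ∈ H3) :
    Summable fun σ : Cosets D => HTerm l k m P s (σ.out : Gam D) := by
  obtain ⟨C, hC⟩ := exists_norm_wigner_le l k m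
  refine Summable.of_norm_bounded ((summable_im_rpow hD hP hs).mul_left C) fun σ => ?_
  rw [HTerm, norm_mul, norm_im_cpow (act_mem _ hP)]
  exact mul_le_mul_of_nonneg_right (hC _ (isOrth_rot _ hP))
    (Real.rpow_nonneg (le_of_lt (act_mem _ hP)) _)

variable {F : Set (ℂ × ℝ)}

/-- The term of `σ` is dominated by a multiple of `cut` at `σP`. By unfolding the integrals of these
majorants over `F` have a finite sum, so sum and integral may be exchanged. -/
lemma coeff_mul_HSeries (hD : Squarefree D) (hF : IsFundDomain D F) (hf : IsTestFunction f)
    (hs : 1 < s.re) (l : ℕ) (k m : ℤ) :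
    (∀ σ : Cosets D, IntegrableOn (fun P => coeff f l k P * HTerm l k m P s (σ.out : Gam D)) F hypVol) ∧
    IntegrableOn (fun P => coeff f l k P * HSeries D l k m P s) F hypVol ∧
    HasSum (fun σ : Cosets D => ∫ P in F, coeff f l k P * HTerm l k m P s (σ.out : Gam D) ∂hypVol)
      ((GamInf' D).relIndex (GamInf D) * ∫ P in F, coeff f l k P * HSeries D l k m P s ∂hypVol) := by
  obtain ⟨n, hn⟩ := hf.exists_box
  obtain ⟨C, hC⟩ := exists_norm_coeff_mul_HTerm_le hf hn l k m s
  have hm : AEStronglyMeasurable (cut D n s.re) hypVol := (measurable_cut D n _).aestronglyMeasurable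
  have hinv : ∀ τ ∈ GamInf' D, ∀ P ∈ H3, cut D n s.re (act τ P) = cut D n s.re P :=
    fun τ hτ P hP => cut_act_unip hτ hP
  have hint := integrableOn_cut D n hs
  have hmem : ∀ᵐ P ∂hypVol.restrict F, P ∈ H3 := ae_restrict_of_ae ae_mem_H3
  have hrel : ((GamInf' D).relIndex (GamInf D) : ℂ) ≠ 0 := Nat.cast_ne_zero.2 (relIndex_ne_zero hD)
  obtain ⟨h1, h2, h3⟩ := integrable_tsum_of_norm_le (μ := hypVol.restrict F)
    (T := fun (σ : Cosets D) P => coeff f l k P * HTerm l k m P s (σ.out : Gam D))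
    (b := fun σ P => C * cut D n s.re (act (σ.out : Gam D) P))
    (fun σ => (aestronglyMeasurable_hypVol
      ((continuousOn_coeff hf l k).mul (continuousOn_HTerm l k m s _))).restrict)
    (fun σ => hmem.mono fun P hP => hC _ σ.out.2 P hP)
    (fun σ => (integrableOn_act hD hF hm hint hinv σ).const_mul C) (by
      simp only [integral_const_mul]
      exact (hasSum_unfold_real hD hF hm hint hinv).summable.mul_left C)
  have he : ∀ P, coeff f l k P * HSeries D l k m P s = 1 / ((GamInf' D).relIndex (GamInf D) : ℂ) *
      ∑' σ : Cosets D, coeff f l k P * HTerm l k m P s (σ.out : Gam D) := fun P => by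
    rw [HSeries, tsum_mul_left]
    ring
  refine ⟨h1, ?_, ?_⟩
  · simp only [he]
    exact h2.const_mul _
  · simp only [he]
    rw [integral_const_mul, ← mul_assoc, mul_one_div_cancel hrel, one_mul]
    exact h3

/-- The component of degree `l` of `λ ^ (1 + s) f(P, λ e₁)`. -/
def degreePart (f : T1M D → ℂ) (s : ℂ) (l : ℕ) (P : ℂ × ℝ) : ℂ := (P.2 : ℂ) ^ (1 + s) * proj f l P east

/-- Equivariance turns the component at `σP` in the direction `e₁` into the one at `P` in the
direction `R⁻¹ e₁`, which `sum_sphHarm_mul_wigner` expands. -/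
lemma sum_coeff_mul_HTerm (hf : IsTestFunction f) (s : ℂ) (l : ℕ) {σ : SL(2, ℂ)} (hσ : σ ∈ Gam D)
    {P : ℂ × ℝ} (hP : P ∈ H3) :
    ∑ m ∈ Finset.Icc (-(l : ℤ)) l, ∑ k ∈ Finset.Icc (-(l : ℤ)) l,
      sphHarm l m east * (coeff f l k P * HTerm l k m P s σ) = degreePart f s l (act σ P) := by
  have hR := isOrth_rot σ hP
  have h := sum_sphHarm_mul_wigner l (continuousOn_fib_right hf hP) hR east_mem_sph
  rw [degreePart, ← hR.apply_inverse east, proj_act l hσ hP, proj, ← h, Finset.mul_sum, hR.apply_inverse]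
  refine Finset.sum_congr rfl fun m _ => ?_
  rw [Finset.mul_sum]
  refine Finset.sum_congr rfl fun k _ => ?_
  rw [HTerm, coeff]
  simp only [fib]
  ring

lemma continuousOn_degreePart (hf : IsTestFunction f) (s : ℂ) (l : ℕ) : ContinuousOn (degreePart f s l) H3 :=
  (continuousOn_im_cpow s).mul (continuousOn_proj hf l east)

lemma exists_norm_degreePart_le (hf : IsTestFunction f) {n : ℕ}
    (hn : ∀ P v, lift f (P, v) ≠ 0 → P ∈ orbitSet D (box n)) (s : ℂ) :
    ∃ C, ∀ P ∈ H3, ∀ l, ‖degreePart f s l P‖ ≤ C * ((l : ℝ) + 1) ^ (-(3 / 2 : ℝ)) * cut D n s.re P := by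
  obtain ⟨C, -, hC⟩ := hf.exists_proj_bound
  refine ⟨C, fun P hP l => norm_cpow_mul_le_cut (g := fun P => proj f l P east) hP (fun h => ?_)
    (hC P hP _ east_mem_sph l) s⟩
  simp only [proj, fib_eq_zero hn h, zero_mul, integral_zero]

lemma integrableOn_degreePart (hf : IsTestFunction f) (hs : 1 < s.re) (l : ℕ) :
    IntegrableOn (degreePart f s l) (strip D) hypVol := by
  obtain ⟨n, hn⟩ := hf.exists_box
  obtain ⟨C, hC⟩ := exists_norm_degreePart_le hf hn s
  refine Integrable.mono' ((integrableOn_cut D n hs).const_mul _)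
    (aestronglyMeasurable_hypVol (continuousOn_degreePart hf s l)).restrict
    ((ae_restrict_of_ae ae_mem_H3).mono fun P hP => hC P hP l)

lemma sum_integral_coeff_mul_HSeries (hD : Squarefree D) (hF : IsFundDomain D F)
    (hf : IsTestFunction f) (hs : 1 < s.re) (l : ℕ) :
    ((GamInf' D).relIndex (GamInf D) : ℂ) * ∑ m ∈ Finset.Icc (-(l : ℤ)) l,
      ∑ k ∈ Finset.Icc (-(l : ℤ)) l,
        sphHarm l m east * ∫ P in F, coeff f l k P * HSeries D l k m P s ∂hypVol =
      2 * ∫ P in strip D, degreePart f s l P ∂hypVol := by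
  have hH := coeff_mul_HSeries (s := s) hD hF hf hs l
  have h1 := hasSum_sum (s := Finset.Icc (-(l : ℤ)) l) fun m _ =>
    hasSum_sum (s := Finset.Icc (-(l : ℤ)) l) fun k _ => ((hH k m).2.2.mul_left (sphHarm l m east))
  have h2 := hasSum_unfold hD hF (aestronglyMeasurable_hypVol (continuousOn_degreePart hf s l))
    (integrableOn_degreePart hf hs l) fun τ hτ P hP => by
      rw [degreePart, degreePart, proj_act_unip l hτ hP]
      simp [act_unip hτ]
  have he : ∀ σ : Cosets D, ∑ m ∈ Finset.Icc (-(l : ℤ)) l, ∑ k ∈ Finset.Icc (-(l : ℤ)) l,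
      sphHarm l m east * ∫ P in F, coeff f l k P * HTerm l k m P s (σ.out : Gam D) ∂hypVol =
      ∫ P in F, degreePart f s l (act (σ.out : Gam D) P) ∂hypVol := by
    intro σ
    have hi : ∀ m k, Integrable (fun P => sphHarm l m east *
        (coeff f l k P * HTerm l k m P s (σ.out : Gam D))) (hypVol.restrict F) := fun m k =>
      ((hH k m).1 σ).const_mul _
    simp only [← integral_const_mul]
    rw [Finset.sum_congr rfl fun m _ => (integral_finsetSum _ fun k _ => hi m k).symm,
      ← integral_finsetSum _ fun m _ => integrable_finsetSum _ fun k _ => hi m k]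
    refine integral_congr_ae ((ae_restrict_of_ae ae_mem_H3).mono fun P hP => ?_)
    exact sum_coeff_mul_HTerm hf s l σ.out.2 hP
  simp only [he] at h1
  rw [← h1.unique h2, Finset.mul_sum]
  refine Finset.sum_congr rfl fun m _ => ?_
  rw [Finset.mul_sum]
  refine Finset.sum_congr rfl fun k _ => ?_
  ring

lemma hasSum_degreePart (hf : IsTestFunction f) (s : ℂ) {P : ℂ × ℝ} (hP : P ∈ H3) :
    HasSum (fun l => degreePart f s l P) ((P.2 : ℂ) ^ (1 + s) * fib f P east) :=
  (hasSum_proj hf hP east_mem_sph).mul_left _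

/-- Dominated convergence with the majorants `(l+1)^(-3/2)` times `cut`, summable in `l` and
integrable over the strip. -/
lemma hasSum_integral_degreePart (hf : IsTestFunction f) (hs : 1 < s.re) :
    HasSum (fun l => ∫ P in strip D, degreePart f s l P ∂hypVol)
      (∫ P in strip D, (P.2 : ℂ) ^ (1 + s) * fib f P east ∂hypVol) := by
  obtain ⟨n, hn⟩ := hf.exists_box
  obtain ⟨C, hC⟩ := exists_norm_degreePart_le hf hn s
  have hmem : ∀ᵐ P ∂hypVol.restrict (strip D), P ∈ H3 := ae_restrict_of_ae ae_mem_H3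
  refine hasSum_integral_of_dominated_convergence
    (fun l P => C * ((l : ℝ) + 1) ^ (-(3 / 2 : ℝ)) * cut D n s.re P)
    (fun l => (aestronglyMeasurable_hypVol (continuousOn_degreePart hf s l)).restrict)
    (fun l => hmem.mono fun P hP => hC P hP l)
    (Filter.Eventually.of_forall fun P => (summable_rate.mul_left C).mul_right _) ?_
    (hmem.mono fun P hP => hasSum_degreePart hf s hP)
  simp only [tsum_mul_right]
  exact (integrableOn_cut D n hs).const_mul _

lemma integrableOn_cpow_mul_fib (hf : IsTestFunction f) (hs : 1 < s.re) :
    IntegrableOn (fun P => (P.2 : ℂ) ^ (1 + s) * fib f P east) (strip D) hypVol := by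
  obtain ⟨n, hn⟩ := hf.exists_box
  obtain ⟨M, hM⟩ := hf.exists_bound
  refine Integrable.mono' ((integrableOn_cut D n hs).const_mul M) (aestronglyMeasurable_hypVol
    ((continuousOn_im_cpow s).mul (continuousOn_fib_left hf east_mem_sph))).restrict
    ((ae_restrict_of_ae ae_mem_H3).mono fun P hP => ?_)
  exact norm_cpow_mul_le_cut (g := fun P => fib f P east) hP (fun h => fib_eq_zero hn h _)
    (hM P hP _ east_mem_sph) s

lemma mellinIntegrand_eq (s : ℂ) {r : ℝ} (hr : 0 < r) : mellinIntegrand f s r = 1 / (area D : ℂ) *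
    ∫ z in cell D, (1 / r ^ 3 : ℝ) • ((r : ℂ) ^ (1 + s) * fib f (z, r) east) := by
  have hr' : (r : ℂ) ≠ 0 := Complex.ofReal_ne_zero.2 hr.ne'
  have h : (r : ℂ) ^ (s - 2) = ((1 / r ^ 3 : ℝ) : ℂ) * (r : ℂ) ^ (1 + s) := by
    -- The exponent `s - 2` is `1 + s` less the 3 supplied by the hyperbolic volume.
    rw [show s - 2 = 1 + s - (3 : ℕ) by push_cast; ring, Complex.cpow_sub _ _ hr', Complex.cpow_natCast]
    push_cast
    ring
  simp only [Complex.real_smul, ← mul_assoc, ← h]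
  rw [integral_const_mul, mellinIntegrand, nu]
  simp only [fib, east]
  ring

lemma integrable_stripMeas (hf : IsTestFunction f) (hs : 1 < s.re) :
    Integrable (fun P : ℂ × ℝ => (1 / P.2 ^ 3 : ℝ) • ((P.2 : ℂ) ^ (1 + s) * fib f P east))
      ((volume.restrict (cell D)).prod (volume.restrict (Ioi 0))) :=
  (integrableOn_strip_iff D).1 (integrableOn_cpow_mul_fib hf hs)

theorem integrableOn_mellinIntegrand (hf : IsTestFunction f) (hs : 1 < s.re) :
    IntegrableOn (mellinIntegrand f s) (Ioi 0) := by
  refine Integrable.congr ((integrable_stripMeas hf hs).integral_prod_right.const_mul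
    (1 / (area D : ℂ))) ?_
  filter_upwards [ae_restrict_mem measurableSet_Ioi] with r hr
  exact (mellinIntegrand_eq s hr).symm

theorem mellinTransform_eq (hf : IsTestFunction f) (hs : 1 < s.re) : mellinTransform f s =
    1 / (area D : ℂ) * ∫ P in strip D, (P.2 : ℂ) ^ (1 + s) * fib f P east ∂hypVol := by
  rw [integral_strip, stripMeas, integral_prod_symm _ (integrable_stripMeas hf hs), mellinTransform,
    ← integral_const_mul]
  exact setIntegral_congr_fun measurableSet_Ioi fun r hr => mellinIntegrand_eq s hr

theorem hasSum_mellinTransform (hD : Squarefree D) (hF : IsFundDomain D F) (hf : IsTestFunction f)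
    (hs : 1 < s.re) :
    HasSum (fun l : ℕ => (cuspIndexPSL D : ℂ) / (area D : ℂ) *
        ∑ m ∈ Finset.Icc (-(l : ℤ)) l, ∑ k ∈ Finset.Icc (-(l : ℤ)) l,
          sphHarm l m (1, 0) * ∫ P in F, coeff f l k P * HSeries D l k m P s ∂hypVol)
      (mellinTransform f s) := by
  rw [mellinTransform_eq hf hs]
  refine ((hasSum_integral_degreePart hf hs).mul_left _).congr_fun fun l => ?_
  have h := sum_integral_coeff_mul_HSeries hD hF hf hs l
  -- The 2 in the index cancels the 2 from unfolding, leaving the index in `PSL(2,ℂ)`.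
  rw [relIndex_eq] at h
  push_cast at h
  rw [mul_assoc] at h
  have h' := mul_left_cancel₀ two_ne_zero h
  rw [← h', east]
  ring

end Mellin

end Bianchi

end

theorem mainTheorem4 (D : ℕ) (hD : Squarefree D)
    (F : Set (ℂ × ℝ)) (hF : IsFundDomain D F)
    (f : T1M D → ℂ) (hf : IsTestFunction f) (s : ℂ) (hs : 1 < s.re) :
    -- the Mellin integral converges absolutely
    MeasureTheory.IntegrableOn (mellinIntegrand f s) (Set.Ioi 0) ∧
    -- the series defining `H^l_{km}(P, s)` converge absolutely
    (∀ (l : ℕ), ∀ m ∈ Finset.Icc (-(l : ℤ)) l, ∀ k ∈ Finset.Icc (-(l : ℤ)) l, ∀ P ∈ H3,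
      Summable fun σ : Cosets D => HTerm l k m P s (σ.out : Gam D)) ∧
    -- the integrals over the fundamental domain converge absolutely
    (∀ (l : ℕ), ∀ m ∈ Finset.Icc (-(l : ℤ)) l, ∀ k ∈ Finset.Icc (-(l : ℤ)) l,
      MeasureTheory.IntegrableOn (fun P => coeff f l k P * HSeries D l k m P s) F hypVol) ∧
    -- the formula for the Mellin transform
    HasSum
      (fun l : ℕ => (cuspIndexPSL D : ℂ) / (area D : ℂ) *
        ∑ m ∈ Finset.Icc (-(l : ℤ)) l, ∑ k ∈ Finset.Icc (-(l : ℤ)) l,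
          sphHarm l m (1, 0) * ∫ P in F, coeff f l k P * HSeries D l k m P s ∂hypVol)
      (mellinTransform f s) := by
  exact ⟨integrableOn_mellinIntegrand hf hs, fun l m _ k _ P hP => summable_HTerm hD hs l k m hP,
    fun l m _ k _ => (coeff_mul_HSeries hD hF hf hs l k m).2.1, hasSum_mellinTransform hD hF hf hs⟩
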